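/- For $x,y\in\omega^\omega$ write $x\le^* y$ if $x(n)\le y(n)$ for all but finitely many $n$. Let $\mathbb{D}_{nd}$ be the nondecreasing Hechler forcing: conditions are pairs $\langle s,f\rangle$ with $s\in\omega^{<\omega}$ nondecreasing and $f\in\omega^\omega$, ordered by $\langle s',f'\rangle\le\langle s,f\rangle$ iff $s\subseteq s'$, $f(n)\le f'(n)$ for all $n$, and $f(n)\le s'(n)$ for all $n\in|s'|\setminus|s|$. In a generic extension of $V$, a real $y\in\omega^\omega$ is called dominating if $f\le^* y$ for all $f\in V\cap\omega^\omega$. (1) Let $V[d]$ be a generic extension of $V$ by $\mathbb{D}_{nd}$ and let $\langle d_n:n\in\omega\rangle\in V[d]$ be a sequence of dominating reals. Then there is a single dominating real $d^*\in V[d]$ such that $d^*\le^* d_n$ for every $n\in\omega$. (Equivalently: every condition of $\mathbb{D}_{nd}$ forces this statement.) (2) It is consistent with ZFC (that is, there is a model of ZFC in which it is true) that there is a family $\mathcal{F}\subseteq\omega^\omega$, bounded in $(\omega^\omega,\le^*)$, with $\mathfrak{b}(\mathcal{F})=\mathfrak{b}^\downarrow(\mathcal{F})=\mathfrak{b}$.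 Here $\mathcal{F}^\downarrow$ is the set of all $y\in\omega^\omega$ with $f\le^* y$ for all $f\in\mathcal{F}$; $\mathfrak{b}(\mathcal{F})$ is the least cardinality of a set $\mathcal{H}\subseteq\mathcal{F}$ that has no $\le^*$-upper bound in $\mathcal{F}$; $\mathfrak{b}^\downarrow(\mathcal{F})$ is the least cardinality of a set $\mathcal{H}\subseteq\mathcal{F}^\downarrow$ that has no $\le^*$-lower bound in $\mathcal{F}^\downarrow$; and $\mathfrak{b}=\mathfrak{b}(\omega^\omega)$. -/

import Mathlib

universe u v

/-! ## Formulas of the language of set theory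

`SetFml U` is the type of formulas of the language `{∈, =}` whose free variables have been replaced
by elements of `U` (in the forcing language, `U` is the class of names). A quantifier carries the
family of its instances. All concrete formulas below are uniform in `U`, so they are ordinary
first-order formulas. -/

inductive SetFml (U : Type*) where
  | bot : SetFml U
  | eq (x y : U) : SetFml U
  | mem (x y : U) : SetFml U
  | imp (φ ψ : SetFml U) : SetFml U
  | all (φ : U → SetFml U) : SetFml U

namespace SetFml

infix:60 " ≐ " => SetFml.eq
infix:60 " ∈' " => SetFml.mem
infixr:30 " ⟶' " => SetFml.imp

variable {U : Type*}

def not (φ : SetFml U) : SetFml U := φ ⟶' bot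
def and (φ ψ : SetFml U) : SetFml U := not (φ ⟶' not ψ)
def or (φ ψ : SetFml U) : SetFml U := not φ ⟶' ψ
def iff (φ ψ : SetFml U) : SetFml U := and (φ ⟶' ψ) (ψ ⟶' φ)
def ex (φ : U → SetFml U) : SetFml U := not (all fun x => not (φ x))

infixr:35 " ⋏ " => SetFml.and
infixr:32 " ⋎ " => SetFml.or
infix:25 " ⟷' " => SetFml.iff

/-- bounded quantifiers `∀ x ∈ a` and `∃ x ∈ a` -/
def allIn (a : U) (φ : U → SetFml U) : SetFml U := all fun x => x ∈' a ⟶' φ x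
def exIn (a : U) (φ : U → SetFml U) : SetFml U := ex fun x => x ∈' a ⋏ φ x

/-- `a ⊆ b` -/
def sub (a b : U) : SetFml U := allIn a fun x => x ∈' b

/-- `z = {x, y}` -/
def isPair (z x y : U) : SetFml U := all fun w => w ∈' z ⟷' (w ≐ x ⋎ w ≐ y)

/-- `z = (x, y) = {{x}, {x, y}}` -/
def isOPair (z x y : U) : SetFml U :=
  ex fun a => ex fun b => isPair a x x ⋏ isPair b x y ⋏ isPair z a b

/-- `a = ∅` -/
def isEmpty (a : U) : SetFml U := all fun x => not (x ∈' a)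

/-- `y = x ∪ {x}` -/
def isSucc (y x : U) : SetFml U := all fun w => w ∈' y ⟷' (w ∈' x ⋎ w ≐ x)

/-- `i` contains `∅` and is closed under successors -/
def isInductive (i : U) : SetFml U :=
  (exIn i fun e => isEmpty e) ⋏ (allIn i fun x => exIn i fun y => isSucc y x)

/-- `o = ω`, the least inductive set -/
def isOmega (o : U) : SetFml U := isInductive o ⋏ all fun i => isInductive i ⟶' sub o i

/-- `(x, y) ∈ f`; for a function `f` this says `f(x) = y` -/
def app (f x y : U) : SetFml U := exIn f fun z => isOPair z x y

/-- `f` is a function from `a` to `b` -/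
def isFun (f a b : U) : SetFml U :=
  (allIn f fun z => exIn a fun x => exIn b fun y => isOPair z x y) ⋏
  (allIn a fun x => exIn b fun y => app f x y ⋏ all fun y' => app f x y' ⟶' y' ≐ y)

/-- `f` is injective -/
def isInj (f : U) : SetFml U :=
  all fun x => all fun x' => all fun y => app f x y ⟶' app f x' y ⟶' x ≐ x'

/-- `|a| ≤ |b|` -/
def cardLE (a b : U) : SetFml U := ex fun f => isFun f a b ⋏ isInj f

/-- `|a| = |b|`: there is a bijection -/
def cardEq (a b : U) : SetFml U :=
  ex fun f => isFun f a b ⋏ isInj f ⋏ (allIn b fun y => exIn a fun x => app f x y)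

/-- `x ≤* y` for `x, y : ω → ω`, where `o` is `ω`; on `ω`, `i ≤ j` is `i ⊆ j`. -/
def leStar (o x y : U) : SetFml U :=
  exIn o fun N => allIn o fun n => sub N n ⟶'
    all fun i => all fun j => app x n i ⟶' app y n j ⟶' sub i j

/-- `y` is a real which eventually dominates every member of `F` (where `o` is `ω`). With `F` the
set of ground model reals: `y` is a dominating real. -/
def isDominating (o F y : U) : SetFml U := isFun y o o ⋏ allIn F fun f => leStar o f y

/-- Every sequence `(d_n : n ∈ ω)` of reals dominating `F` has a real `e` which also dominates `F`
and satisfies `e ≤* d_n` for all `n`. -/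
def countableLowerBounds (F : U) : SetFml U :=
  all fun o => isOmega o ⟶' all fun s => all fun c => isFun s o c ⟶'
    (allIn o fun n => all fun y => app s n y ⟶' isDominating o F y) ⟶'
    ex fun e => isDominating o F e ⋏
      allIn o fun n => all fun y => app s n y ⟶' leStar o e y

/-- `H ⊆ X` is unbounded in `(X, le)`: no element of `X` is above all elements of `H`. -/
def isUnboundedIn (le : U → U → SetFml U) (X H : U) : SetFml U :=
  sub H X ⋏ not (exIn X fun y => allIn H fun h => le h y)

/-- `min {|H| : H ⊆ X is unbounded in (X, le)} = |κ|` (in particular there is such an `H`) -/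
def isBoundingNumber (le : U → U → SetFml U) (X κ : U) : SetFml U :=
  (ex fun H => isUnboundedIn le X H ⋏ cardEq H κ) ⋏
  (all fun H => isUnboundedIn le X H ⟶' cardLE κ H)

/-- There is a bounded family `F ⊆ ω^ω` with `𝔟(F) = 𝔟↓(F) = 𝔟`. Here `R = ω^ω`, `D = F↓` is the set
of all reals dominating `F`, and `κ` is a set of the common cardinality. -/
def existsLaflammeFamily : SetFml U :=
  ex fun o => ex fun R => ex fun F => ex fun D => ex fun κ =>
    isOmega o ⋏ (all fun f => f ∈' R ⟷' isFun f o o) ⋏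
    sub F R ⋏ (exIn R fun g => allIn F fun f => leStar o f g) ⋏
    (all fun y => y ∈' D ⟷' isDominating o F y) ⋏
    isBoundingNumber (fun x y => leStar o x y) F κ ⋏
    isBoundingNumber (fun x y => leStar o y x) D κ ⋏
    isBoundingNumber (fun x y => leStar o x y) R κ

/-- Truth of a formula in the structure `(M, E)`. -/
def Holds {M : Type*} (E : M → M → Prop) : SetFml M → Prop
  | bot => False
  | eq x y => x = y
  | mem x y => E x y
  | imp φ ψ => Holds E φ → Holds E ψ
  | all φ => ∀ x, Holds E (φ x)

end SetFml

/-! ## Models of ZFC -/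

/-- the only symbol of the language of set theory -/
inductive MemSymbol : ℕ → Type
  | mem : MemSymbol 2

/-- the first-order language with a single binary relation symbol -/
def memLanguage : FirstOrder.Language := ⟨fun _ => Empty, MemSymbol⟩

/-- `(M, E)` as a structure for `memLanguage` -/
@[reducible] def memStructure {M : Type*} (E : M → M → Prop) : memLanguage.Structure M where
  funMap := fun f _ => nomatch f
  RelMap {n} r := match n, r with
    | _, MemSymbol.mem => fun v => E (v 0) (v 1)

/-- `(M, E)` is a model of ZFC. The schemas range over the relations on `M` that are first-order
definable in `(M, E)` with parameters from `M`. -/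
structure IsModelZFC {M : Type*} (E : M → M → Prop) : Prop where
  extensionality : ∀ a b, (∀ z, E z a ↔ E z b) → a = b
  foundation : ∀ a, (∃ z, E z a) → ∃ z, E z a ∧ ∀ w, E w z → ¬ E w a
  pairing : ∀ x y, ∃ c, ∀ z, E z c ↔ z = x ∨ z = y
  union : ∀ a, ∃ u, ∀ z, E z u ↔ ∃ w, E w a ∧ E z w
  powerset : ∀ a, ∃ b, ∀ z, E z b ↔ ∀ w, E w z → E w a
  infinity : ∃ o, (∃ e, E e o ∧ ∀ z, ¬ E z e) ∧
    ∀ x, E x o → ∃ y, E y o ∧ ∀ z, E z y ↔ E z x ∨ z = x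
  separation : letI := memStructure E
    ∀ S : Set M, Set.univ.Definable₁ memLanguage S → ∀ a, ∃ b, ∀ z, E z b ↔ E z a ∧ z ∈ S
  replacement : letI := memStructure E
    ∀ R : Set (M × M), Set.univ.Definable₂ memLanguage R → ∀ a,
      (∀ x, E x a → ∃! y, (x, y) ∈ R) → ∃ b, ∀ y, E y b ↔ ∃ x, E x a ∧ (x, y) ∈ R
  choice : ∀ a, (∀ x, E x a → ∃ z, E z x) →
    (∀ x y z, E x a → E y a → E z x → E z y → x = y) →
    ∃ c, ∀ x, E x a → ∃! z, E z x ∧ E z c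

/-! ## Forcing over the universe -/

/-- `P`-names: sets of pairs (name, condition) -/
inductive PName (P : Type v) : Type (max (u + 1) v)
  | mk (ι : Type u) (name : ι → PName P) (cond : ι → P) : PName P

namespace PName

variable {P : Type v} [Preorder P]

/-- `x.ForcesEq y p` is `p ⊩ x = y`: below `p`, every condition of an element of `x` can be
extended to force that element to be equal to an element of `y`, and conversely. -/
def ForcesEq : PName.{u, v} P → PName.{u, v} P → P → Prop
  | mk ι a c, mk κ b d, p =>
    (∀ i : ι, ∀ q ≤ p, q ≤ c i → ∃ r ≤ q, ∃ j : κ, r ≤ d j ∧ ForcesEq (a i) (b j) r) ∧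
    (∀ j : κ, ∀ q ≤ p, q ≤ d j → ∃ r ≤ q, ∃ i : ι, r ≤ c i ∧ ForcesEq (a i) (b j) r)

/-- `x.ForcesMem y p` is `p ⊩ x ∈ y`: densely often below `p`, `x` is forced to be equal to an
element of `y`. -/
def ForcesMem (x : PName.{u, v} P) : PName.{u, v} P → P → Prop
  | mk κ b d, p => ∀ q ≤ p, ∃ r ≤ q, ∃ j : κ, r ≤ d j ∧ ForcesEq x (b j) r

/-- the canonical name of a ground model set -/
def check [OrderTop P] : PSet.{u} → PName.{u, v} P
  | PSet.mk α A => mk α (fun i => check (A i)) (fun _ => ⊤)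

/-- the canonical name of `V ∩ ω^ω`, the set of ground model reals -/
noncomputable def groundReals [OrderTop P] : PName.{u, v} P :=
  check (Quotient.out (ZFSet.funs ZFSet.omega ZFSet.omega))

end PName

/-- The forcing relation `p ⊩ φ`. The primitives `⊥, =, ∈, →, ∀` suffice: the other connectives are
their classical abbreviations, and the set of conditions forcing `φ` is regular open. -/
def Forces {P : Type v} [Preorder P] : P → SetFml (PName.{u, v} P) → Prop
  | _, .bot => False
  | p, .eq x y => PName.ForcesEq x y p
  | p, .mem x y => PName.ForcesMem x y p
  | p, .imp φ ψ => ∀ q ≤ p, Forces q φ → Forces q ψ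
  | p, .all φ => ∀ x, Forces p (φ x)

/-! ## Nondecreasing Hechler forcing -/

/-- conditions `⟨s, f⟩` of `𝔻_nd`: a nondecreasing stem `s ∈ ω^{<ω}` and a commitment `f ∈ ω^ω` -/
structure HechlerND where
  stem : List ℕ
  nondecreasing : stem.Pairwise (· ≤ ·)
  commit : ℕ → ℕ

namespace HechlerND

/-- `⟨s', f'⟩ ≤ ⟨s, f⟩` iff `s ⊆ s'`, `f ≤ f'` everywhere, and `f(n) ≤ s'(n)` for all
`n ∈ |s'| \ |s|` -/
instance : Preorder HechlerND where
  le q p := p.stem <+: q.stem ∧ (∀ n, p.commit n ≤ q.commit n) ∧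
    ∀ n (h : n < q.stem.length), p.stem.length ≤ n → p.commit n ≤ q.stem[n]
  le_refl p := ⟨List.prefix_refl _, fun _ => le_rfl, fun _ h h' => absurd h (not_lt.2 h')⟩
  le_trans r q p hrq hqp := by
    refine ⟨hqp.1.trans hrq.1, fun n => (hqp.2.1 n).trans (hrq.2.1 n), fun n h hn => ?_⟩
    by_cases hq : n < q.stem.length
    · have h1 := hqp.2.2 n hq hn
      rwa [hrq.1.getElem hq] at h1
    · exact (hqp.2.1 n).trans (hrq.2.2 n h (not_lt.1 hq))

/-- the weakest condition `⟨∅, 0⟩` -/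
instance : OrderTop HechlerND where
  top := ⟨[], List.Pairwise.nil, fun _ => 0⟩
  le_top _ := ⟨List.nil_prefix, fun _ => Nat.zero_le _, fun _ _ _ => Nat.zero_le _⟩

end HechlerND

/-! Part (1). Let `d` be the generic real. If `g` and `h` are ground model functions tending to
infinity, then `n ↦ g (d (h n))` is still dominating (`isDominating_slowName`). These slowed-down
reals are coinitial among the dominating reals: if a condition forces `y` to be dominating, some
extension puts one of them below `y` (`exists_slowName_le`). The reason is that `y` dominates a
ground model function bounding the small values that short stems cannot avoid. So for large `n` a
short stem can avoid any finite set of values of `y n` by raising its commitment alone. That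
commitment is compatible with any condition whose stem jumps far enough at an early place. A very
large value of `d` at `H n` produces such a jump, so `y n` cannot be small when `d (H n)` is large.
Conditions with the same stem are compatible and there are only countably many stems. A sequence of
names therefore needs only countably many pairs `(g, h)`, and a pair growing more slowly than all of
them gives the common lower bound. The comparison uses that `d` is nondecreasing.

Part (2). `GapCond` is a countably closed forcing, so it adds no reals. It adds a tight gap in
`2^ω`: the lower half is `F`, and splitting shows that the upper half is exactly `F↓`. It also adds
an enumeration of all reals in which every proper initial segment is countable. Countable subsets of
the lower half, of the upper half and of `ω^ω` are bounded in the relevant direction, so unbounded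
subsets are uncountable; by the enumeration they have the size of the continuum. Hence the three
bounding numbers coincide. To obtain an actual model, formulas are coded by the countable type
`Fml`, and a descending sequence of conditions is built that decides every formula about countably
many names and supplies counterexamples to refuted universal statements. The names modulo forced
equality form a structure whose truths are the forced statements (`holds_iff_forced`), so it
suffices that the ZFC axioms and the existence of the family are forced. -/

/-! ## The forcing relation -/

namespace PName

variable {P : Type v}

/-- the index type of a name -/
def Idx : PName.{u, v} P → Type u
  | mk ι _ _ => ι

/-- the elements of a name -/
def elt : (x : PName.{u, v} P) → x.Idx → PName.{u, v} P
  | mk _ a _ => a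

/-- the conditions attached to the elements of a name -/
def cnd : (x : PName.{u, v} P) → x.Idx → P
  | mk _ _ c => c

@[elab_as_elim]
theorem elt_induction {motive : PName.{u, v} P → Prop} (x : PName.{u, v} P)
    (h : ∀ x, (∀ i, motive (elt x i)) → motive x) : motive x := by
  induction x with
  | mk ι a c ih => exact h _ ih

variable [Preorder P]

theorem forcesEq_iff {x y : PName.{u, v} P} {p : P} :
    ForcesEq x y p ↔
      (∀ i, ∀ q ≤ p, q ≤ x.cnd i → ∃ r ≤ q, ∃ j, r ≤ y.cnd j ∧ ForcesEq (x.elt i) (y.elt j) r) ∧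
      (∀ j, ∀ q ≤ p, q ≤ y.cnd j →
        ∃ r ≤ q, ∃ i, r ≤ x.cnd i ∧ ForcesEq (x.elt i) (y.elt j) r) := by
  cases x; cases y
  rw [ForcesEq]; rfl

theorem forcesMem_iff {x y : PName.{u, v} P} {p : P} :
    ForcesMem x y p ↔ ∀ q ≤ p, ∃ r ≤ q, ∃ j, r ≤ y.cnd j ∧ ForcesEq x (y.elt j) r := by
  cases y; rfl

theorem ForcesEq.mono {x y : PName.{u, v} P} {p q : P} (h : ForcesEq x y p) (hq : q ≤ p) :
    ForcesEq x y q := by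
  rw [forcesEq_iff] at h ⊢
  exact ⟨fun i r hr => h.1 i r (hr.trans hq), fun i r hr => h.2 i r (hr.trans hq)⟩

theorem ForcesMem.mono {x y : PName.{u, v} P} {p q : P} (h : ForcesMem x y p) (hq : q ≤ p) :
    ForcesMem x y q := by
  rw [forcesMem_iff] at h ⊢
  exact fun r hr => h r (hr.trans hq)

theorem ForcesEq.of_dense {x y : PName.{u, v} P} {p : P}
    (h : ∀ q ≤ p, ∃ r ≤ q, ForcesEq x y r) : ForcesEq x y p := by
  rw [forcesEq_iff]
  refine ⟨fun i q hq hi => ?_, fun i q hq hi => ?_⟩ <;> obtain ⟨r, hr, h1⟩ := h q hq <;>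
    rw [forcesEq_iff] at h1
  · obtain ⟨s, hs, h2⟩ := h1.1 i r le_rfl (hr.trans hi)
    exact ⟨s, hs.trans hr, h2⟩
  · obtain ⟨s, hs, h2⟩ := h1.2 i r le_rfl (hr.trans hi)
    exact ⟨s, hs.trans hr, h2⟩

theorem ForcesMem.of_dense {x y : PName.{u, v} P} {p : P}
    (h : ∀ q ≤ p, ∃ r ≤ q, ForcesMem x y r) : ForcesMem x y p := by
  rw [forcesMem_iff]
  intro q hq
  obtain ⟨r, hr, h1⟩ := h q hq
  rw [forcesMem_iff] at h1
  obtain ⟨s, hs, h2⟩ := h1 r le_rfl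
  exact ⟨s, hs.trans hr, h2⟩

theorem forcesEq_refl (x : PName.{u, v} P) (p : P) : ForcesEq x x p := by
  induction x using elt_induction generalizing p with
  | h x ih =>
    rw [forcesEq_iff]
    exact ⟨fun i q _ hi => ⟨q, le_rfl, i, hi, ih i q⟩, fun i q _ hi => ⟨q, le_rfl, i, hi, ih i q⟩⟩

theorem ForcesEq.symm {x y : PName.{u, v} P} {p : P} (h : ForcesEq x y p) : ForcesEq y x p := by
  induction x using elt_induction generalizing y p with
  | h x ih =>
    rw [forcesEq_iff] at h ⊢
    refine ⟨fun i q hq hi => ?_, fun i q hq hi => ?_⟩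
    · obtain ⟨r, hr, j, hj, h1⟩ := h.2 i q hq hi
      exact ⟨r, hr, j, hj, ih j h1⟩
    · obtain ⟨r, hr, j, hj, h1⟩ := h.1 i q hq hi
      exact ⟨r, hr, j, hj, ih i h1⟩

theorem ForcesEq.trans {x y z : PName.{u, v} P} {p : P} (h : ForcesEq x y p)
    (h' : ForcesEq y z p) : ForcesEq x z p := by
  induction x using elt_induction generalizing y z p with
  | h x ih =>
    rw [forcesEq_iff] at h h' ⊢
    refine ⟨fun i q hq hi => ?_, fun i q hq hi => ?_⟩
    · obtain ⟨r, hr, j, hj, h1⟩ := h.1 i q hq hi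
      obtain ⟨s, hs, k, hk, h2⟩ := h'.1 j r (hr.trans hq) hj
      exact ⟨s, hs.trans hr, k, hk, ih i (h1.mono hs) h2⟩
    · obtain ⟨r, hr, j, hj, h1⟩ := h'.2 i q hq hi
      obtain ⟨s, hs, k, hk, h2⟩ := h.2 j r (hr.trans hq) hj
      exact ⟨s, hs.trans hr, k, hk, ih k h2 (h1.mono hs)⟩

theorem ForcesMem.congr {x x' y y' : PName.{u, v} P} {p : P} (h : ForcesMem x y p)
    (hx : ForcesEq x x' p) (hy : ForcesEq y y' p) : ForcesMem x' y' p := by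
  rw [forcesMem_iff] at h ⊢
  rw [forcesEq_iff] at hy
  intro q hq
  obtain ⟨r, hr, j, hj, h1⟩ := h q hq
  obtain ⟨s, hs, k, hk, h2⟩ := hy.1 j r (hr.trans hq) hj
  exact ⟨s, hs.trans hr, k, hk, ((hx.mono (hs.trans (hr.trans hq))).symm.trans (h1.mono hs)).trans h2⟩

theorem forcesMem_elt {y : PName.{u, v} P} {p : P} (j : y.Idx) (hp : p ≤ y.cnd j) :
    ForcesMem (y.elt j) y p := by
  rw [forcesMem_iff]
  exact fun q hq => ⟨q, le_rfl, j, hq.trans hp, forcesEq_refl _ _⟩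

end PName

namespace Forces

open SetFml

variable {P : Type v} [Preorder P] {p q : P} {φ ψ χ φ' ψ' : SetFml (PName.{u, v} P)}
  {x y z x' y' z' a b : PName.{u, v} P} {Φ Ψ : PName.{u, v} P → SetFml (PName.{u, v} P)}

theorem mono (h : Forces p φ) (hq : q ≤ p) : Forces q φ := by
  induction φ generalizing p q with
  | bot => exact h
  | eq x y => exact PName.ForcesEq.mono h hq
  | mem x y => exact PName.ForcesMem.mono h hq
  | imp φ ψ _ _ => exact fun r hr => h r (hr.trans hq)
  | all Φ ih => exact fun x => ih x (h x) hq

/-- The atomic clauses have this property, and it passes through `imp` and `all`. It makes classical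
reasoning about forced statements possible: goals may be verified densely below `p`. -/
theorem of_dense (h : ∀ q ≤ p, ∃ r ≤ q, Forces r φ) : Forces p φ := by
  induction φ generalizing p with
  | bot => obtain ⟨r, _, hr⟩ := h p le_rfl; exact hr
  | eq x y => exact PName.ForcesEq.of_dense h
  | mem x y => exact PName.ForcesMem.of_dense h
  | imp φ ψ _ ih =>
    intro q hq h1
    refine ih fun r hr => ?_
    obtain ⟨s, hs, h2⟩ := h r (hr.trans hq)
    exact ⟨s, hs, h2 s le_rfl (h1.mono (hs.trans hr))⟩
  | all Φ ih =>
    refine fun x => ih x fun q hq => ?_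
    obtain ⟨s, hs, h2⟩ := h q hq
    exact ⟨s, hs, h2 x⟩

theorem not_iff : Forces p (SetFml.not φ) ↔ ∀ q ≤ p, ¬ Forces q φ := Iff.rfl

theorem exists_not (h : ¬ Forces p φ) : ∃ q ≤ p, Forces q (SetFml.not φ) := by
  by_contra! hc
  refine h (of_dense fun q hq => ?_)
  have := hc q hq
  rw [not_iff] at this
  push Not at this
  exact this

theorem decide (p : P) (φ : SetFml (PName.{u, v} P)) :
    ∃ q ≤ p, Forces q φ ∨ Forces q (SetFml.not φ) := by
  by_cases h : Forces p φ
  · exact ⟨p, le_rfl, Or.inl h⟩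
  · obtain ⟨q, hq, h⟩ := exists_not h
    exact ⟨q, hq, Or.inr h⟩

theorem and_iff : Forces p (φ ⋏ ψ) ↔ Forces p φ ∧ Forces p ψ := by
  constructor
  · intro h
    constructor
    · by_contra hc
      obtain ⟨q, hq, h'⟩ := exists_not hc
      exact h q hq fun r hr h1 => absurd h1 (h' r hr)
    · by_contra hc
      obtain ⟨q, hq, h'⟩ := exists_not hc
      exact h q hq fun r hr _ => h'.mono hr
  · exact fun h q hq h' => h' q le_rfl (h.1.mono hq) q le_rfl (h.2.mono hq)

theorem or_iff : Forces p (φ ⋎ ψ) ↔ ∀ q ≤ p, ∃ r ≤ q, Forces r φ ∨ Forces r ψ := by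
  constructor
  · intro h q hq
    obtain ⟨r, hr, h' | h'⟩ := decide q φ
    · exact ⟨r, hr, Or.inl h'⟩
    · exact ⟨r, hr, Or.inr (h r (hr.trans hq) h')⟩
  · intro h q hq h'
    refine of_dense fun r hr => ?_
    obtain ⟨s, hs, h1 | h1⟩ := h r (hr.trans hq)
    · exact absurd h1 (h' s (hs.trans hr))
    · exact ⟨s, hs, h1⟩

theorem iff_iff : Forces p (φ ⟷' ψ) ↔ ∀ q ≤ p, (Forces q φ ↔ Forces q ψ) :=
  and_iff.trans ⟨fun h q hq => ⟨h.1 q hq, h.2 q hq⟩,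
    fun h => ⟨fun q hq => (h q hq).1, fun q hq => (h q hq).2⟩⟩

theorem ex_iff : Forces p (ex Φ) ↔ ∀ q ≤ p, ∃ r ≤ q, ∃ x, Forces r (Φ x) := by
  constructor
  · intro h q hq
    by_contra! hc
    exact h q hq fun x r hr h' => hc r hr x h'
  · intro h q hq h'
    obtain ⟨r, hr, x, hx⟩ := h q hq
    exact h' x r hr hx

theorem ex_intro (x : PName.{u, v} P) (h : Forces p (Φ x)) : Forces p (ex Φ) :=
  ex_iff.2 fun q hq => ⟨q, le_rfl, x, h.mono hq⟩

/-- Witnesses found densely are enough, so no single name witnessing the existential (fullness) is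
ever needed. -/
theorem ex_elim (h : Forces p (ex Φ)) (h' : ∀ q ≤ p, ∀ x, Forces q (Φ x) → Forces q ψ) :
    Forces p ψ := by
  refine of_dense fun q hq => ?_
  obtain ⟨r, hr, x, hx⟩ := ex_iff.1 h q hq
  exact ⟨r, hr, h' r (hr.trans hq) x hx⟩

theorem or_elim (h : Forces p (φ ⋎ ψ)) (h1 : ∀ q ≤ p, Forces q φ → Forces q χ)
    (h2 : ∀ q ≤ p, Forces q ψ → Forces q χ) : Forces p χ := by
  refine of_dense fun q hq => ?_
  obtain ⟨r, hr, h' | h'⟩ := or_iff.1 h q hq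
  · exact ⟨r, hr, h1 r (hr.trans hq) h'⟩
  · exact ⟨r, hr, h2 r (hr.trans hq) h'⟩

theorem or_inl (h : Forces p φ) : Forces p (φ ⋎ ψ) :=
  or_iff.2 fun q hq => ⟨q, le_rfl, Or.inl (h.mono hq)⟩

theorem or_inr (h : Forces p ψ) : Forces p (φ ⋎ ψ) :=
  or_iff.2 fun q hq => ⟨q, le_rfl, Or.inr (h.mono hq)⟩

theorem exIn_iff : Forces p (exIn a Φ) ↔
    ∀ q ≤ p, ∃ r ≤ q, ∃ x, Forces r (x ∈' a) ∧ Forces r (Φ x) := by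
  simp only [exIn, ex_iff, and_iff]

theorem exIn_intro (x : PName.{u, v} P) (h : Forces p (x ∈' a)) (h' : Forces p (Φ x)) :
    Forces p (exIn a Φ) :=
  ex_intro x (and_iff.2 ⟨h, h'⟩)

theorem mem_iff : Forces p (x ∈' y) ↔
    ∀ q ≤ p, ∃ r ≤ q, ∃ j, r ≤ y.cnd j ∧ Forces r (x ≐ y.elt j) :=
  PName.forcesMem_iff

theorem eq_refl : Forces p (x ≐ x) := PName.forcesEq_refl x p

theorem eq_symm (h : Forces p (x ≐ y)) : Forces p (y ≐ x) := PName.ForcesEq.symm h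

theorem eq_trans (h : Forces p (x ≐ y)) (h' : Forces p (y ≐ z)) : Forces p (x ≐ z) :=
  PName.ForcesEq.trans h h'

theorem mem_congr (h : Forces p (x ∈' y)) (hx : Forces p (x ≐ x')) (hy : Forces p (y ≐ y')) :
    Forces p (x' ∈' y') := PName.ForcesMem.congr h hx hy

theorem mem_elt (j : y.Idx) (hp : p ≤ y.cnd j) : Forces p (y.elt j ∈' y) :=
  PName.forcesMem_elt j hp

/-- the axiom of extensionality -/
theorem eq_of_mem_iff (h : ∀ z, ∀ q ≤ p, (Forces q (z ∈' x) ↔ Forces q (z ∈' y))) :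
    Forces p (x ≐ y) := by
  refine PName.forcesEq_iff.2 ⟨fun i q hq hi => ?_, fun i q hq hi => ?_⟩
  · exact mem_iff.1 ((h _ q hq).1 (mem_elt i hi)) q le_rfl
  · obtain ⟨r, hr, j, hj, h1⟩ := mem_iff.1 ((h _ q hq).2 (mem_elt i hi)) q le_rfl
    exact ⟨r, hr, j, hj, eq_symm h1⟩

/-- To prove a forced statement about the elements of a name it suffices to look at the elements
of the name that are given by its indices. -/
theorem mem_elim (h : Forces p (x ∈' y))
    (h' : ∀ q ≤ p, ∀ j, q ≤ y.cnd j → Forces q (x ≐ y.elt j) → Forces q φ) : Forces p φ := by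
  refine of_dense fun q hq => ?_
  obtain ⟨r, hr, j, hj, h1⟩ := mem_iff.1 h q hq
  exact ⟨r, hr, h' r (hr.trans hq) j hj h1⟩

end Forces

/-! ### Congruence -/

/-- `φ` and `ψ` are equivalent below `p`. -/
def ForcedIff {P : Type v} [Preorder P] (p : P) (φ ψ : SetFml (PName.{u, v} P)) : Prop :=
  ∀ q ≤ p, (Forces q φ ↔ Forces q ψ)

namespace ForcedIff

open SetFml

variable {P : Type v} [Preorder P] {p q : P} {φ ψ χ φ' ψ' : SetFml (PName.{u, v} P)}
  {x y z o f x' y' z' o' f' a b a' b' : PName.{u, v} P}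
  {Φ Ψ : PName.{u, v} P → SetFml (PName.{u, v} P)}

theorem refl : ForcedIff p φ φ := fun _ _ => Iff.rfl

/-- Forced equality of names is weaker than identity, so substitution has to be justified along the
construction of each formula. -/
theorem eq (hx : Forces p (x ≐ x')) (hy : Forces p (y ≐ y')) : ForcedIff p (x ≐ y) (x' ≐ y') :=
  fun _ hq => ⟨fun h => ((hx.mono hq).eq_symm.eq_trans h).eq_trans (hy.mono hq),
    fun h => ((hx.mono hq).eq_trans h).eq_trans (hy.mono hq).eq_symm⟩

theorem mem (hx : Forces p (x ≐ x')) (hy : Forces p (y ≐ y')) : ForcedIff p (x ∈' y) (x' ∈' y') :=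
  fun _ hq => ⟨fun h => h.mem_congr (hx.mono hq) (hy.mono hq),
    fun h => h.mem_congr (hx.mono hq).eq_symm (hy.mono hq).eq_symm⟩

theorem imp (h : ForcedIff p φ φ') (h' : ForcedIff p ψ ψ') :
    ForcedIff p (φ ⟶' ψ) (φ' ⟶' ψ') :=
  fun _ hq => ⟨fun k r hr hφ => (h' r (hr.trans hq)).1 (k r hr ((h r (hr.trans hq)).2 hφ)),
    fun k r hr hφ => (h' r (hr.trans hq)).2 (k r hr ((h r (hr.trans hq)).1 hφ))⟩

theorem all (h : ∀ x, ForcedIff p (Φ x) (Ψ x)) : ForcedIff p (SetFml.all Φ) (SetFml.all Ψ) :=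
  fun q hq => ⟨fun k x => (h x q hq).1 (k x), fun k x => (h x q hq).2 (k x)⟩

theorem not (h : ForcedIff p φ φ') : ForcedIff p (SetFml.not φ) (SetFml.not φ') := h.imp refl

theorem and (h : ForcedIff p φ φ') (h' : ForcedIff p ψ ψ') : ForcedIff p (φ ⋏ ψ) (φ' ⋏ ψ') :=
  (h.imp h'.not).not

theorem or (h : ForcedIff p φ φ') (h' : ForcedIff p ψ ψ') : ForcedIff p (φ ⋎ ψ) (φ' ⋎ ψ') :=
  h.not.imp h'

theorem iff (h : ForcedIff p φ φ') (h' : ForcedIff p ψ ψ') : ForcedIff p (φ ⟷' ψ) (φ' ⟷' ψ') :=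
  (h.imp h').and (h'.imp h)

theorem ex (h : ∀ x, ForcedIff p (Φ x) (Ψ x)) : ForcedIff p (SetFml.ex Φ) (SetFml.ex Ψ) :=
  (all fun x => (h x).not).not

theorem allIn (ha : Forces p (a ≐ a')) (h : ∀ x, ForcedIff p (Φ x) (Ψ x)) :
    ForcedIff p (SetFml.allIn a Φ) (SetFml.allIn a' Ψ) :=
  all fun x => (mem Forces.eq_refl ha).imp (h x)

theorem exIn (ha : Forces p (a ≐ a')) (h : ∀ x, ForcedIff p (Φ x) (Ψ x)) :
    ForcedIff p (SetFml.exIn a Φ) (SetFml.exIn a' Ψ) :=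
  ex fun x => (mem Forces.eq_refl ha).and (h x)

theorem sub (ha : Forces p (a ≐ a')) (hb : Forces p (b ≐ b')) :
    ForcedIff p (SetFml.sub a b) (SetFml.sub a' b') :=
  allIn ha fun _ => mem Forces.eq_refl hb

theorem isPair (hz : Forces p (z ≐ z')) (hx : Forces p (x ≐ x')) (hy : Forces p (y ≐ y')) :
    ForcedIff p (SetFml.isPair z x y) (SetFml.isPair z' x' y') :=
  all fun _ => (mem Forces.eq_refl hz).iff ((eq Forces.eq_refl hx).or (eq Forces.eq_refl hy))

theorem isOPair (hz : Forces p (z ≐ z')) (hx : Forces p (x ≐ x')) (hy : Forces p (y ≐ y')) :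
    ForcedIff p (SetFml.isOPair z x y) (SetFml.isOPair z' x' y') :=
  ex fun _ => ex fun _ => (isPair Forces.eq_refl hx hx).and
    ((isPair Forces.eq_refl hx hy).and (isPair hz Forces.eq_refl Forces.eq_refl))

theorem isSucc (hy : Forces p (y ≐ y')) (hx : Forces p (x ≐ x')) :
    ForcedIff p (SetFml.isSucc y x) (SetFml.isSucc y' x') :=
  all fun _ => (mem Forces.eq_refl hy).iff ((mem Forces.eq_refl hx).or (eq Forces.eq_refl hx))

theorem app (hf : Forces p (f ≐ f')) (hx : Forces p (x ≐ x')) (hy : Forces p (y ≐ y')) :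
    ForcedIff p (SetFml.app f x y) (SetFml.app f' x' y') :=
  exIn hf fun _ => isOPair Forces.eq_refl hx hy

theorem isFun (hf : Forces p (f ≐ f')) (ha : Forces p (a ≐ a')) (hb : Forces p (b ≐ b')) :
    ForcedIff p (SetFml.isFun f a b) (SetFml.isFun f' a' b') :=
  (allIn hf fun _ => exIn ha fun _ => exIn hb fun _ => refl).and
    (allIn ha fun _ => exIn hb fun _ => (app hf Forces.eq_refl Forces.eq_refl).and
      (all fun _ => (app hf Forces.eq_refl Forces.eq_refl).imp refl))

theorem leStar (ho : Forces p (o ≐ o')) (hx : Forces p (x ≐ x')) (hy : Forces p (y ≐ y')) :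
    ForcedIff p (SetFml.leStar o x y) (SetFml.leStar o' x' y') :=
  exIn ho fun _ => allIn ho fun _ => refl.imp (all fun _ => all fun _ =>
    (app hx Forces.eq_refl Forces.eq_refl).imp ((app hy Forces.eq_refl Forces.eq_refl).imp refl))

theorem isDominating (ho : Forces p (o ≐ o')) (ha : Forces p (a ≐ a')) (hy : Forces p (y ≐ y')) :
    ForcedIff p (SetFml.isDominating o a y) (SetFml.isDominating o' a' y') :=
  (isFun hy ho ho).and (allIn ha fun _ => leStar ho Forces.eq_refl hy)

end ForcedIff

theorem Forces.congr {P : Type v} [Preorder P] {p : P} {φ ψ : SetFml (PName.{u, v} P)}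
    (h : Forces p φ) (h' : ForcedIff p φ ψ) : Forces p ψ := (h' p le_rfl).1 h

set_option linter.unusedSectionVars false

/-! ## Canonical names -/

namespace PName

variable {P : Type} [Preorder P] [OrderTop P]

/-- the name of the unordered pair -/
def upair (x y : PName.{u, 0} P) : PName.{u, 0} P :=
  mk (ULift Bool) (fun b => bif b.down then x else y) (fun _ => ⊤)

/-- the name of the ordered pair -/
def opair (x y : PName.{u, 0} P) : PName.{u, 0} P := upair (upair x x) (upair x y)

/-- the name of the set of all `nm i` for which the generic filter meets `A i` -/
def subName {ι : Type} (nm : ι → PName.{u, 0} P) (A : ι → P → Prop) : PName.{u, 0} P :=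
  mk (ULift {a : ι × P // A a.1 a.2}) (fun a => nm a.down.1.1) (fun a => a.down.1.2)

/-- the canonical name of a natural number -/
def nat (n : ℕ) : PName.{u, 0} P := check (PSet.ofNat n)

variable (P) in
/-- the canonical name of `ω` -/
def omega : PName.{u, 0} P := check PSet.omega

/-- a name of the set of all pairs `(nmA i, nmB k)` for which the generic filter meets `Q i k` -/
def relName {ι κ : Type} (nmA : ι → PName.{u, 0} P) (nmB : κ → PName.{u, 0} P)
    (Q : ι → κ → P → Prop) : PName.{u, 0} P :=
  subName (fun a : ι × κ => opair (nmA a.1) (nmB a.2)) (fun a => Q a.1 a.2)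

/-- the canonical name of a ground model real -/
def real (f : ℕ → ℕ) : PName.{u, 0} P := relName nat nat (fun n k _ => f n = k)

end PName

namespace Forces

open SetFml PName

variable {P : Type} [Preorder P] [OrderTop P] {p q : P} {φ ψ χ : SetFml (PName.{u, 0} P)}
  {x y z x' y' z' a b f : PName.{u, 0} P} {Φ Ψ : PName.{u, 0} P → SetFml (PName.{u, 0} P)}

theorem mem_upair_iff : Forces p (z ∈' upair x y) ↔ Forces p (z ≐ x ⋎ z ≐ y) := by
  rw [mem_iff, or_iff]
  refine forall₂_congr fun q _ => exists_congr fun r => and_congr_right fun _ => ?_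
  constructor
  · rintro ⟨⟨b⟩, -, h⟩
    cases b
    · exact Or.inr h
    · exact Or.inl h
  · rintro (h | h)
    · exact ⟨⟨true⟩, le_top, h⟩
    · exact ⟨⟨false⟩, le_top, h⟩

theorem isPair_iff : Forces p (isPair z x y) ↔ Forces p (z ≐ upair x y) := by
  constructor
  · refine fun h => eq_of_mem_iff fun w q hq => ?_
    rw [mem_upair_iff]
    exact iff_iff.1 (h w) q hq
  · refine fun h w => iff_iff.2 fun q hq => ?_
    rw [← mem_upair_iff]
    exact ForcedIff.mem eq_refl h q hq

theorem upair_congr (hx : Forces p (x ≐ x')) (hy : Forces p (y ≐ y')) :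
    Forces p (upair x y ≐ upair x' y') :=
  isPair_iff.1 ((isPair_iff.2 eq_refl).congr (ForcedIff.isPair eq_refl hx hy))

theorem opair_congr (hx : Forces p (x ≐ x')) (hy : Forces p (y ≐ y')) :
    Forces p (opair x y ≐ opair x' y') :=
  upair_congr (upair_congr hx hx) (upair_congr hx hy)

theorem isOPair_iff : Forces p (isOPair z x y) ↔ Forces p (z ≐ opair x y) := by
  constructor
  · refine fun h => ex_elim h fun q _ a h => ex_elim h fun r hr b h => ?_
    simp only [and_iff, isPair_iff] at h
    exact h.2.2.eq_trans (upair_congr h.1 h.2.1)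
  · refine fun h => ex_intro (upair x x) (ex_intro (upair x y) ?_)
    simp only [and_iff, isPair_iff]
    exact ⟨eq_refl, eq_refl, h⟩

theorem left_mem_upair : Forces p (x ∈' upair x y) := mem_upair_iff.2 (or_inl eq_refl)

theorem right_mem_upair : Forces p (y ∈' upair x y) := mem_upair_iff.2 (or_inr eq_refl)

theorem eq_of_mem_upair (h : Forces p (z ∈' upair x x)) : Forces p (z ≐ x) :=
  or_elim (mem_upair_iff.1 h) (fun _ _ h => h) (fun _ _ h => h)

theorem opair_inj (h : Forces p (opair x y ≐ opair x' y')) :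
    Forces p (x ≐ x') ∧ Forces p (y ≐ y') := by
  have hx : Forces p (x ≐ x') := by
    have h1 : Forces p (upair x x ∈' opair x' y') := left_mem_upair.mem_congr eq_refl h
    refine or_elim (mem_upair_iff.1 h1) (fun q _ h => ?_) (fun q _ h => ?_)
    · exact (eq_of_mem_upair (left_mem_upair.mem_congr eq_refl h.eq_symm)).eq_symm
    · exact (eq_of_mem_upair (left_mem_upair.mem_congr eq_refl h.eq_symm)).eq_symm
  refine ⟨hx, ?_⟩
  have h1 : Forces p (upair x y ∈' opair x' y') := right_mem_upair.mem_congr eq_refl h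
  have h2 : Forces p (upair x' y' ∈' opair x y) := right_mem_upair.mem_congr eq_refl h.eq_symm
  -- The degenerate case in which the second coordinate equals the first one and the Kuratowski pair
  -- collapses.
  have key : ∀ q ≤ p, Forces q (y ≐ x') → Forces q (y ≐ y') := by
    intro q hq hy
    refine or_elim (mem_upair_iff.1 (h2.mono hq)) (fun r hr h => ?_) (fun r hr h => ?_)
    · have := eq_of_mem_upair (right_mem_upair.mem_congr eq_refl h)
      exact (hy.mono hr).eq_trans ((hx.mono (hr.trans hq)).eq_symm.eq_trans this.eq_symm)
    · refine or_elim (mem_upair_iff.1 (right_mem_upair.mem_congr eq_refl h))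
        (fun s hs h => ?_) (fun s hs h => h.eq_symm)
      exact (hy.mono (hs.trans hr)).eq_trans
        ((hx.mono (hs.trans (hr.trans hq))).eq_symm.eq_trans h.eq_symm)
  refine or_elim (mem_upair_iff.1 h1) (fun q hq h => ?_) (fun q hq h => ?_)
  · exact key q hq (eq_of_mem_upair (right_mem_upair.mem_congr eq_refl h))
  · refine or_elim (mem_upair_iff.1 (right_mem_upair.mem_congr eq_refl h))
      (fun r hr h => key r (hr.trans hq) h) (fun r hr h => h)

theorem app_iff : Forces p (app f x y) ↔ Forces p (opair x y ∈' f) := by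
  constructor
  · refine fun h => ex_elim h fun q _ z h => ?_
    rw [and_iff, isOPair_iff] at h
    exact h.1.mem_congr h.2 eq_refl
  · exact fun h => exIn_intro _ h (isOPair_iff.2 eq_refl)

theorem app_congr (h : Forces p (app f x y)) (hx : Forces p (x ≐ x')) (hy : Forces p (y ≐ y')) :
    Forces p (app f x' y') := h.congr (ForcedIff.app eq_refl hx hy)

/-! ### Subnames -/

section SubName

variable {ι κ : Type} {nm nmA : ι → PName.{u, 0} P} {nmB : κ → PName.{u, 0} P}
  {A : ι → P → Prop} {Q : ι → κ → P → Prop}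

/-- Since `A i` is inherited by stronger conditions, the condition attached to an index of the name
can be replaced by the condition at hand. -/
theorem mem_subName_iff (hA : ∀ i p q, q ≤ p → A i p → A i q) :
    Forces p (x ∈' subName nm A) ↔ ∀ q ≤ p, ∃ r ≤ q, ∃ i, A i r ∧ Forces r (x ≐ nm i) := by
  rw [mem_iff]
  refine forall₂_congr fun q _ => exists_congr fun r => and_congr_right fun _ => ?_
  constructor
  · rintro ⟨⟨⟨i, s⟩, h⟩, hr, h'⟩
    exact ⟨i, hA i s r hr h, h'⟩
  · rintro ⟨i, h, h'⟩
    exact ⟨⟨⟨i, r⟩, h⟩, le_rfl, h'⟩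

theorem mem_subName (hA : ∀ i p q, q ≤ p → A i p → A i q)
    (hnm : ∀ i j (p : P), Forces p (nm i ≐ nm j) → i = j) {i : ι} :
    Forces p (nm i ∈' subName nm A) ↔ ∀ q ≤ p, ∃ r ≤ q, A i r := by
  rw [mem_subName_iff hA]
  refine forall₂_congr fun q _ => exists_congr fun r => and_congr_right fun _ => ?_
  constructor
  · rintro ⟨j, h, h'⟩
    rwa [hnm i j r h']
  · exact fun h => ⟨i, h, eq_refl⟩

theorem opair_name_inj (hnmA : ∀ i j (p : P), Forces p (nmA i ≐ nmA j) → i = j)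
    (hnmB : ∀ i j (p : P), Forces p (nmB i ≐ nmB j) → i = j) (i j : ι × κ) (p : P)
    (h : Forces p (opair (nmA i.1) (nmB i.2) ≐ opair (nmA j.1) (nmB j.2))) : i = j :=
  Prod.ext (hnmA _ _ p (opair_inj h).1) (hnmB _ _ p (opair_inj h).2)

theorem app_relName (hQ : ∀ i k p q, q ≤ p → Q i k p → Q i k q)
    (hnmA : ∀ i j (p : P), Forces p (nmA i ≐ nmA j) → i = j)
    (hnmB : ∀ i j (p : P), Forces p (nmB i ≐ nmB j) → i = j) {i : ι} {k : κ} :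
    Forces p (app (relName nmA nmB Q) (nmA i) (nmB k)) ↔ ∀ q ≤ p, ∃ r ≤ q, Q i k r := by
  rw [app_iff]
  exact mem_subName (nm := fun a : ι × κ => opair (nmA a.1) (nmB a.2))
    (A := fun a => Q a.1 a.2) (i := (i, k))
    (fun a => hQ a.1 a.2) (opair_name_inj hnmA hnmB)

theorem app_relName_iff (hQ : ∀ i k p q, q ≤ p → Q i k p → Q i k q) :
    Forces p (app (relName nmA nmB Q) x y) ↔
      ∀ q ≤ p, ∃ r ≤ q, ∃ i k, Q i k r ∧ Forces r (x ≐ nmA i) ∧ Forces r (y ≐ nmB k) := by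
  rw [app_iff, relName, mem_subName_iff (fun a => hQ a.1 a.2)]
  refine forall₂_congr fun q _ => exists_congr fun r => and_congr_right fun _ => ?_
  constructor
  · rintro ⟨⟨i, k⟩, h, h'⟩
    exact ⟨i, k, h, opair_inj h'⟩
  · rintro ⟨i, k, h, h'⟩
    exact ⟨⟨i, k⟩, h, opair_congr h'.1 h'.2⟩

theorem isFun_relName (hQ : ∀ i k p q, q ≤ p → Q i k p → Q i k q)
    (hnmA : ∀ i j (p : P), Forces p (nmA i ≐ nmA j) → i = j)
    (ha : ∀ q ≤ p, ∀ x, Forces q (x ∈' a) → ∃ r ≤ q, ∃ i, Forces r (x ≐ nmA i))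
    (hab : ∀ q, ∀ i k, Q i k q → Forces q (nmA i ∈' a) ∧ Forces q (nmB k ∈' b))
    (tot : ∀ q ≤ p, ∀ i, Forces q (nmA i ∈' a) → ∃ r ≤ q, ∃ k, Q i k r)
    (func : ∀ q ≤ p, ∀ i k k', Q i k q → Q i k' q → k = k') :
    Forces p (isFun (relName nmA nmB Q) a b) := by
  refine and_iff.2 ⟨fun z q hq h => exIn_iff.2 fun r hr => ?_, fun x q hq h => of_dense fun r hr => ?_⟩
  · obtain ⟨s, hs, ⟨i, k⟩, h1, h2⟩ := (mem_subName_iff (fun a => hQ a.1 a.2)).1 h r hr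
    exact ⟨s, hs, nmA i, (hab s i k h1).1,
      exIn_intro (nmB k) (hab s i k h1).2 (isOPair_iff.2 h2)⟩
  · obtain ⟨s, hs, i, hi⟩ := ha r (hr.trans hq) x (h.mono hr)
    obtain ⟨t, ht, k, hk⟩ := tot s (hs.trans (hr.trans hq)) i
      ((h.mono (hs.trans hr)).mem_congr hi eq_refl)
    refine ⟨t, ht.trans hs, exIn_intro (nmB k) (hab t i k hk).2 (and_iff.2 ⟨?_, fun y w hw h' => ?_⟩)⟩
    · exact (app_relName_iff hQ).2 fun w hw =>
        ⟨w, le_rfl, i, k, hQ i k t w hw hk, hi.mono (hw.trans ht), eq_refl⟩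
    · refine of_dense fun w' hw' => ?_
      obtain ⟨v, hv, i', k', h1, h2, h3⟩ := (app_relName_iff hQ).1 h' w' hw'
      have hvt : v ≤ t := hv.trans (hw'.trans hw)
      obtain rfl : i' = i := hnmA _ _ v (h2.eq_symm.eq_trans (hi.mono (hvt.trans ht)))
      obtain rfl := func v (hvt.trans (ht.trans (hs.trans (hr.trans hq)))) _ _ _ h1
        (hQ i' k t v hvt hk)
      exact ⟨v, hv, h3⟩

theorem isInj_relName (hQ : ∀ i k p q, q ≤ p → Q i k p → Q i k q)
    (hnmB : ∀ i j (p : P), Forces p (nmB i ≐ nmB j) → i = j)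
    (inj : ∀ q ≤ p, ∀ i i' k, Q i k q → Q i' k q → i = i') :
    Forces p (isInj (relName nmA nmB Q)) := by
  refine fun x x' y q hq h q' hq' h' => of_dense fun r hr => ?_
  obtain ⟨s, hs, i, k, h1, h2, h3⟩ := (app_relName_iff hQ).1 (h.mono hq') r hr
  obtain ⟨t, ht, i', k', h1', h2', h3'⟩ := (app_relName_iff hQ).1 h' s (hs.trans hr)
  obtain rfl := hnmB _ _ t ((h3.mono ht).eq_symm.eq_trans h3')
  obtain rfl := inj t (ht.trans (hs.trans (hr.trans (hq'.trans hq)))) _ _ _ (hQ _ _ _ _ ht h1) h1'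
  exact ⟨t, ht.trans hs, (h2.mono ht).eq_trans h2'.eq_symm⟩

/-- A bijection of the extension is described by which pairs a condition has already matched.
Totality and surjectivity are density requirements; functionality and injectivity are checked on
single conditions. -/
theorem cardEq_of_relation (hQ : ∀ i k p q, q ≤ p → Q i k p → Q i k q)
    (hnmA : ∀ i j (p : P), Forces p (nmA i ≐ nmA j) → i = j)
    (hnmB : ∀ i j (p : P), Forces p (nmB i ≐ nmB j) → i = j)
    (ha : ∀ q ≤ p, ∀ x, Forces q (x ∈' a) → ∃ r ≤ q, ∃ i, Forces r (x ≐ nmA i))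
    (hb : ∀ q ≤ p, ∀ x, Forces q (x ∈' b) → ∃ r ≤ q, ∃ i, Forces r (x ≐ nmB i))
    (hab : ∀ q, ∀ i k, Q i k q → Forces q (nmA i ∈' a) ∧ Forces q (nmB k ∈' b))
    (tot : ∀ q ≤ p, ∀ i, Forces q (nmA i ∈' a) → ∃ r ≤ q, ∃ k, Q i k r)
    (onto : ∀ q ≤ p, ∀ k, Forces q (nmB k ∈' b) → ∃ r ≤ q, ∃ i, Q i k r)
    (func : ∀ q ≤ p, ∀ i k k', Q i k q → Q i k' q → k = k')
    (inj : ∀ q ≤ p, ∀ i i' k, Q i k q → Q i' k q → i = i') :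
    Forces p (cardEq a b) := by
  refine ex_intro (relName nmA nmB Q) (and_iff.2 ⟨isFun_relName hQ hnmA ha hab tot func,
    and_iff.2 ⟨isInj_relName hQ hnmB inj, fun y q hq h => exIn_iff.2 fun r hr => ?_⟩⟩)
  obtain ⟨s, hs, k, hk⟩ := hb r (hr.trans hq) y (h.mono hr)
  obtain ⟨t, ht, i, hi⟩ := onto s (hs.trans (hr.trans hq)) k
    ((h.mono (hs.trans hr)).mem_congr hk eq_refl)
  refine ⟨t, ht.trans hs, nmA i, (hab t i k hi).1, ?_⟩
  exact (app_relName_iff hQ).2 fun w hw =>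
    ⟨w, le_rfl, i, k, hQ i k t w hw hi, eq_refl, hk.mono (hw.trans ht)⟩

theorem cardLE_of_cardEq (h : Forces p (cardEq a b)) : Forces p (cardLE a b) :=
  ex_elim h fun _ _ f h => ex_intro f (and_iff.2 ⟨(and_iff.1 h).1, (and_iff.1 (and_iff.1 h).2).1⟩)

end SubName

/-! ### Check names -/

theorem mem_check_iff {s : PSet.{u}} :
    Forces p (x ∈' check s) ↔ ∀ q ≤ p, ∃ r ≤ q, ∃ t ∈ s, Forces r (x ≐ check t) := by
  have key : ∀ s t : PSet.{u}, PSet.Equiv s t → ∀ p : P, Forces p (check s ≐ check t) := by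
    intro s
    induction s with
    | mk α A ih =>
      rintro ⟨β, B⟩ h p
      refine PName.forcesEq_iff.2 ⟨fun i q hq _ => ?_, fun j q hq _ => ?_⟩
      · obtain ⟨j, hj⟩ := h.exists_left i
        exact ⟨q, le_rfl, j, le_top, ih i _ hj q⟩
      · obtain ⟨i, hi⟩ := h.exists_right j
        exact ⟨q, le_rfl, i, le_top, ih i _ hi q⟩
  rw [mem_iff]
  refine forall₂_congr fun q _ => exists_congr fun r => and_congr_right fun _ => ?_
  cases s with
  | mk α A =>
    constructor
    · rintro ⟨j, -, h⟩
      exact ⟨A j, PSet.Mem.mk A j, h⟩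
    · rintro ⟨t, ⟨j, hj⟩, h⟩
      exact ⟨j, le_top, h.eq_trans (key _ _ hj r)⟩

theorem check_mem {s t : PSet.{u}} (h : s ∈ t) : Forces p (check s ∈' check t) :=
  mem_check_iff.2 fun q _ => ⟨q, le_rfl, s, h, eq_refl⟩

theorem check_eq {s t : PSet.{u}} (h : PSet.Equiv s t) : Forces p (check s ≐ check t) := by
  refine eq_of_mem_iff fun z q _ => ?_
  simp only [mem_check_iff, PSet.equiv_iff_mem.1 h]

/-- Equality of ground model sets is absolute, by induction on the set. -/
theorem equiv_of_check_eq {s t : PSet.{u}} (h : Forces p (check s ≐ check t)) :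
    PSet.Equiv s t := by
  induction s generalizing t p with
  | mk α A ih =>
    have key : ∀ j, ∀ t, Forces p (check (A j) ∈' check t) → A j ∈ t := by
      intro j t hj
      obtain ⟨r, _, t', ht', h'⟩ := mem_check_iff.1 hj p le_rfl
      exact (PSet.Mem.congr_left (ih j h')).2 ht'
    refine PSet.equiv_iff_mem.2 fun {w} => ⟨fun hw => ?_, fun hw => ?_⟩
    · obtain ⟨j, hj⟩ := hw
      exact (PSet.Mem.congr_left hj).2 (key j t ((check_mem (PSet.Mem.mk A j)).mem_congr eq_refl h))
    · have := (check_mem hw).mem_congr eq_refl h.eq_symm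
      obtain ⟨r, _, t', ⟨j, hj⟩, h'⟩ := mem_check_iff.1 this p le_rfl
      have h2 := ih j ((check_eq hj).eq_symm.eq_trans h'.eq_symm)
      exact ⟨j, h2.symm⟩

theorem mem_of_check_mem {s t : PSet.{u}} (h : Forces p (check s ∈' check t)) : s ∈ t := by
  obtain ⟨r, _, t', ht', h'⟩ := mem_check_iff.1 h p le_rfl
  exact (PSet.Mem.congr_left (equiv_of_check_eq h')).2 ht'

theorem check_sub {s t : PSet.{u}} (h : s ⊆ t) : Forces p (sub (check s) (check t)) := by
  refine fun x q _ hx => mem_check_iff.2 fun r hr => ?_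
  obtain ⟨w, hw, v, hv, h'⟩ := mem_check_iff.1 hx r hr
  exact ⟨w, hw, v, PSet.mem_of_subset h hv, h'⟩

theorem check_upair {s t w : PSet.{u}} (h : ∀ z, z ∈ w ↔ PSet.Equiv z s ∨ PSet.Equiv z t) :
    Forces p (check w ≐ upair (check s) (check t)) := by
  refine eq_of_mem_iff fun z q _ => ?_
  rw [mem_check_iff, mem_upair_iff, or_iff]
  refine forall₂_congr fun q _ => exists_congr fun r => and_congr_right fun _ => ?_
  constructor
  · rintro ⟨v, hv, h'⟩
    exact ((h v).1 hv).imp (fun e => h'.eq_trans (check_eq e)) (fun e => h'.eq_trans (check_eq e))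
  · rintro (h' | h')
    · exact ⟨s, (h s).2 (Or.inl PSet.Equiv.rfl), h'⟩
    · exact ⟨t, (h t).2 (Or.inr PSet.Equiv.rfl), h'⟩

theorem check_opair {s t w : PSet.{u}}
    (h : ZFSet.mk w = ZFSet.pair (ZFSet.mk s) (ZFSet.mk t)) :
    Forces p (check w ≐ opair (check s) (check t)) := by
  have h1 : Forces p (check {s, s} ≐ upair (check s) (check s)) := check_upair fun z => PSet.mem_pair
  have h2 : Forces p (check {s, t} ≐ upair (check s) (check t)) := check_upair fun z => PSet.mem_pair
  have h3 : Forces p (check w ≐ upair (check {s, s}) (check {s, t})) := by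
    refine check_upair fun z => ?_
    have e : PSet.Equiv w {{s, s}, {s, t}} := by
      refine ZFSet.exact (h.trans ?_)
      change ZFSet.pair (ZFSet.mk s) (ZFSet.mk t) =
        {{ZFSet.mk s, ZFSet.mk s}, {ZFSet.mk s, ZFSet.mk t}}
      rw [ZFSet.pair_eq_singleton]; rfl
    rw [PSet.equiv_iff_mem.1 e, PSet.mem_pair]
  exact h3.eq_trans (upair_congr h1 h2)

/-! ### Natural numbers -/

theorem _root_.PSet.mem_ofNat_succ {x : PSet.{u}} {n : ℕ} :
    x ∈ PSet.ofNat.{u} (n + 1) ↔ PSet.Equiv x (PSet.ofNat.{u} n) ∨ x ∈ PSet.ofNat.{u} n :=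
  PSet.mem_insert_iff

theorem _root_.PSet.ofNat_mem_ofNat {m n : ℕ} (h : m < n) :
    PSet.ofNat.{u} m ∈ PSet.ofNat.{u} n := by
  induction n with
  | zero => omega
  | succ n ih =>
    rw [PSet.mem_ofNat_succ]
    rcases Nat.lt_succ_iff_lt_or_eq.1 h with h | rfl
    · exact Or.inr (ih h)
    · exact Or.inl PSet.Equiv.rfl

theorem _root_.PSet.ofNat_subset {m n : ℕ} (h : m ≤ n) :
    PSet.ofNat.{u} m ⊆ PSet.ofNat.{u} n := by
  rw [PSet.subset_iff]
  induction n, h using Nat.le_induction with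
  | base => exact fun _ h => h
  | succ n _ ih => exact fun _ h => PSet.mem_ofNat_succ.2 (Or.inr (ih h))

theorem nat_inj {m n : ℕ} (p : P) (h : Forces p (nat m ≐ (nat n : PName.{u, 0} P))) : m = n := by
  have e := equiv_of_check_eq h
  rcases lt_trichotomy m n with h' | h' | h'
  · exact absurd ((PSet.Mem.congr_right e).2 (PSet.ofNat_mem_ofNat h')) (PSet.mem_irrefl _)
  · exact h'
  · exact absurd ((PSet.Mem.congr_right e).1 (PSet.ofNat_mem_ofNat h')) (PSet.mem_irrefl _)

theorem nat_inj' (m n : ℕ) (p : P) (h : Forces p (nat m ≐ (nat n : PName.{u, 0} P))) : m = n :=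
  nat_inj p h

theorem sub_nat_iff {m n : ℕ} : Forces p (sub (nat m) (nat n : PName.{u, 0} P)) ↔ m ≤ n := by
  refine ⟨fun h => ?_, fun h => check_sub (PSet.ofNat_subset h)⟩
  by_contra! hc
  exact PSet.mem_irrefl _ (mem_of_check_mem (h _ p le_rfl (check_mem (PSet.ofNat_mem_ofNat hc))))

theorem nat_mem_omega (n : ℕ) : Forces p (nat n ∈' omega.{u} P) :=
  check_mem ⟨⟨n⟩, PSet.Equiv.rfl⟩

theorem mem_omega_iff : Forces p (x ∈' omega.{u} P) ↔ ∀ q ≤ p, ∃ r ≤ q, ∃ n, Forces r (x ≐ nat n) := by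
  rw [mem_iff]
  refine forall₂_congr fun q _ => exists_congr fun r => and_congr_right fun _ => ?_
  constructor
  · rintro ⟨j, -, h⟩
    exact ⟨j.down, h⟩
  · rintro ⟨n, h⟩
    exact ⟨⟨n⟩, le_top, h⟩

theorem mem_omega (h : Forces p (x ∈' omega.{u} P)) : ∃ r ≤ p, ∃ n, Forces r (x ≐ nat n) :=
  mem_omega_iff.1 h p le_rfl

theorem omega_elim (h : Forces p (x ∈' omega.{u} P))
    (h' : ∀ q ≤ p, ∀ n, Forces q (x ≐ nat n) → Forces q φ) : Forces p φ := by
  refine of_dense fun q hq => ?_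
  obtain ⟨r, hr, n, h1⟩ := mem_omega_iff.1 h q hq
  exact ⟨r, hr, h' r (hr.trans hq) n h1⟩

theorem isEmpty_nat_zero : Forces p (isEmpty (nat 0 : PName.{u, 0} P)) := by
  intro x q _ hx
  obtain ⟨r, _, t, ht, _⟩ := mem_check_iff.1 hx q le_rfl
  exact PSet.notMem_empty t ht

theorem isSucc_nat (n : ℕ) : Forces p (isSucc (nat (n + 1)) (nat n : PName.{u, 0} P)) := by
  refine fun w => iff_iff.2 fun q _ => ?_
  rw [or_iff, nat, mem_check_iff]
  refine ⟨fun h r hr => ?_, fun h r hr => ?_⟩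
  · obtain ⟨s, hs, t, ht, h⟩ := h r hr
    rcases PSet.mem_ofNat_succ.1 ht with h' | h'
    · exact ⟨s, hs, Or.inr (h.eq_trans (check_eq h'))⟩
    · exact ⟨s, hs, Or.inl ((check_mem h').mem_congr h.eq_symm eq_refl)⟩
  · obtain ⟨s, hs, h | h⟩ := h r hr
    · obtain ⟨v, hv, t, ht, h'⟩ := mem_check_iff.1 h s le_rfl
      exact ⟨v, hv.trans hs, t, PSet.mem_ofNat_succ.2 (Or.inr ht), h'⟩
    · exact ⟨s, hs, _, PSet.mem_ofNat_succ.2 (Or.inl PSet.Equiv.rfl), h⟩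

theorem isInductive_omega : Forces p (isInductive (omega.{u} P)) := by
  refine and_iff.2 ⟨exIn_intro (nat 0) (nat_mem_omega 0) isEmpty_nat_zero, fun x q _ hx => ?_⟩
  refine omega_elim hx fun r _ n h => exIn_intro (nat (n + 1)) (nat_mem_omega _) ?_
  exact (isSucc_nat n).congr (ForcedIff.isSucc eq_refl h.eq_symm)

theorem sub_omega_of_isInductive (h : Forces p (isInductive a)) :
    Forces p (sub (omega.{u} P) a) := by
  obtain ⟨h0, h1⟩ := and_iff.1 h
  have key : ∀ n : ℕ, Forces p (nat n ∈' a) := by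
    intro n
    induction n with
    | zero =>
      refine ex_elim h0 fun q _ e he => ?_
      obtain ⟨he, he'⟩ := and_iff.1 he
      refine he.mem_congr (eq_of_mem_iff fun z r hr => ⟨fun hz => ?_, fun hz => ?_⟩) eq_refl
      · exact absurd hz (he' z r hr)
      · exact absurd hz (isEmpty_nat_zero (p := r) z r le_rfl)
    | succ n ih =>
      refine ex_elim (h1 _ p le_rfl ih) fun q hq e he => ?_
      obtain ⟨he, he'⟩ := and_iff.1 he
      refine he.mem_congr (eq_of_mem_iff fun z r hr => ?_) eq_refl
      exact (iff_iff.1 (he' z) r hr).trans (iff_iff.1 (isSucc_nat (p := r) n z) r le_rfl).symm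
  exact fun x q hq hx => omega_elim hx fun r hr n h =>
    ((key n).mono (hr.trans hq)).mem_congr h.eq_symm eq_refl

theorem isOmega_omega : Forces p (isOmega (omega.{u} P)) :=
  and_iff.2 ⟨isInductive_omega, fun _ _ _ => sub_omega_of_isInductive⟩

theorem eq_omega (h : Forces p (isOmega x)) : Forces p (x ≐ omega.{u} P) := by
  obtain ⟨h0, h1⟩ := and_iff.1 h
  refine eq_of_mem_iff fun z q hq => ⟨fun hz => ?_, fun hz => ?_⟩
  · exact h1 (omega P) p le_rfl isInductive_omega z q hq hz
  · exact sub_omega_of_isInductive h0 z q hq hz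

/-! ### Reals -/

theorem app_real {g : ℕ → ℕ} {n k : ℕ} :
    Forces p (app (real g : PName.{u, 0} P) (nat n) (nat k)) ↔ g n = k := by
  rw [real, app_relName (fun _ _ _ _ _ h => h) nat_inj' nat_inj']
  exact ⟨fun h => (h p le_rfl).choose_spec.2, fun h q _ => ⟨q, le_rfl, h⟩⟩

theorem real_inj (g h : ℕ → ℕ) (p : P) (e : Forces p (real g ≐ (real h : PName.{u, 0} P))) :
    g = h := by
  funext n
  have := (app_real.2 rfl : Forces p (app (real g : PName.{u, 0} P) (nat n) (nat (g n))))
  exact (app_real.1 (this.congr (ForcedIff.app e eq_refl eq_refl))).symm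

theorem isFun_real (g : ℕ → ℕ) :
    Forces p (isFun (real g) (omega.{u} P) (omega.{u} P)) := by
  refine isFun_relName (fun _ _ _ _ _ h => h) nat_inj' (fun q _ x hx => mem_omega hx)
    (fun q i k _ => ⟨nat_mem_omega i, nat_mem_omega k⟩) (fun q _ i _ => ⟨q, le_rfl, g i, rfl⟩) ?_
  rintro q _ i k k' rfl rfl
  rfl

theorem isFun_app_mem (hf : Forces p (isFun f a b)) (h : Forces p (app f x y)) :
    Forces p (x ∈' a) ∧ Forces p (y ∈' b) := by
  have h1 := (and_iff.1 hf).1 _ p le_rfl (app_iff.1 h)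
  have key : ∀ q ≤ p, ∃ r ≤ q, Forces r (x ∈' a) ∧ Forces r (y ∈' b) := by
    intro q hq
    obtain ⟨r, hr, x', hx', h2⟩ := exIn_iff.1 h1 q hq
    obtain ⟨s, hs, y', hy', h3⟩ := exIn_iff.1 h2 r le_rfl
    have h4 := opair_inj (isOPair_iff.1 h3)
    exact ⟨s, hs.trans hr, (hx'.mono hs).mem_congr h4.1.eq_symm eq_refl,
      hy'.mem_congr h4.2.eq_symm eq_refl⟩
  exact ⟨of_dense fun q hq => (key q hq).imp fun r h => ⟨h.1, h.2.1⟩,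
    of_dense fun q hq => (key q hq).imp fun r h => ⟨h.1, h.2.2⟩⟩

theorem isFun_total (hf : Forces p (isFun f a b)) (hx : Forces p (x ∈' a)) :
    ∃ r ≤ p, ∃ y, Forces r (y ∈' b) ∧ Forces r (app f x y) := by
  obtain ⟨r, hr, y, hy, h⟩ := exIn_iff.1 ((and_iff.1 hf).2 x p le_rfl hx) p le_rfl
  exact ⟨r, hr, y, hy, (and_iff.1 h).1⟩

theorem isFun_unique (hf : Forces p (isFun f a b)) (h : Forces p (app f x y))
    (h' : Forces p (app f x y')) : Forces p (y ≐ y') := by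
  refine ex_elim ((and_iff.1 hf).2 x p le_rfl (isFun_app_mem hf h).1) fun q hq z hz => ?_
  obtain ⟨-, hz⟩ := and_iff.1 hz
  obtain ⟨-, hz⟩ := and_iff.1 hz
  exact (hz y q le_rfl (h.mono hq)).eq_trans (hz y' q le_rfl (h'.mono hq)).eq_symm

theorem isFun_omega_total (hf : Forces p (isFun f (omega.{u} P) (omega.{u} P))) (n : ℕ) :
    ∃ r ≤ p, ∃ k, Forces r (app f (nat n) (nat k)) := by
  obtain ⟨r, hr, y, hy, h⟩ := isFun_total hf (nat_mem_omega n)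
  obtain ⟨s, hs, k, hk⟩ := mem_omega hy
  exact ⟨s, hs.trans hr, k, (h.mono hs).app_congr eq_refl hk⟩

theorem eq_real (hf : Forces p (isFun f (omega.{u} P) (omega.{u} P))) {g : ℕ → ℕ}
    (h : ∀ n, Forces p (app f (nat n) (nat (g n)))) : Forces p (f ≐ real g) := by
  refine eq_of_mem_iff fun z q hq => ⟨fun hz => ?_, fun hz => ?_⟩
  · refine ex_elim ((and_iff.1 hf).1 z q hq hz) fun r hr x hx => ?_
    obtain ⟨hx, h1⟩ := and_iff.1 hx
    refine omega_elim hx fun s hs n hn => ex_elim (h1.mono hs) fun t ht y hy => ?_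
    obtain ⟨hy, h2⟩ := and_iff.1 hy
    have htp : t ≤ p := ht.trans (hs.trans (hr.trans hq))
    have h3 : Forces t (z ≐ opair (nat n) y) :=
      (isOPair_iff.1 h2).eq_trans (opair_congr (hn.mono ht) eq_refl)
    have h4 : Forces t (app f (nat n) y) :=
      app_iff.2 ((hz.mono (ht.trans (hs.trans hr))).mem_congr h3 eq_refl)
    have h5 := isFun_unique (hf.mono htp) h4 ((h n).mono htp)
    exact (app_iff.1 (app_real.2 rfl)).mem_congr
      (h3.eq_trans (opair_congr eq_refl h5)).eq_symm eq_refl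
  · refine of_dense fun r hr => ?_
    rw [real, relName, mem_subName_iff (fun _ _ _ _ h => h)] at hz
    obtain ⟨s, hs, ⟨n, k⟩, h1, h2⟩ := hz r hr
    obtain rfl : g n = k := h1
    exact ⟨s, hs, (app_iff.1 ((h n).mono (hs.trans (hr.trans hq)))).mem_congr h2.eq_symm eq_refl⟩

/-- The set-theoretic functions from `ω` to `ω` correspond to the functions `ℕ → ℕ`. From here on
ground model reals are handled only through the latter. -/
theorem mem_groundReals_iff :
    Forces p (x ∈' groundReals) ↔ ∀ q ≤ p, ∃ r ≤ q, ∃ g, Forces r (x ≐ real g) := by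
  have hω : ∀ {s : PSet.{u}}, ZFSet.mk s ∈ ZFSet.omega ↔ ∃ n, PSet.Equiv s (PSet.ofNat n) :=
    ⟨fun ⟨n, h⟩ => ⟨n.down, h⟩, fun ⟨n, h⟩ => ⟨⟨n⟩, h⟩⟩
  have hout : ∀ {w : PSet.{u}}, w ∈ Quotient.out (ZFSet.funs ZFSet.omega ZFSet.omega) ↔
      ZFSet.IsFunc ZFSet.omega ZFSet.omega (ZFSet.mk w) := by
    intro w
    rw [← ZFSet.mem_funs, ← ZFSet.mk_mem_iff]
    exact iff_of_eq (congrArg (ZFSet.mk w ∈ ·) (Quotient.out_eq (ZFSet.funs ZFSet.omega ZFSet.omega)))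
  have hfun : ∀ {w : PSet.{u}}, ZFSet.IsFunc ZFSet.omega ZFSet.omega (ZFSet.mk w) →
      ∃ g, ∀ r : P, Forces r (check w ≐ real g) := by
    rintro w ⟨h1, h2⟩
    have h3 : ∀ n : ℕ, ∃ k : ℕ, ZFSet.pair (ZFSet.mk (PSet.ofNat n)) (ZFSet.mk (PSet.ofNat k)) ∈
        ZFSet.mk w := by
      intro n
      obtain ⟨v, hv, -⟩ := h2 _ (hω.2 ⟨n, PSet.Equiv.rfl⟩)
      obtain ⟨v, rfl⟩ := Quotient.exists_rep v
      obtain ⟨k, hk⟩ := hω.1 (ZFSet.pair_mem_prod.1 (h1 hv)).2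
      exact ⟨k, by rw [← ZFSet.sound hk]; exact hv⟩
    choose g hg using h3
    refine ⟨g, fun r => eq_of_mem_iff fun z q _ => ?_⟩
    rw [mem_check_iff, real, relName, mem_subName_iff (fun _ _ _ _ h => h)]
    refine forall₂_congr fun q _ => exists_congr fun r => and_congr_right fun _ => ?_
    constructor
    · rintro ⟨t, ht, h⟩
      obtain ⟨a, ha, b, hb, e⟩ := ZFSet.mem_prod.1 (h1 (ZFSet.mk_mem_iff.2 ht))
      obtain ⟨v, -, hv⟩ := h2 a ha
      have hb' := hv b (by beta_reduce; rw [← e]; exact ZFSet.mk_mem_iff.2 ht)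
      obtain ⟨a, rfl⟩ := Quotient.exists_rep a
      obtain ⟨n, hn⟩ := hω.1 ha
      have ea : ZFSet.mk a = ZFSet.mk (PSet.ofNat n) := ZFSet.sound hn
      have hb'' := hv (ZFSet.mk (PSet.ofNat (g n))) (by
        have := hg n; rw [← ea] at this; exact this)
      refine ⟨(n, g n), rfl, h.eq_trans (check_opair ?_)⟩
      rw [e, hb', ← hb'', ← ea]; rfl
    · rintro ⟨⟨n, k⟩, h0, h⟩
      obtain rfl : g n = k := h0
      refine ⟨Quotient.out (ZFSet.pair (ZFSet.mk (PSet.ofNat n)) (ZFSet.mk (PSet.ofNat (g n)))),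
        ?_, h.eq_trans (check_opair (Quotient.out_eq _)).eq_symm⟩
      rw [← ZFSet.mk_mem_iff]
      have e := Quotient.out_eq (ZFSet.pair (ZFSet.mk (PSet.ofNat n)) (ZFSet.mk (PSet.ofNat (g n))))
      exact (congrArg (· ∈ ZFSet.mk w) e).mpr (hg n)
  rw [groundReals, mem_check_iff]
  refine forall₂_congr fun q _ => exists_congr fun r => and_congr_right fun _ => ?_
  constructor
  · rintro ⟨t, ht, h⟩
    obtain ⟨g, hg⟩ := hfun (hout.1 ht)
    exact ⟨g, h.eq_trans (hg r)⟩
  · rintro ⟨g, h⟩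
    -- The graph of `g` as a set, with representatives of its ordered pairs.
    let c : ℕ → ZFSet.{u} := fun n =>
      ZFSet.pair (ZFSet.mk (PSet.ofNat n)) (ZFSet.mk (PSet.ofNat (g n)))
    let w : PSet.{u} := PSet.mk (ULift ℕ) (fun n => Quotient.out (c n.down))
    have hc : ∀ n, ZFSet.mk (Quotient.out (c n)) = c n := fun n => Quotient.out_eq _
    have hw : ∀ z, z ∈ ZFSet.mk w ↔ ∃ n, z = c n := by
      intro z
      obtain ⟨z, rfl⟩ := Quotient.exists_rep z
      constructor
      · rintro ⟨⟨n⟩, hn⟩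
        exact ⟨n, (ZFSet.sound hn).trans (hc n)⟩
      · rintro ⟨n, hn⟩
        exact ⟨⟨n⟩, ZFSet.exact (hn.trans (hc n).symm)⟩
    have hinj : ∀ m n : ℕ, ZFSet.mk.{u} (PSet.ofNat m) = ZFSet.mk (PSet.ofNat n) → m = n :=
      fun m n e => nat_inj (P := P) p (check_eq (ZFSet.exact e))
    have hwf : ZFSet.IsFunc ZFSet.omega ZFSet.omega (ZFSet.mk w) := by
      refine ⟨fun z hz => ?_, fun z hz => ?_⟩
      · obtain ⟨n, rfl⟩ := (hw z).1 hz
        exact ZFSet.pair_mem_prod.2 ⟨hω.2 ⟨n, PSet.Equiv.rfl⟩, hω.2 ⟨g n, PSet.Equiv.rfl⟩⟩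
      · obtain ⟨z, rfl⟩ := Quotient.exists_rep z
        obtain ⟨n, hn⟩ := hω.1 hz
        have en : ZFSet.mk z = ZFSet.mk (PSet.ofNat n) := ZFSet.sound hn
        refine ⟨ZFSet.mk (PSet.ofNat (g n)), (hw _).2 ⟨n, ?_⟩, fun v hv => ?_⟩
        · exact congrArg (fun a => ZFSet.pair a _) en
        · obtain ⟨m, hm⟩ := (hw _).1 hv
          obtain ⟨e1, rfl⟩ := ZFSet.pair_injective hm
          rw [hinj n m (en.symm.trans e1)]
    -- The function recovered from the graph is identified with `g` by evaluating it at each natural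
    -- number.
    obtain ⟨g', hg'⟩ := hfun hwf
    have e : g' = g := by
      funext n
      have h1 : Forces p (app (check w : PName.{u, 0} P) (nat n) (nat (g n))) := by
        refine app_iff.2 ((check_mem (s := Quotient.out (c n)) ?_).mem_congr
          (check_opair (hc n)) eq_refl)
        exact ⟨⟨n⟩, PSet.Equiv.rfl⟩
      exact app_real.1 (h1.congr (ForcedIff.app (hg' p) eq_refl eq_refl))
    exact ⟨w, hout.2 hwf, h.eq_trans (e ▸ (hg' r).eq_symm)⟩

theorem real_mem_groundReals (g : ℕ → ℕ) : Forces p (real g ∈' (groundReals : PName.{u, 0} P)) :=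
  mem_groundReals_iff.2 fun q _ => ⟨q, le_rfl, g, eq_refl⟩

/-- the meaning of `y ≤* z` -/
theorem leStar_iff (hy : Forces p (isFun y (omega.{u} P) (omega.{u} P)))
    (hz : Forces p (isFun z (omega.{u} P) (omega.{u} P))) :
    Forces p (leStar (omega.{u} P) y z) ↔ ∀ q ≤ p, ∃ r ≤ q, ∃ N, ∀ n ≥ N, ∀ s ≤ r, ∀ i j,
      Forces s (app y (nat n) (nat i)) → Forces s (app z (nat n) (nat j)) → i ≤ j := by
  constructor
  · intro h q hq
    obtain ⟨r, hr, N, hN, h⟩ := exIn_iff.1 h q hq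
    obtain ⟨s, hs, N, hN⟩ := mem_omega hN
    refine ⟨s, hs.trans hr, N, fun n hn t ht i j hi hj => ?_⟩
    have hsub : Forces t (sub _ (nat n)) := (sub_nat_iff.2 hn).congr
      (ForcedIff.sub (hN.mono ht).eq_symm (eq_refl (x := (nat n : PName.{u, 0} P))))
    exact sub_nat_iff.1 (h (nat n) t (ht.trans hs) (nat_mem_omega n) t le_rfl hsub _ _ t le_rfl hi
      t le_rfl hj)
  · intro h
    refine exIn_iff.2 fun q hq => ?_
    obtain ⟨r, hr, N, h⟩ := h q hq
    refine ⟨r, hr, nat N, nat_mem_omega N, fun n s hs hn s' hs' hNn i j t ht hi t' ht' hj => ?_⟩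
    have htp : t' ≤ p := ht'.trans (ht.trans (hs'.trans (hs.trans (hr.trans hq))))
    refine omega_elim (hn.mono (ht'.trans (ht.trans hs'))) fun a ha n' hn' => ?_
    refine omega_elim (isFun_app_mem (hz.mono (ha.trans htp)) (hj.mono ha)).2 fun b hb j' hj' => ?_
    refine omega_elim (isFun_app_mem (hy.mono (hb.trans (ha.trans htp)))
      (hi.mono (hb.trans (ha.trans ht')))).2 fun c hc i' hi' => ?_
    have hca : c ≤ a := hc.trans hb
    have hct : c ≤ t := hca.trans (ha.trans ht')
    have h1 : N ≤ n' := sub_nat_iff.1 ((hNn.mono (hct.trans ht)).congr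
      (ForcedIff.sub (eq_refl (x := (nat N : PName.{u, 0} P))) (hn'.mono hca)))
    have h2 := h n' h1 c (hct.trans (ht.trans (hs'.trans hs))) i' j'
      ((hi.mono hct).app_congr (hn'.mono hca) hi')
      ((hj.mono (hca.trans ha)).app_congr (hn'.mono hca) (hj'.mono hc))
    exact (sub_nat_iff.2 h2).congr (ForcedIff.sub hi'.eq_symm (hj'.mono hc).eq_symm)

theorem leStar_trans (hx : Forces p (isFun x (omega.{u} P) (omega.{u} P)))
    (hy : Forces p (isFun y (omega.{u} P) (omega.{u} P)))
    (hz : Forces p (isFun z (omega.{u} P) (omega.{u} P)))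
    (h : Forces p (leStar (omega.{u} P) x y)) (h' : Forces p (leStar (omega.{u} P) y z)) :
    Forces p (leStar (omega.{u} P) x z) := by
  rw [leStar_iff hx hz]
  intro q hq
  obtain ⟨r, hr, N, h1⟩ := (leStar_iff hx hy).1 h q hq
  obtain ⟨s, hs, M, h2⟩ := (leStar_iff hy hz).1 h' r (hr.trans hq)
  refine ⟨s, hs.trans hr, max N M, fun n hn t ht i j hi hj => ?_⟩
  obtain ⟨t', ht', k, hk⟩ := isFun_omega_total
    (hy.mono (ht.trans (hs.trans (hr.trans hq)))) n
  exact (h1 n (le_of_max_le_left hn) t' (ht'.trans (ht.trans hs)) i k (hi.mono ht') hk).trans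
    (h2 n (le_of_max_le_right hn) t' (ht'.trans ht) k j hk (hj.mono ht'))

theorem leStar_real_iff {g h : ℕ → ℕ} :
    Forces p (leStar (omega.{u} P) (real g) (real h)) ↔ ∀ᶠ n in Filter.atTop, g n ≤ h n := by
  rw [leStar_iff (isFun_real g) (isFun_real h), Filter.eventually_atTop]
  constructor
  · intro H
    obtain ⟨r, -, N, H⟩ := H p le_rfl
    exact ⟨N, fun n hn => H n hn r le_rfl _ _ (app_real.2 rfl) (app_real.2 rfl)⟩
  · rintro ⟨N, H⟩ q _
    refine ⟨q, le_rfl, N, fun n hn s _ i j hi hj => ?_⟩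
    rw [← app_real.1 hi, ← app_real.1 hj]
    exact H n hn

end Forces

/-! ## Nondecreasing Hechler forcing -/

/-! ### Growth rates of functions on `ω` and jumps in finite sequences -/

open Filter

/-- Take for `g v` the greatest `k ≤ v` with `T k ≤ v`. The value `0` is also the default when there
is no such `k`, which is why it is exempt from the third clause. -/
theorem exists_inverse (T : ℕ → ℕ) : ∃ g : ℕ → ℕ, Monotone g ∧ Tendsto g atTop atTop ∧
    (∀ v, g v ≠ 0 → T (g v) ≤ v) ∧ ∀ i v, i ≤ v → T i ≤ v → i ≤ g v := by
  classical
  have h4 : ∀ i v, i ≤ v → T i ≤ v → i ≤ Nat.findGreatest (fun k => T k ≤ v) v :=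
    fun i v h h' => Nat.le_findGreatest h h'
  refine ⟨fun v => Nat.findGreatest (fun k => T k ≤ v) v, fun v w h => ?_, ?_, fun v hv => ?_, h4⟩
  · exact Nat.findGreatest_mono (fun k hk => le_trans hk h) h
  · refine tendsto_atTop.2 fun i => ?_
    filter_upwards [eventually_ge_atTop (max i (T i))] with v hv
    exact h4 i v (le_of_max_le_left hv) (le_of_max_le_right hv)
  · exact Nat.findGreatest_of_ne_zero (P := fun k => T k ≤ v) rfl hv

/-- Diagonalisation: `g` reaches the value `i` only after the functions with index at most `i` have
reached `i` for good. -/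
theorem exists_slow (G : ℕ → ℕ → ℕ) (hG : ∀ a, Tendsto (G a) atTop atTop) :
    ∃ g : ℕ → ℕ, Monotone g ∧ Tendsto g atTop atTop ∧ ∀ a, ∀ᶠ n in atTop, g n ≤ G a n := by
  have h1 : ∀ i, ∃ T, ∀ x ≥ T, ∀ a ≤ i, i ≤ G a x := by
    intro i
    refine eventually_atTop.1 ?_
    exact (eventually_all_finite (Set.finite_Iic i)).2 fun a _ =>
      (hG a).eventually (eventually_ge_atTop i)
  choose T hT using h1
  obtain ⟨g, hg, hg', h, -⟩ := exists_inverse T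
  refine ⟨g, hg, hg', fun a => ?_⟩
  filter_upwards [hg'.eventually (eventually_ge_atTop a)] with n hn
  by_cases h0 : g n = 0
  · rw [h0]; exact Nat.zero_le _
  · exact hT _ n (h n h0) a hn

theorem finite_lists (n : ℕ) : {s : List ℕ | s.length ≤ n ∧ ∀ a ∈ s, a ≤ n}.Finite := by
  refine ((List.finite_length_le (Fin (n + 1)) n).image (List.map Fin.val)).subset ?_
  rintro s ⟨h1, h2⟩
  refine ⟨s.pmap (fun a ha => (⟨a, Nat.lt_succ_of_le ha⟩ : Fin (n + 1))) h2, by simpa using h1, ?_⟩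
  rw [List.map_pmap]
  simp

theorem exists_uniform_bound {α : Type*} {S : Set α} (hS : S.Finite) {Q : α → ℕ → Prop}
    (mono : ∀ x B B', B ≤ B' → Q x B → Q x B') (h : ∀ x ∈ S, ∃ B, Q x B) :
    ∃ B, ∀ x ∈ S, Q x B := by
  have : ∀ᶠ B in atTop, ∀ x ∈ S, Q x B := (eventually_all_finite hS).2 fun x hx => by
    obtain ⟨B, hB⟩ := h x hx
    exact eventually_atTop.2 ⟨B, fun B' h' => mono x B B' h' hB⟩
  exact this.exists

/-- Without a jump, each position from `a` on raises the bound on the entries by at most one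
application of `Φ`. There are `b - a + 1 ≤ x + 1` positions up to `b`, so `r[b]` would be at most
the iterate. -/
theorem exists_iterate_jump {Φ : ℕ → ℕ} (hΦ' : ∀ x, x ≤ Φ x) {r : List ℕ}
    {a b x : ℕ} (hab : a ≤ b) (hb : b < r.length) (hbx : b ≤ x) (ha : ∀ c ∈ r.take a, c ≤ x)
    (h : Φ^[x + 1] x < r[b]) :
    ∃ l z, ∃ hl : l < r.length, a ≤ l ∧ l ≤ b ∧ x ≤ z ∧ (∀ c ∈ r.take l, c ≤ z) ∧ Φ z ≤ r[l] := by
  by_contra! hc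
  have hmono : ∀ j, x ≤ Φ^[j] x := fun j => Function.id_le_iterate_of_id_le hΦ' j x
  have key : ∀ j, a + j ≤ b + 1 → ∀ c ∈ r.take (a + j), c ≤ Φ^[j] x := by
    intro j
    induction j with
    | zero => exact fun _ => ha
    | succ j ih =>
      intro hj c hc'
      have h1 := hc (a + j) (Φ^[j] x) (by omega) (by omega) (by omega) (hmono j) (ih (by omega))
      rw [Function.iterate_succ_apply']
      rw [← add_assoc, List.take_succ_eq_append_getElem (by omega), List.mem_append,
        List.mem_singleton] at hc'
      rcases hc' with hc' | rfl
      · exact (ih (by omega) c hc').trans (hΦ' _)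
      · exact h1.le
  have h2 := key (b - a + 1) (by omega) r[b] (by
    rw [show a + (b - a + 1) = b + 1 by omega, List.take_succ_eq_append_getElem hb]
    exact List.mem_append_right _ (List.mem_singleton_self _))
  have h3 : Φ^[b - a + 1] x ≤ Φ^[x + 1] x :=
    Function.monotone_iterate_of_id_le hΦ' (by omega : b - a + 1 ≤ x + 1) x
  omega

/-! ### Slowed-down generic reals and lower bounds of dominating reals -/

namespace HechlerND

open SetFml PName

/-- the condition with the stem of `p` and a larger commitment -/
def raise (p : HechlerND) (c : ℕ → ℕ) : HechlerND :=
  ⟨p.stem, p.nondecreasing, fun n => max (p.commit n) (c n)⟩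

theorem raise_le (p : HechlerND) (c : ℕ → ℕ) : p.raise c ≤ p :=
  ⟨List.prefix_refl _, fun _ => le_max_left _ _, fun _ h h' => absurd h (not_lt.2 h')⟩

/-- As there are countably many stems, the forcing is σ-centered. This reduces a name to countably
many cases. -/
theorem exists_compatible {p q : HechlerND} (h : p.stem = q.stem) : ∃ r, r ≤ p ∧ r ≤ q :=
  ⟨p.raise q.commit, raise_le p _, by
    refine ⟨h ▸ List.prefix_refl _, fun _ => le_max_right _ _, fun _ h1 h' => ?_⟩
    exact absurd h1 (not_lt.2 (by rw [← h] at h'; exact h'))⟩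

theorem exists_longer (p : HechlerND) (m : ℕ) : ∃ q ≤ p, m < q.stem.length := by
  have one : ∀ p : HechlerND, ∃ q ≤ p, q.stem.length = p.stem.length + 1 := by
    intro p
    refine ⟨⟨p.stem ++ [p.stem.sum + p.commit p.stem.length], ?_, p.commit⟩,
      ⟨List.prefix_append _ _, fun _ => le_rfl, fun n hn hn' => ?_⟩, by simp⟩
    · rw [List.pairwise_append]
      refine ⟨p.nondecreasing, List.pairwise_singleton _ _, fun a ha b hb => ?_⟩
      rw [List.mem_singleton.1 hb]
      exact (List.le_sum_of_mem ha).trans (Nat.le_add_right _ _)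
    · have : n = p.stem.length := by
        have : n < p.stem.length + 1 := by simpa using hn
        omega
      subst this
      simp
  induction m with
  | zero => obtain ⟨q, hq, h⟩ := one p; exact ⟨q, hq, by omega⟩
  | succ m ih =>
    obtain ⟨q, hq, h⟩ := ih
    obtain ⟨r, hr, h'⟩ := one q
    exact ⟨r, hr.trans hq, by omega⟩

/-- a name of the real `n ↦ g (d (h n))`, where `d` is the generic real -/
def slowName (g h : ℕ → ℕ) : PName.{u, 0} HechlerND :=
  relName nat nat (fun n k p => ∃ hl : h n < p.stem.length, k = g p.stem[h n])

theorem slowName_mono (g h : ℕ → ℕ) (n k : ℕ) (p q : HechlerND) (hq : q ≤ p)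
    (H : ∃ hl : h n < p.stem.length, k = g p.stem[h n]) :
    ∃ hl : h n < q.stem.length, k = g q.stem[h n] := by
  obtain ⟨hl, rfl⟩ := H
  exact ⟨hl.trans_le hq.1.length_le, by rw [hq.1.getElem hl]⟩

variable {p : HechlerND} {g h g' h' : ℕ → ℕ}

theorem app_slowName {n k : ℕ}
    (H : Forces p (app (slowName.{u} g h) (nat n) (nat k))) :
    ∃ q ≤ p, ∃ hl : h n < q.stem.length, k = g q.stem[h n] :=
  (Forces.app_relName (slowName_mono g h) Forces.nat_inj' Forces.nat_inj').1 H p le_rfl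

theorem isFun_slowName : Forces p (isFun (slowName.{u} g h) (omega _) (omega _)) := by
  refine Forces.isFun_relName (slowName_mono g h) Forces.nat_inj'
    (fun q _ x hx => Forces.mem_omega hx)
    (fun q i k _ => ⟨Forces.nat_mem_omega i, Forces.nat_mem_omega k⟩) (fun q _ i _ => ?_) ?_
  · obtain ⟨r, hr, hl⟩ := exists_longer q (h i)
    exact ⟨r, hr, _, hl, rfl⟩
  · rintro q _ i k k' ⟨_, rfl⟩ ⟨_, rfl⟩
    rfl

/-- For each `m` only finitely many `n` have `h n ≤ m`. So a commitment at `m` can make `d m` large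
enough for `g (d m)` to exceed `f n` for all of them. -/
theorem isDominating_slowName (hg : Tendsto g atTop atTop) (hh : Tendsto h atTop atTop) :
    Forces p (isDominating (omega _) groundReals (slowName.{u} g h)) := by
  refine Forces.and_iff.2 ⟨isFun_slowName, fun x q hq hx => ?_⟩
  refine Forces.of_dense fun q' hq' => ?_
  obtain ⟨q, hqq', f, hf⟩ := Forces.mem_groundReals_iff.1 hx q' hq'
  refine ⟨q, hqq', Forces.congr ?_ (ForcedIff.leStar Forces.eq_refl hf.eq_symm Forces.eq_refl)⟩
  rw [Forces.leStar_iff (Forces.isFun_real f) isFun_slowName]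
  intro q _
  have h1 : ∀ m, ∃ K, ∀ x ≥ K, ∀ n, h n ≤ m → f n ≤ g x := by
    intro m
    refine eventually_atTop.1 ?_
    have hfin : {n | h n ≤ m}.Finite := by
      obtain ⟨N, hN⟩ := eventually_atTop.1 (hh.eventually (eventually_gt_atTop m))
      exact (Set.finite_Iio N).subset fun n hn => by
        by_contra hc
        exact absurd (hN n (not_lt.1 hc)) (not_lt.2 hn)
    exact (eventually_all_finite hfin).2 fun n _ => hg.eventually (eventually_ge_atTop _)
  choose f' hf' using h1
  obtain ⟨N, hN⟩ := eventually_atTop.1 (hh.eventually (eventually_ge_atTop q.stem.length))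
  refine ⟨q.raise f', raise_le _ _, N, fun n hn s hs i j hi hj => ?_⟩
  obtain ⟨t, ht, hl, rfl⟩ := app_slowName hj
  rw [← Forces.app_real.1 hi]
  refine hf' (h n) _ ?_ n le_rfl
  exact (le_max_right _ _).trans ((ht.trans hs).2.2 (h n) hl (hN n hn))

/-- `g (d (h n)) ≤ g' (d (h n)) ≤ g' (d (h' n))`. The first inequality needs `d (h n)` beyond the
threshold `K`, which becomes the commitment; the second needs the generic real to be nondecreasing.
-/
theorem slowName_le_slowName (hg : ∀ᶠ n in atTop, g n ≤ g' n) (hh : ∀ᶠ n in atTop, h n ≤ h' n)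
    (mono : Monotone g') (hh' : Tendsto h atTop atTop) :
    Forces p (leStar (omega _) (slowName.{u} g h) (slowName g' h')) := by
  rw [Forces.leStar_iff isFun_slowName isFun_slowName]
  intro q _
  obtain ⟨K, hK⟩ := eventually_atTop.1 hg
  obtain ⟨N, hN⟩ :=
    eventually_atTop.1 ((hh'.eventually (eventually_ge_atTop q.stem.length)).and hh)
  refine ⟨q.raise fun _ => K, raise_le _ _, N, fun n hn s hs i j hi hj => ?_⟩
  obtain ⟨t, ht, hl, rfl⟩ := app_slowName hi
  obtain ⟨t', ht', hl', rfl⟩ := app_slowName (hj.mono ht)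
  have h1 : K ≤ t.stem[h n] :=
    (le_max_right _ _).trans ((ht.trans hs).2.2 (h n) hl (hN n hn).1)
  have h2 : t.stem[h n] ≤ t'.stem[h' n] := by
    rw [ht'.1.getElem hl]
    rcases (hN n hn).2.eq_or_lt with e | e
    · simp only [e, le_refl]
    · exact List.pairwise_iff_getElem.1 t'.nondecreasing _ _ _ _ e
  exact (hK _ h1).trans (mono h2)

/-- If `p` forces `y` to be dominating then, for suitable ground model reals `g` and `h`, it can be
extended to force that `n ↦ g (d (h n))` is below `y`. -/
theorem exists_slowName_le {y : PName.{u, 0} HechlerND}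
    (hy : Forces p (isDominating (omega _) groundReals y)) :
    ∃ q ≤ p, ∃ g h : ℕ → ℕ, Monotone g ∧ Tendsto g atTop atTop ∧ Tendsto h atTop atTop ∧
      Forces q (leStar (omega _) (slowName g h) y) := by
  obtain ⟨hfun, hdom⟩ := Forces.and_iff.1 hy
  -- `Fav t n k`: no condition with stem `t` forces `y n ≠ k`
  let Fav (t : List ℕ) (n k : ℕ) : Prop := ∃ ht : t.Pairwise (· ≤ ·), ∀ c, ∃ r,
    r ≤ (⟨t, ht, c⟩ : HechlerND) ∧ Forces r (app y (nat n) (nat k))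
  let Ext (s : List ℕ) (n h : ℕ) (t : List ℕ) : Prop :=
    s <+: t ∧ t.length ≤ h ∧ ∀ i (hi : i < t.length), s.length ≤ i → n ≤ t[i]
  -- For each `n` there are finitely many length bounds and initial stems to consider, so one number
  -- bounds a favoured value for every pair that has one. The resulting `F` is a ground model real,
  -- hence dominated by `y`.
  have hF : ∀ n, ∃ B, ∀ x ∈ (Set.Iic n ×ˢ {s : List ℕ | s.length ≤ n ∧ ∀ a ∈ s, a ≤ n}),
      (∃ t k, Ext x.2 n x.1 t ∧ Fav t n k) → ∃ t k, Ext x.2 n x.1 t ∧ Fav t n k ∧ k < B := by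
    intro n
    refine exists_uniform_bound ((Set.finite_Iic n).prod (finite_lists n)) ?_ ?_
    · rintro x B B' hB H h
      obtain ⟨t, k, h1, h2, h3⟩ := H h
      exact ⟨t, k, h1, h2, h3.trans_le hB⟩
    · rintro x -
      by_cases h : ∃ t k, Ext x.2 n x.1 t ∧ Fav t n k
      · obtain ⟨t, k, h1, h2⟩ := h
        exact ⟨k + 1, fun _ => ⟨t, k, h1, h2, Nat.lt_succ_self k⟩⟩
      · exact ⟨0, fun h' => absurd h' h⟩
  choose F hF using hF
  obtain ⟨r, hrp, N, hN⟩ := (Forces.leStar_iff (Forces.isFun_real F) hfun).1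
    (hdom (real F) p le_rfl (Forces.real_mem_groundReals F)) p le_rfl
  have hN : ∀ n ≥ N, ∀ s ≤ r, ∀ j, Forces s (app y (nat n) (nat j)) → F n ≤ j :=
    fun n hn s hs j hj => hN n hn s hs _ j (Forces.app_real.2 rfl) hj
  -- Below position `H n` the commitment of `r` is at most `n`, so new entries of size at least `n`
  -- there respect it automatically. The summand `h` gives `H n ≤ n`.
  obtain ⟨H, -, hHtop, hH, -⟩ := exists_inverse fun h => h + ∑ i ∈ Finset.range h, r.commit i
  have hHn : ∀ n, H n ≤ n := fun n => by
    by_cases h0 : H n = 0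
    · omega
    · exact (Nat.le_add_right _ _).trans (hH n h0)
  have hHc : ∀ n, ∀ i < H n, r.commit i ≤ n := fun n i hi => by
    refine (Finset.single_le_sum (f := r.commit) (fun _ _ => Nat.zero_le _)
      (Finset.mem_range.2 hi)).trans ((Nat.le_add_left _ _).trans (hH n (by omega)))
  let M := r.stem.sum + 1
  have hM : ∀ a ∈ r.stem, a < M := fun a ha => Nat.lt_succ_of_le (List.le_sum_of_mem ha)
  -- Short stems favour no value. Cut `t` at its first entry of size at least `n`, which lies past
  -- `r.stem` because `n ≥ M`. By the choice of `F`, the tail can be replaced so that a value below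
  -- `F n` is favoured. The new stem still gives a condition below `r`, and that condition forces `F
  -- n ≤ y n`.
  have hA : ∀ n, N ≤ n → M ≤ n → ∀ (t : List ℕ) (ht : t.Pairwise (· ≤ ·)),
      (⟨t, ht, r.commit⟩ : HechlerND) ≤ r → t.length ≤ H n → ∀ k, ¬ Fav t n k := by
    classical
    intro n hn hMn t ht htr htH k hk
    obtain ⟨m, hmt, hm1, hm2⟩ : ∃ m, m ≤ t.length ∧ (∀ i (hi : i < t.length), i < m → t[i] < n) ∧
        ∀ i (hi : i < t.length), m ≤ i → n ≤ t[i] := by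
      have hex : ∃ m, ∀ (h : m < t.length), n ≤ t[m] :=
        ⟨t.length, fun h => absurd h (lt_irrefl _)⟩
      refine ⟨Nat.find hex, Nat.find_le fun h => absurd h (lt_irrefl _), fun i hi him => ?_,
        fun i hi him => ?_⟩
      · have := Nat.find_min hex him
        push Not at this
        exact this.2
      · have h1 := Nat.find_spec hex (him.trans_lt hi)
        rcases him.eq_or_lt with e | e
        · simp only [e] at h1; exact h1
        · exact h1.trans (List.pairwise_iff_getElem.1 ht _ _ _ _ e)
    have hst : r.stem.length ≤ m := by
      by_contra! hc
      have h1 := hm2 m (hc.trans_le htr.1.length_le) le_rfl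
      rw [← htr.1.getElem hc] at h1
      exact absurd (hM _ (List.getElem_mem hc)) (by omega)
    have hlen : (t.take m).length = m := by simp [hmt]
    obtain ⟨t', k', ⟨h1, h2, h3⟩, ⟨ht', h4⟩, h5⟩ := hF n (H n, t.take m)
      ⟨hHn n, by have := hHn n; change (t.take m).length ≤ n; omega, fun a ha => by
        obtain ⟨i, hi, rfl⟩ := List.mem_iff_getElem.1 ha
        rw [hlen] at hi
        rw [List.getElem_take]
        exact (hm1 i _ hi).le⟩
      ⟨t, k, ⟨List.take_prefix _ _, htH, fun i hi hi' => hm2 i hi (by rwa [hlen] at hi')⟩, hk⟩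
    obtain ⟨w, hw, h6⟩ := h4 r.commit
    have h7 : (⟨t', ht', r.commit⟩ : HechlerND) ≤ r := by
      refine ⟨?_, fun _ => le_rfl, fun i hi hi' => ?_⟩
      · refine (List.prefix_of_prefix_length_le htr.1 (List.take_prefix m t) ?_).trans h1
        omega
      · change i < t'.length at hi
        change r.commit i ≤ t'[i]
        rcases lt_or_ge i m with him | him
        · have hi2 : i < (t.take m).length := by omega
          have e : (t.take m)[i] = t'[i] := h1.getElem hi2
          rw [← e, List.getElem_take]
          exact htr.2.2 i (by change i < t.length; omega) hi'
        · exact (hHc n i (by omega)).trans (h3 i hi (by change (t.take m).length ≤ i; omega))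
    exact absurd (hN n hn w (hw.trans h7) k' h6) (by omega)
  -- Each value can be avoided without lengthening the stem, and the sum of the commitments avoids
  -- all values up to `k` together.
  have hc : ∀ (t : List ℕ) (n k : ℕ), ∃ c : ℕ → ℕ, ∀ ht : t.Pairwise (· ≤ ·),
      (⟨t, ht, r.commit⟩ : HechlerND) ≤ r → N ≤ n → M ≤ n → t.length ≤ H n →
      ∀ k' ≤ k, ∀ s ≤ (⟨t, ht, c⟩ : HechlerND), ¬ Forces s (app y (nat n) (nat k')) := by
    intro t n k
    by_cases ht : t.Pairwise (· ≤ ·)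
    swap
    · exact ⟨0, fun h => absurd h ht⟩
    by_cases hyp : (⟨t, ht, r.commit⟩ : HechlerND) ≤ r ∧ N ≤ n ∧ M ≤ n ∧ t.length ≤ H n
    swap
    · exact ⟨0, fun _ h1 h2 h3 h4 => absurd ⟨h1, h2, h3, h4⟩ hyp⟩
    have h1 : ∀ k', ∃ c : ℕ → ℕ, ∀ s ≤ (⟨t, ht, c⟩ : HechlerND),
        ¬ Forces s (app y (nat n) (nat k')) := by
      intro k'
      have := hA n hyp.2.1 hyp.2.2.1 t ht hyp.1 hyp.2.2.2 k'
      simp only [Fav, ht, exists_true_left] at this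
      push Not at this
      exact this
    choose c hc using h1
    refine ⟨fun i => ∑ k' ∈ Finset.range (k + 1), c k' i, fun _ _ _ _ _ k' hk' s hs => ?_⟩
    refine hc k' s (hs.trans ⟨List.prefix_refl _, fun i => ?_,
      fun _ h h' => absurd h (not_lt.2 h')⟩)
    exact Finset.single_le_sum (f := fun k' => c k' i) (fun _ _ => Nat.zero_le _)
      (Finset.mem_range.2 (Nat.lt_succ_of_le hk'))
  choose c hc using hc
  obtain ⟨Φ, hΦ', hΦc⟩ : ∃ Φ : ℕ → ℕ, (∀ x, x ≤ Φ x) ∧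
      ∀ x, ∀ t : List ℕ, t.length ≤ x → (∀ a ∈ t, a ≤ x) → ∀ n ≤ x, ∀ k ≤ x, ∀ i ≤ x,
        c t n k i ≤ Φ x := by
    have h1 : ∀ x, ∃ B, ∀ w ∈ {s : List ℕ | s.length ≤ x ∧ ∀ a ∈ s, a ≤ x} ×ˢ
        (Set.Iic x ×ˢ (Set.Iic x ×ˢ Set.Iic x)), c w.1 w.2.1 w.2.2.1 w.2.2.2 ≤ B := fun x =>
      exists_uniform_bound ((finite_lists x).prod ((Set.finite_Iic x).prod
        ((Set.finite_Iic x).prod (Set.finite_Iic x)))) (fun _ _ _ h h' => h'.trans h)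
        (fun _ _ => ⟨_, le_rfl⟩)
    choose B hB using h1
    refine ⟨fun x => x + ∑ i ∈ Finset.range (x + 1), B i, fun x => Nat.le_add_right _ _,
      fun x t ht ha n hn k hk i hi => ?_⟩
    exact (hB x (t, n, k, i) ⟨⟨ht, ha⟩, hn, hk, hi⟩).trans
        ((Finset.single_le_sum (f := B) (fun _ _ => Nat.zero_le _)
          (Finset.mem_range.2 (Nat.lt_succ_self x))).trans (Nat.le_add_left _ _))
  -- Cut the stem of `s` just before the jump. The avoiding commitment for the shorter stem is met
  -- by the rest of the stem: up to `z` because of the jump and monotonicity, beyond `z` because `s`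
  -- already respects `Φ`. So `s` is compatible with avoiding `k`.
  have hjump : ∀ s ≤ r.raise Φ, ∀ n, N ≤ n → M ≤ n → ∀ k z l, ∀ hl : l < s.stem.length,
      r.stem.length ≤ l → l ≤ H n → n ≤ z → k ≤ z → l ≤ z → (∀ a ∈ s.stem.take l, a ≤ z) →
      Φ z ≤ s.stem[l] → ¬ Forces s (app y (nat n) (nat k)) := by
    intro s hs n hn hMn k z l hl hrl hlH hnz hkz hlz hz hzl hf
    have hsr : s ≤ r := hs.trans (raise_le _ _)
    have hlen : (s.stem.take l).length = l := by simp [hl.le]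
    have ht : (s.stem.take l).Pairwise (· ≤ ·) :=
      s.nondecreasing.sublist (List.take_sublist _ _)
    let c' := c (s.stem.take l) n k
    refine hc (s.stem.take l) n k ht ⟨?_, fun _ => le_rfl, fun i hi hi' => ?_⟩ hn hMn (by omega) k
      le_rfl (s.raise c') ⟨List.take_prefix _ _, fun i => le_max_right _ _, fun i hi hi' => ?_⟩
      (hf.mono (raise_le _ _))
    · exact List.prefix_of_prefix_length_le hsr.1 (List.take_prefix _ _) (hrl.trans hlen.ge)
    · change r.commit i ≤ (s.stem.take l)[i]
      rw [List.getElem_take]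
      exact hsr.2.2 i _ hi'
    · change i < s.stem.length at hi
      change (s.stem.take l).length ≤ i at hi'
      change c' i ≤ s.stem[i]
      rw [hlen] at hi'
      rcases le_or_gt i z with h1 | h1
      · refine (hΦc z _ (by omega) hz n hnz k hkz i h1).trans (hzl.trans ?_)
        rcases hi'.eq_or_lt with e | e
        · simp only [e, le_refl]
        · exact List.pairwise_iff_getElem.1 s.nondecreasing _ _ _ _ e
      · refine (hΦc i _ (by omega) (fun a ha => (hz a ha).trans h1.le) n (by omega) k (by omega) i
          le_rfl).trans ((le_max_right (r.commit i) _).trans (hs.2.2 i hi (hrl.trans hi')))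
  -- At most `z + 1` positions are available when `H n ≤ z`, hence the number of iterations. The
  -- final `+ 1` gives the strict inequality required by `exists_iterate_jump`.
  let G : ℕ → ℕ := fun z => Φ^[z + 1] z + 1
  obtain ⟨g, hgm, hgtop, hg, hg'⟩ := exists_inverse G
  -- As a commitment, `K` ensures `n ≤ g (d (H n))`, so that the starting bound of the jump argument
  -- is at least `n`.
  have hK : ∀ i, ∃ K, ∀ n ∈ {n | H n ≤ i}, max n (G n) ≤ K := by
    intro i
    have hfin : {n | H n ≤ i}.Finite := by
      obtain ⟨N, hN⟩ := eventually_atTop.1 (hHtop.eventually (eventually_gt_atTop i))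
      exact (Set.finite_Iio N).subset fun n hn => by
        by_contra hc
        exact absurd (hN n (not_lt.1 hc)) (not_lt.2 hn)
    exact exists_uniform_bound hfin (fun _ _ _ h h' => h'.trans h) (fun _ _ => ⟨_, le_rfl⟩)
  choose K hK using hK
  obtain ⟨N', hN'⟩ := eventually_atTop.1 (hHtop.eventually (eventually_ge_atTop r.stem.length))
  refine ⟨(r.raise Φ).raise K, (raise_le _ _).trans ((raise_le _ _).trans hrp), g, H, hgm, hgtop,
    hHtop, ?_⟩
  rw [Forces.leStar_iff isFun_slowName (hfun.mono ((raise_le _ _).trans ((raise_le _ _).trans hrp)))]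
  refine fun q hq => ⟨q, le_rfl, max N' (max N M), fun n hn s hs i j hi hj => ?_⟩
  -- If the value `j` of `y n` were below `g (d (H n))`, then `d (H n)` would be large enough for a
  -- jump at some position up to `H n`, and `hjump` would rule out `j`.
  by_contra! hji
  obtain ⟨t, hts, hl, rfl⟩ := app_slowName hi
  have htq : t ≤ (r.raise Φ).raise K := hts.trans (hs.trans hq)
  have htr : t ≤ r.raise Φ := htq.trans (raise_le _ _)
  have hn1 : r.stem.length ≤ H n := hN' n (by omega)
  have hv : max n (G n) ≤ t.stem[H n] :=
    (hK (H n) n (Set.mem_ofPred.2 le_rfl)).trans ((le_max_right _ _).trans (htq.2.2 (H n) hl hn1))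
  have h1 : n ≤ g t.stem[H n] := hg' _ _ (le_of_max_le_left hv) (le_of_max_le_right hv)
  have h2 : G (g t.stem[H n]) ≤ t.stem[H n] := hg _ (by omega)
  have hHn' := hHn n
  obtain ⟨l, z, hl', h3, h4, h5, h6, h7⟩ := exists_iterate_jump hΦ' hn1 hl
    (by omega : H n ≤ g t.stem[H n]) (fun a ha => by
      have e : t.stem.take r.stem.length = r.stem := (List.prefix_iff_eq_take.1 htr.1).symm
      rw [e] at ha
      have := hM a ha
      omega) (Nat.lt_of_succ_le h2)
  exact hjump t htr n (by omega) (by omega) j z l hl' h3 h4 (by omega) (by omega) (by omega) h6 h7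
    (hj.mono hts)

theorem forces_countableLowerBounds (p : HechlerND) :
    Forces p (countableLowerBounds (groundReals : PName.{u, 0} HechlerND)) := by
  intro o p1 _ ho s c p2 hp2 hs p3 hp3 hd
  have ho : Forces p3 (o ≐ omega _) := Forces.eq_omega (ho.mono (hp3.trans hp2))
  replace hs := hs.mono hp3
  -- lower bounds for the terms of the sequence, one for each stem
  let Good (n : ℕ) (q : HechlerND) (y : PName.{u, 0} HechlerND) (w : (ℕ → ℕ) × (ℕ → ℕ)) : Prop :=
    q ≤ p3 ∧ Forces q (app s (nat n) y) ∧ Forces q (isDominating (omega _) groundReals y) ∧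
      Monotone w.1 ∧ Tendsto w.1 atTop atTop ∧ Tendsto w.2 atTop atTop ∧
      Forces q (leStar (omega _) (slowName w.1 w.2) y)
  -- The choice depends only on `n` and the stem. The identities are a default for stems of no
  -- qualifying condition.
  have h1 : ∀ (n : ℕ) (t : List ℕ), ∃ w : (ℕ → ℕ) × (ℕ → ℕ), Monotone w.1 ∧
      Tendsto w.1 atTop atTop ∧ Tendsto w.2 atTop atTop ∧
      ((∃ q y w, Good n q y w ∧ q.stem = t) → ∃ q y, Good n q y w ∧ q.stem = t) := by
    intro n t
    by_cases h : ∃ q y w, Good n q y w ∧ q.stem = t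
    · obtain ⟨q, y, w, hw, e⟩ := h
      exact ⟨w, hw.2.2.2.1, hw.2.2.2.2.1, hw.2.2.2.2.2.1, fun _ => ⟨q, y, hw, e⟩⟩
    · exact ⟨(id, id), monotone_id, tendsto_id, tendsto_id, fun h' => absurd h' h⟩
  choose w hw1 hw2 hw3 hw using h1
  obtain ⟨β, hβ⟩ := exists_surjective_nat (ℕ × List ℕ)
  obtain ⟨g, _, hg, hg'⟩ := exists_slow (fun a => (w (β a).1 (β a).2).1) fun a => hw2 _ _
  obtain ⟨h, _, hh, hh'⟩ := exists_slow (fun a => (w (β a).1 (β a).2).2) fun a => hw3 _ _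
  refine Forces.ex_intro (slowName g h) (Forces.and_iff.2 ⟨?_, fun m q hq hm y r hr hy => ?_⟩)
  · exact (isDominating_slowName hg hh).congr
      (ForcedIff.isDominating ho.eq_symm Forces.eq_refl Forces.eq_refl)
  · have ho' := ho.mono hq
    refine Forces.omega_elim ((hm.mem_congr Forces.eq_refl ho').mono hr) fun r1 hr1 n hn => ?_
    refine Forces.of_dense fun r' hr' => ?_
    have hr3 : r' ≤ p3 := hr'.trans (hr1.trans (hr.trans hq))
    have hy1 : Forces r' (app s (nat n) y) :=
      (hy.mono (hr'.trans hr1)).app_congr (hn.mono hr') Forces.eq_refl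
    have hy2 : Forces r' (isDominating (omega _) groundReals y) :=
      (hd m r' hr3 (hm.mono (hr'.trans (hr1.trans hr))) y r' le_rfl (hy.mono (hr'.trans hr1))).congr
        (ForcedIff.isDominating (ho.mono hr3) Forces.eq_refl Forces.eq_refl)
    obtain ⟨r2, hr2, g', h', k1, k2, k3, k4⟩ := exists_slowName_le hy2
    -- The stored pair may come from another condition `q2` and another name `y2`. Equal stems make
    -- `q2` and `r2` compatible, and a common extension identifies `y2` with `y`, both being the
    -- value of the sequence at `n`.
    obtain ⟨q2, y2, ⟨-, l1, l2, -, -, -, l3⟩, e⟩ := hw n r2.stem ⟨r2, y, (g', h'),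
      ⟨hr2.trans hr3, hy1.mono hr2, hy2.mono hr2, k1, k2, k3, k4⟩, rfl⟩
    obtain ⟨v, hv, hv'⟩ := exists_compatible e.symm
    have hvr : v ≤ r' := hv.trans hr2
    have hyy : Forces v (y2 ≐ y) :=
      Forces.isFun_unique (hs.mono (hvr.trans hr3)) (l1.mono hv') (hy1.mono hvr)
    obtain ⟨a, ha⟩ := hβ (n, r2.stem)
    have h4 : Forces v (leStar (omega _) (slowName g h) (slowName (w n r2.stem).1 (w n r2.stem).2)) := by
      refine slowName_le_slowName ?_ ?_ (hw1 _ _) hh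
      · have := hg' a; rwa [ha] at this
      · have := hh' a; rwa [ha] at this
    refine ⟨v, hvr, ?_⟩
    refine Forces.congr ?_ (ForcedIff.leStar (ho.mono (hvr.trans hr3)).eq_symm Forces.eq_refl hyy)
    exact Forces.leStar_trans isFun_slowName isFun_slowName (Forces.and_iff.1 (l2.mono hv')).1 h4
      (l3.mono hv')

end HechlerND

/-! ## The axioms of ZFC are forced -/

namespace Forces

open SetFml PName

variable {P : Type} [Preorder P] {p : P}

theorem extensionality :
    Forces p (all fun a : PName.{u, 0} P => all fun b => (all fun z => z ∈' a ⟷' z ∈' b) ⟶' a ≐ b) :=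
  fun _ _ _ _ h => eq_of_mem_iff fun z r hr => iff_iff.1 (h z) r hr

/-- If a condition forces that there is no minimal element, induction on names shows that no name
can be forced into `a` below it. -/
theorem foundation : Forces p (all fun a : PName.{u, 0} P => (ex fun z => z ∈' a) ⟶'
    ex fun z => z ∈' a ⋏ all fun w => w ∈' z ⟶' SetFml.not (w ∈' a)) := by
  intro a q _ h
  by_contra hc
  obtain ⟨r, hr, hc⟩ := exists_not hc
  have key : ∀ x : PName.{u, 0} P, ∀ s ≤ r, ¬ Forces s (x ∈' a) := by
    intro x
    induction x using elt_induction with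
    | h x ih =>
      intro s hs hx
      refine hc s hs (ex_intro x (and_iff.2 ⟨hx, fun w t ht hw t' ht' hwa => ?_⟩))
      obtain ⟨v, hv, j, -, hj⟩ := mem_iff.1 hw t' ht'
      exact ih j v (hv.trans (ht'.trans (ht.trans hs))) ((hwa.mono hv).mem_congr hj eq_refl)
  obtain ⟨s, hs, x, hx⟩ := ex_iff.1 (h.mono hr) r le_rfl
  exact key x s hs hx

theorem union : Forces p (all fun a : PName.{u, 0} P => ex fun u => all fun z =>
    z ∈' u ⟷' ex fun w => w ∈' a ⋏ z ∈' w) := by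
  intro a
  let b : PName.{u, 0} P := mk {x : (Σ i : a.Idx, (a.elt i).Idx) × P //
    x.2 ≤ a.cnd x.1.1 ∧ x.2 ≤ (a.elt x.1.1).cnd x.1.2}
    (fun x => (a.elt x.1.1.1).elt x.1.1.2) (fun x => x.1.2)
  refine ex_intro b fun z => iff_iff.2 fun q _ => ⟨fun h => ?_, fun h => ?_⟩
  · refine ex_iff.2 fun q' hq' => ?_
    obtain ⟨r, hr, ⟨⟨⟨i, j⟩, s⟩, h1, h2⟩, h3, h4⟩ := mem_iff.1 h q' hq'
    exact ⟨r, hr, a.elt i, and_iff.2 ⟨mem_elt i (le_trans h3 h1),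
      (mem_elt j (le_trans h3 h2)).mem_congr h4.eq_symm eq_refl⟩⟩
  · refine ex_elim h fun r _ w hw => ?_
    obtain ⟨hw, hz⟩ := and_iff.1 hw
    refine mem_elim hw fun s hs i hi hwi => ?_
    refine mem_elim ((hz.mono hs).mem_congr eq_refl hwi) fun t ht j hj hzj => ?_
    exact (mem_elt (y := b) ⟨⟨⟨i, j⟩, t⟩, ht.trans hi, hj⟩ le_rfl).mem_congr hzj.eq_symm eq_refl

theorem separation {Φ : PName.{u, 0} P → SetFml (PName.{u, 0} P)}
    (hΦ : ∀ x y (q : P), Forces q (x ≐ y) → Forces q (Φ x) → Forces q (Φ y))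
    (a : PName.{u, 0} P) : Forces p (ex fun b => all fun z => z ∈' b ⟷' (z ∈' a ⋏ Φ z)) := by
  let b : PName.{u, 0} P := mk {x : a.Idx × P // x.2 ≤ a.cnd x.1 ∧ Forces x.2 (Φ (a.elt x.1))}
    (fun x => a.elt x.1.1) (fun x => x.1.2)
  refine ex_intro b fun z => iff_iff.2 fun q _ => ⟨fun h => ?_, fun h => ?_⟩
  · refine mem_elim h fun r hr => ?_
    rintro ⟨⟨i, s⟩, h1, h2⟩ (h3 : r ≤ s) h4
    exact and_iff.2 ⟨(mem_elt i (h3.trans h1)).mem_congr h4.eq_symm eq_refl,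
      hΦ _ _ r h4.eq_symm (h2.mono h3)⟩
  · obtain ⟨h1, h2⟩ := and_iff.1 h
    refine mem_elim h1 fun r hr i hi hz => ?_
    exact (mem_elt (y := b) ⟨⟨i, r⟩, hi, hΦ _ _ r hz (h2.mono hr)⟩ le_rfl).mem_congr
      hz.eq_symm eq_refl

/-- Every subset of `a` equals a name built from the indices of `a`: attach to each index the
conditions forcing its element into the subset. There is only a set of such names. -/
theorem powerset : Forces p (all fun a : PName.{u, 0} P => ex fun b => all fun z =>
    z ∈' b ⟷' all fun w => w ∈' z ⟶' w ∈' a) := by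
  intro a
  let c (S : a.Idx → P → Prop) : PName.{u, 0} P := mk {x : a.Idx × P // x.2 ≤ a.cnd x.1 ∧ S x.1 x.2}
    (fun x => a.elt x.1.1) (fun x => x.1.2)
  let b : PName.{u, 0} P := mk ((a.Idx → P → Prop) × P) (fun S => c S.1) (fun S => S.2)
  refine ex_intro b fun z => iff_iff.2 fun q _ => ⟨fun h => ?_, fun h => ?_⟩
  · intro w r hr hw
    refine mem_elim (h.mono hr) fun s hs S _ hz => ?_
    refine mem_elim ((hw.mono hs).mem_congr eq_refl hz) fun t ht => ?_
    rintro ⟨⟨i, s⟩, h1, -⟩ (h3 : t ≤ s) (h4 : Forces t (w ≐ a.elt i))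
    exact (mem_elt i (h3.trans h1)).mem_congr h4.eq_symm eq_refl
  · let S : a.Idx → P → Prop := fun i r => Forces r (a.elt i ∈' z)
    refine (mem_elt (y := b) (S, q) le_rfl).mem_congr (eq_of_mem_iff fun w r hr => ?_) eq_refl
    constructor
    · intro hw
      refine mem_elim hw fun s hs => ?_
      rintro ⟨⟨i, t⟩, _, h2⟩ (h3 : s ≤ t) (h4 : Forces s (w ≐ a.elt i))
      exact (Forces.mono h2 h3).mem_congr h4.eq_symm eq_refl
    · intro hw
      refine mem_elim (h w r hr hw) fun s hs i hi hwi => ?_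
      exact (mem_elt (y := c S) ⟨⟨i, s⟩, hi, (hw.mono hs).mem_congr hwi eq_refl⟩ le_rfl).mem_congr
        hwi.eq_symm eq_refl

/-- One value is chosen for each index of `a` and each condition. By uniqueness in the extension it
does not matter which one. -/
theorem replacement {Φ : PName.{u, 0} P → PName.{u, 0} P → SetFml (PName.{u, 0} P)}
    (hΦ : ∀ x y x' y' (q : P), Forces q (x ≐ x') → Forces q (y ≐ y') → Forces q (Φ x y) →
      Forces q (Φ x' y'))
    (a : PName.{u, 0} P) :
    Forces p ((all fun x => x ∈' a ⟶' ex fun y => Φ x y ⋏ all fun y' => Φ x y' ⟶' y' ≐ y) ⟶'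
      ex fun b => all fun y => y ∈' b ⟷' ex fun x => x ∈' a ⋏ Φ x y) := by
  intro p _ h
  have hy : ∀ (i : a.Idx) (r : P), ∃ y, (∃ y, Forces r (Φ (a.elt i) y)) → Forces r (Φ (a.elt i) y) := by
    intro i r
    by_cases h : ∃ y, Forces r (Φ (a.elt i) y)
    · exact ⟨h.choose, fun _ => h.choose_spec⟩
    · exact ⟨a, fun h' => absurd h' h⟩
  choose Y hY using hy
  let b : PName.{u, 0} P := mk {x : a.Idx × P // x.2 ≤ a.cnd x.1 ∧ ∃ y, Forces x.2 (Φ (a.elt x.1) y)}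
    (fun x => Y x.1.1 x.1.2) (fun x => x.1.2)
  refine ex_intro b fun y => iff_iff.2 fun q hq => ⟨fun h1 => ?_, fun h1 => ?_⟩
  · refine mem_elim h1 fun r hr => ?_
    rintro ⟨⟨i, s⟩, h2, h3⟩ (h4 : r ≤ s) h5
    exact ex_intro (a.elt i) (and_iff.2 ⟨mem_elt i (h4.trans h2),
      hΦ _ _ _ _ r eq_refl h5.eq_symm ((hY i s h3).mono h4)⟩)
  · refine ex_elim h1 fun r hr x hx => ?_
    obtain ⟨hx, hxy⟩ := and_iff.1 hx
    refine mem_elim hx fun s hs i hi hxi => ?_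
    have h2 : Forces s (Φ (a.elt i) y) := hΦ _ _ _ _ s hxi eq_refl (hxy.mono hs)
    have hsp : s ≤ p := hs.trans (hr.trans hq)
    refine ex_elim (h (a.elt i) s hsp (mem_elt i hi)) fun t ht y' hy' => ?_
    obtain ⟨-, hy'⟩ := and_iff.1 hy'
    have h3 : Forces t (y ≐ y') := hy' y t le_rfl (h2.mono ht)
    have h4 : Forces t (Φ (a.elt i) (Y i t)) := hY i t ⟨y, h2.mono ht⟩
    have h5 : Forces t (Y i t ≐ y') := hy' _ t le_rfl h4
    exact (mem_elt (y := b) ⟨⟨i, t⟩, ht.trans hi, y, h2.mono ht⟩ le_rfl).mem_congr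
      (h5.eq_trans h3.eq_symm) eq_refl

/-- Well-order in the ground model the indices `K` of elements of elements of `a`, and let each
member of `a` select the least index whose element belongs to it. Two indices of `a` may name the
same set; they then select the same element of `K`. -/
theorem choice : Forces p (all fun a : PName.{u, 0} P =>
    (all fun x => x ∈' a ⟶' ex fun z => z ∈' x) ⟶'
    (all fun x => all fun y => all fun z => x ∈' a ⟶' y ∈' a ⟶' z ∈' x ⟶' z ∈' y ⟶' x ≐ y) ⟶'
    ex fun c => all fun x => x ∈' a ⟶' ex fun z => (z ∈' x ⋏ z ∈' c) ⋏
      all fun z' => (z' ∈' x ⋏ z' ∈' c) ⟶' z' ≐ z) := by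
  intro a p1 _ hne p2 hp2 hdisj
  let K := Σ i : a.Idx, (a.elt i).Idx
  let el (k : K) : PName.{u, 0} P := (a.elt k.1).elt k.2
  let Sel (i : a.Idx) (k : K) (r : P) : Prop := Forces r (a.elt i ∈' a) ∧
    Forces r (el k ∈' a.elt i) ∧ ∀ k', WellOrderingRel k' k → Forces r (SetFml.not (el k' ∈' a.elt i))
  let c : PName.{u, 0} P := mk {x : a.Idx × K × P // Sel x.1 x.2.1 x.2.2}
    (fun x => el x.1.2.1) (fun x => x.1.2.2)
  refine ex_intro c fun x p3 hp3 hx => ?_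
  refine mem_elim hx fun q hq i hi hxi => of_dense fun q' hq' => ?_
  have hqp : q' ≤ p2 := hq'.trans (hq.trans hp3)
  replace hxi := hxi.mono hq'
  have hai : Forces q' (a.elt i ∈' a) := mem_elt i (hq'.trans hi)
  have hex : ∃ k, ∃ r ≤ q', Forces r (el k ∈' a.elt i) := by
    obtain ⟨r, hr, z, hz⟩ := ex_iff.1 (hne (a.elt i) q' (hqp.trans hp2) hai) q' le_rfl
    obtain ⟨s, hs, j, hj, hzj⟩ := mem_iff.1 hz r le_rfl
    exact ⟨⟨i, j⟩, s, hs.trans hr, mem_elt j hj⟩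
  obtain ⟨k, ⟨r, hr, hk⟩, hmin⟩ := (IsWellFounded.wf (r := WellOrderingRel (α := K))).has_min
    {k | ∃ r ≤ q', Forces r (el k ∈' a.elt i)} hex
  have hsel : Sel i k r := ⟨hai.mono hr, hk, fun k' hk' s hs hs' =>
    hmin k' ⟨s, hs.trans hr, hs'⟩ hk'⟩
  refine ⟨r, hr, ex_intro (el k) (and_iff.2 ⟨and_iff.2 ⟨?_, ?_⟩, fun z s hs hz => ?_⟩)⟩
  · exact hk.mem_congr eq_refl (hxi.mono hr).eq_symm
  · exact mem_elt (y := c) ⟨⟨i, k, r⟩, hsel⟩ le_rfl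
  · obtain ⟨hz1, hz2⟩ := and_iff.1 hz
    refine mem_elim hz2 fun t ht => ?_
    rintro ⟨⟨i', k', w⟩, hsel'⟩ (hw : t ≤ w) (hzk : Forces t (z ≐ el k'))
    have htr : t ≤ r := ht.trans hs
    have hii : Forces t (a.elt i' ≐ a.elt i) := by
      refine hdisj _ _ z t (htr.trans (hr.trans hqp)) (hsel'.1.mono hw) t le_rfl
        (hai.mono (htr.trans hr)) t le_rfl ?_ t le_rfl ?_
      · exact (hsel'.2.1.mono hw).mem_congr hzk.eq_symm eq_refl
      · exact (hz1.mono ht).mem_congr eq_refl (hxi.mono (htr.trans hr))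
    obtain rfl : k' = k := by
      rcases trichotomous_of WellOrderingRel k' k with h | h | h
      · exact absurd ((hsel'.2.1.mono hw).mem_congr eq_refl hii) (hsel.2.2 k' h t htr)
      · exact h
      · exact absurd ((hk.mono htr).mem_congr eq_refl hii.eq_symm) (hsel'.2.2 k h t hw)
    exact hzk

end Forces

/-! ## First-order formulas -/

/-- first-order formulas of the language `{∈, =}` with de Bruijn indices -/
inductive Fml where
  | bot : Fml
  | eq (i j : ℕ) : Fml
  | mem (i j : ℕ) : Fml
  | imp (φ ψ : Fml) : Fml
  | all (φ : Fml) : Fml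
deriving Countable

namespace Fml

open SetFml

def not (φ : Fml) : Fml := imp φ bot
def and (φ ψ : Fml) : Fml := not (imp φ (not ψ))
def or (φ ψ : Fml) : Fml := imp (not φ) ψ
def iff (φ ψ : Fml) : Fml := and (imp φ ψ) (imp ψ φ)
def ex (φ : Fml) : Fml := not (all (not φ))

def allIn (a : ℕ) (φ : Fml) : Fml := all (imp (mem 0 (a + 1)) φ)
def exIn (a : ℕ) (φ : Fml) : Fml := ex (and (mem 0 (a + 1)) φ)
def sub (a b : ℕ) : Fml := allIn a (mem 0 (b + 1))
def isPair (z x y : ℕ) : Fml := all (iff (mem 0 (z + 1)) (or (eq 0 (x + 1)) (eq 0 (y + 1))))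
def isOPair (z x y : ℕ) : Fml := ex (ex (and (isPair 1 (x + 2) (x + 2))
  (and (isPair 0 (x + 2) (y + 2)) (isPair (z + 2) 1 0))))
def isEmpty (a : ℕ) : Fml := all (not (mem 0 (a + 1)))
def isSucc (y x : ℕ) : Fml := all (iff (mem 0 (y + 1)) (or (mem 0 (x + 1)) (eq 0 (x + 1))))
def isInductive (i : ℕ) : Fml :=
  and (exIn i (isEmpty 0)) (allIn i (exIn (i + 1) (isSucc 0 1)))
def isOmega (o : ℕ) : Fml := and (isInductive o) (all (imp (isInductive 0) (sub (o + 1) 0)))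
def app (f x y : ℕ) : Fml := exIn f (isOPair 0 (x + 1) (y + 1))
def isFun (f a b : ℕ) : Fml :=
  and (allIn f (exIn (a + 1) (exIn (b + 2) (isOPair 2 1 0))))
    (allIn a (exIn (b + 1) (and (app (f + 2) 1 0) (all (imp (app (f + 3) 2 0) (eq 0 1))))))
def isInj (f : ℕ) : Fml :=
  all (all (all (imp (app (f + 3) 2 0) (imp (app (f + 3) 1 0) (eq 2 1)))))
def cardLE (a b : ℕ) : Fml := ex (and (isFun 0 (a + 1) (b + 1)) (isInj 0))
def cardEq (a b : ℕ) : Fml := ex (and (isFun 0 (a + 1) (b + 1)) (and (isInj 0)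
  (allIn (b + 1) (exIn (a + 2) (app 2 0 1)))))
def leStar (o x y : ℕ) : Fml := exIn o (allIn (o + 1) (imp (sub 1 0)
  (all (all (imp (app (x + 4) 2 1) (imp (app (y + 4) 2 0) (sub 1 0)))))))
def isDominating (o F y : ℕ) : Fml := and (isFun y o o) (allIn F (leStar (o + 1) 0 (y + 1)))
def isUnboundedIn (le : ℕ → ℕ → ℕ → Fml) (o X H : ℕ) : Fml :=
  and (sub H X) (not (exIn X (allIn (H + 1) (le (o + 2) 0 1))))
def isBoundingNumber (le : ℕ → ℕ → ℕ → Fml) (o X κ : ℕ) : Fml :=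
  and (ex (and (isUnboundedIn le (o + 1) (X + 1) 0) (cardEq 0 (κ + 1))))
    (all (imp (isUnboundedIn le (o + 1) (X + 1) 0) (cardLE (κ + 1) 0)))

/-- the formula `SetFml.existsLaflammeFamily` -/
def existsLaflammeFamily : Fml :=
  ex (ex (ex (ex (ex (and (isOmega 4) (and (all (iff (mem 0 4) (isFun 0 5 5)))
    (and (sub 2 3) (and (exIn 3 (allIn 3 (leStar 6 0 1)))
    (and (all (iff (mem 0 2) (isDominating 5 3 0)))
    (and (isBoundingNumber leStar 4 2 0)
    (and (isBoundingNumber (fun o x y => leStar o y x) 4 1 0)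
      (isBoundingNumber leStar 4 3 0))))))))))))

/-- the formula with its free variables replaced by the entries of a list -/
def interp {U : Type*} (d : U) : Fml → List U → SetFml U
  | bot, _ => .bot
  | eq i j, l => .eq (l.getD i d) (l.getD j d)
  | mem i j, l => .mem (l.getD i d) (l.getD j d)
  | imp φ ψ, l => .imp (φ.interp d l) (ψ.interp d l)
  | all φ, l => .all fun x => φ.interp d (x :: l)

/-- the action of a renaming of the free variables -/
def rename : (ℕ → ℕ) → Fml → Fml
  | _, bot => bot
  | f, eq i j => eq (f i) (f j)
  | f, mem i j => mem (f i) (f j)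
  | f, imp φ ψ => imp (φ.rename f) (ψ.rename f)
  | f, all φ => all (φ.rename fun i => Nat.casesOn i 0 fun j => f j + 1)

theorem interp_rename {U : Type*} (d : U) (φ : Fml) (f : ℕ → ℕ) (l l' : List U)
    (h : ∀ i, l.getD (f i) d = l'.getD i d) : (φ.rename f).interp d l = φ.interp d l' := by
  induction φ generalizing f l l' with
  | bot => rfl
  | eq i j => simp only [rename, interp, h]
  | mem i j => simp only [rename, interp, h]
  | imp φ ψ ih ih' => simp only [rename, interp, ih f l l' h, ih' f l l' h]
  | all φ ih =>
    simp only [rename, interp]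
    congr 1
    funext x
    refine ih _ _ _ fun i => ?_
    cases i with
    | zero => rfl
    | succ i => simpa using h i

/-- the existence of `{z ∈ a : φ z}` -/
def separation (φ : Fml) : Fml :=
  ex (all (iff (mem 0 1) (and (mem 0 2) (φ.rename fun i => Nat.casesOn i 0 fun j => j + 3))))

theorem interp_separation {U : Type*} (d a : U) (l : List U) (φ : Fml) :
    (separation φ).interp d (a :: l) =
      SetFml.ex fun b => .all fun z => z ∈' b ⟷' (z ∈' a ⋏ φ.interp d (z :: l)) := by
  have h : ∀ b z : U, (φ.rename fun i => Nat.casesOn i 0 fun j => j + 3).interp d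
      (z :: b :: a :: l) = φ.interp d (z :: l) := fun b z =>
    interp_rename d φ _ _ _ fun i => by cases i <;> rfl
  change (SetFml.ex fun b => .all fun z => z ∈' b ⟷' (z ∈' a ⋏
    (φ.rename fun i => Nat.casesOn i 0 fun j => j + 3).interp d (z :: b :: a :: l))) = _
  simp only [h]

/-- the map sending `0` to `a`, `1` to `b` and `i + 2` to `i + c` -/
def shift (a b c : ℕ) (i : ℕ) : ℕ := Nat.casesOn i a fun j => Nat.casesOn j b fun k => k + c

/-- the existence of the image of `a` under a function defined by `φ` -/
def replacement (φ : Fml) : Fml :=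
  imp (all (imp (mem 0 1) (ex (and (φ.rename (shift 1 0 3))
      (all (imp (φ.rename (shift 2 0 4)) (eq 0 1)))))))
    (ex (all (iff (mem 0 1) (ex (and (mem 0 3) (φ.rename (shift 0 1 4)))))))

theorem interp_replacement {U : Type*} (d a : U) (l : List U) (φ : Fml) :
    (replacement φ).interp d (a :: l) =
      ((SetFml.all fun x => x ∈' a ⟶' SetFml.ex fun y => φ.interp d (x :: y :: l) ⋏
          .all fun y' => φ.interp d (x :: y' :: l) ⟶' y' ≐ y) ⟶'
        SetFml.ex fun b => .all fun y => y ∈' b ⟷' .ex fun x => x ∈' a ⋏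
          φ.interp d (x :: y :: l)) := by
  have aux : ∀ {a b c : ℕ} {l' : List U} {x y : U}, l'.getD a d = x → l'.getD b d = y →
      (∀ i, l'.getD (i + c) d = l.getD i d) →
      (φ.rename (shift a b c)).interp d l' = φ.interp d (x :: y :: l) := by
    intro a b c l' x y h1 h2 h3
    refine interp_rename d φ _ _ _ fun i => ?_
    rcases i with _ | _ | i
    · exact h1
    · exact h2
    · exact h3 i
  have h1 : ∀ x y : U, (φ.rename (shift 1 0 3)).interp d (y :: x :: a :: l) =
    φ.interp d (x :: y :: l) := fun x y => aux rfl rfl fun _ => rfl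
  have h2 : ∀ x y y' : U, (φ.rename (shift 2 0 4)).interp d (y' :: y :: x :: a :: l) =
    φ.interp d (x :: y' :: l) := fun x y y' => aux rfl rfl fun _ => rfl
  have h3 : ∀ x y b : U, (φ.rename (shift 0 1 4)).interp d (x :: y :: b :: a :: l) =
    φ.interp d (x :: y :: l) := fun x y b => aux rfl rfl fun _ => rfl
  change ((SetFml.all fun x => x ∈' a ⟶' SetFml.ex fun y =>
      (φ.rename (shift 1 0 3)).interp d (y :: x :: a :: l) ⋏
        .all fun y' => (φ.rename (shift 2 0 4)).interp d (y' :: y :: x :: a :: l) ⟶' y' ≐ y) ⟶'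
      SetFml.ex fun b => .all fun y => y ∈' b ⟷' .ex fun x => x ∈' a ⋏
        (φ.rename (shift 0 1 4)).interp d (x :: y :: b :: a :: l)) = _
  simp only [h1, h2, h3]

theorem forcedIff_interp {P : Type} [Preorder P] {p : P} {d : PName.{u, 0} P} (φ : Fml)
    (l l' : List (PName.{u, 0} P)) (h : ∀ i, Forces p (l.getD i d ≐ l'.getD i d)) :
    ForcedIff p (φ.interp d l) (φ.interp d l') := by
  induction φ generalizing l l' with
  | bot => exact ForcedIff.refl
  | eq i j => exact ForcedIff.eq (h i) (h j)
  | mem i j => exact ForcedIff.mem (h i) (h j)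
  | imp φ ψ ih ih' => exact (ih l l' h).imp (ih' l l' h)
  | all φ ih =>
    refine ForcedIff.all fun x => ih _ _ fun i => ?_
    cases i with
    | zero => exact Forces.eq_refl
    | succ i => exact h i

/-- The two syntaxes number bound variables in opposite directions: the newest one is last in `Fin
n` but first in the list. Hence the position `n - 1 - i`, with the free variables after all bound
ones. -/
theorem exists_interp_iff_realize {α : Type*} {n : ℕ} (ψ : memLanguage.BoundedFormula α n)
    (idx : α → ℕ) : ∃ φ : Fml, ∀ {M : Type u} (E : M → M → Prop) (d : M) (v : α → M)
      (xs : Fin n → M) (l : List M), (∀ i : Fin n, l.getD (n - 1 - i) d = xs i) →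
      (∀ a, l.getD (n + idx a) d = v a) →
      (Holds E (φ.interp d l) ↔
        @FirstOrder.Language.BoundedFormula.Realize _ M (memStructure E) _ _ ψ v xs) := by
  have term : ∀ {n : ℕ} (t : memLanguage.Term (α ⊕ Fin n)), ∃ i : ℕ,
      ∀ {M : Type u} (E : M → M → Prop) (d : M) (v : α → M)
      (xs : Fin n → M) (l : List M), (∀ i : Fin n, l.getD (n - 1 - i) d = xs i) →
      (∀ a, l.getD (n + idx a) d = v a) →
      @FirstOrder.Language.Term.realize _ M (memStructure E) _ (Sum.elim v xs) t = l.getD i d := by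
    intro n t
    cases t with
    | var a =>
      cases a with
      | inl a => exact ⟨n + idx a, fun E d v xs l _ h => (h a).symm⟩
      | inr i => exact ⟨n - 1 - i, fun E d v xs l h _ => (h i).symm⟩
    | func f _ => exact nomatch f
  induction ψ with
  | falsum => exact ⟨bot, fun E d v xs l _ _ => Iff.rfl⟩
  | equal t t' =>
    obtain ⟨i, hi⟩ := term t
    obtain ⟨j, hj⟩ := term t'
    refine ⟨eq i j, fun E d v xs l h h' => ?_⟩
    change l.getD i d = l.getD j d ↔ _ = _
    rw [hi E d v xs l h h', hj E d v xs l h h']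
  | rel R ts =>
    cases R with
    | mem =>
      obtain ⟨i, hi⟩ := term (ts 0)
      obtain ⟨j, hj⟩ := term (ts 1)
      refine ⟨mem i j, fun E d v xs l h h' => ?_⟩
      change E (l.getD i d) (l.getD j d) ↔ E (@FirstOrder.Language.Term.realize _ _
        (memStructure E) _ (Sum.elim v xs) (ts 0)) (@FirstOrder.Language.Term.realize _ _
        (memStructure E) _ (Sum.elim v xs) (ts 1))
      rw [hi E d v xs l h h', hj E d v xs l h h']
  | imp ψ ψ' ih ih' =>
    obtain ⟨φ, h⟩ := ih
    obtain ⟨φ', h'⟩ := ih'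
    exact ⟨imp φ φ', fun E d v xs l k k' =>
      imp_congr (h E d v xs l k k') (h' E d v xs l k k')⟩
  | @all n ψ ih =>
    obtain ⟨φ, h⟩ := ih
    refine ⟨all φ, fun E d v xs l k k' => forall_congr' fun x =>
      h E d v (Fin.snoc xs x) (x :: l) (fun i => ?_) (fun a => ?_)⟩
    · refine Fin.lastCases ?_ (fun i => ?_) i
      · simp
      · rw [Fin.snoc_castSucc, ← k i, Fin.val_castSucc,
          show n + 1 - 1 - (i : ℕ) = n - 1 - i + 1 by have := i.2; omega]
        rfl
    · rw [← k' a, show n + 1 + idx a = n + idx a + 1 by omega]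
      rfl

theorem exists_interp_of_definable {M : Type u} (E : M → M → Prop) (d : M) {k : ℕ}
    {S : Set (Fin k → M)}
    (hS : letI := memStructure E; Set.univ.Definable memLanguage S) :
    ∃ (φ : Fml) (ps : List M), ∀ x : Fin k → M,
      x ∈ S ↔ Holds E (φ.interp d (List.ofFn x ++ ps)) := by
  classical
  let _ := memStructure E
  obtain ⟨ψ, rfl⟩ := Set.definable_iff_exists_formula_sum.1 hS
  let V := ψ.freeVarFinset
  let e : V ≃ Fin V.card := V.equivFin
  -- Only finitely many parameters occur in the formula. Coordinate variables receive the dummy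
  -- entry `d`, so that positions agree with the enumeration `e`.
  let ps : List M := List.ofFn fun j : Fin V.card =>
    match (e.symm j).1 with
    | .inl a => a.1
    | .inr _ => d
  let idx : V → ℕ := fun a => match a.1 with
    | .inl _ => k + e a
    | .inr i => i
  obtain ⟨φ, hφ⟩ := exists_interp_iff_realize.{u} (ψ.restrictFreeVar (id : V → V)) idx
  refine ⟨φ, ps, fun x => ?_⟩
  rw [hφ E d (fun a => Sum.elim (fun a => a.1) x a.1) default (List.ofFn x ++ ps)
    (fun i => i.elim0) ?_]
  · exact (FirstOrder.Language.BoundedFormula.realize_restrictFreeVar (φ := ψ) (f := id)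
      (v := fun a => Sum.elim (fun a => a.1) x a.1) (Sum.elim Subtype.val x) fun a => rfl).symm
  · intro a
    rw [zero_add]
    obtain ⟨a, ha⟩ := a
    cases a with
    | inl b =>
      change (List.ofFn x ++ ps).getD (k + e ⟨Sum.inl b, ha⟩) d = b.1
      rw [List.getD_append_right _ _ _ _ (by simp)]
      simp [ps, List.getD_eq_getElem?_getD]
    | inr i =>
      change (List.ofFn x ++ ps).getD i d = x i
      rw [List.getD_append _ _ _ _ (by simp)]
      simp [List.getD_eq_getElem?_getD]

end Fml

/-! ## Generic models -/

/-- A descending sequence of conditions which is generic for the forcing language with constants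
from a countable set of names. -/
structure GenericSequence (P : Type) [Preorder P] where
  cond : ℕ → P
  name : ℕ → PName.{u, 0} P
  cond_succ_le : ∀ n, cond (n + 1) ≤ cond n
  decide : ∀ (φ : Fml) (l : List ℕ), ∃ n, Forces (cond n) (φ.interp (name 0) (l.map name)) ∨
    Forces (cond n) (SetFml.not (φ.interp (name 0) (l.map name)))
  witness : ∀ (φ : Fml) (l : List ℕ) (n : ℕ),
    Forces (cond n) (SetFml.not (φ.all.interp (name 0) (l.map name))) →
    ∃ m k, Forces (cond m) (SetFml.not (φ.interp (name 0) (name k :: l.map name)))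

/-- A Rasiowa–Sikorski construction combined with Henkin witnesses. There are countably many tasks,
since formulas are countable and refer to names by their number in a list that grows along the way.
-/
theorem exists_genericSequence {P : Type} [Preorder P] (p : P) :
    Nonempty (GenericSequence.{u} P) := by
  let d : PName.{u, 0} P := .mk PEmpty (fun x => x.elim) (fun x => x.elim)
  have step : ∀ (φ : Fml) (l : List (PName.{u, 0} P)) (q : P), ∃ w : P × PName.{u, 0} P, w.1 ≤ q ∧
      (Forces w.1 (φ.interp d l) ∨ Forces w.1 (SetFml.not (φ.interp d l))) ∧
      ∀ ψ, φ = Fml.all ψ → Forces w.1 (SetFml.not (φ.interp d l)) →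
        Forces w.1 (SetFml.not (ψ.interp d (w.2 :: l))) := by
    intro φ l q
    obtain ⟨r, hr, h | h⟩ := Forces.decide q (φ.interp d l)
    · exact ⟨(r, d), hr, Or.inl h, fun ψ _ h' => absurd h (h' r le_rfl)⟩
    · by_cases hφ : ∃ ψ, φ = Fml.all ψ
      · obtain ⟨ψ, rfl⟩ := hφ
        have h1 : ¬ ∀ x, Forces r (ψ.interp d (x :: l)) := h r le_rfl
        push Not at h1
        obtain ⟨x, hx⟩ := h1
        obtain ⟨s, hs, h2⟩ := Forces.exists_not hx
        refine ⟨(s, x), hs.trans hr, Or.inr (h.mono hs), ?_⟩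
        rintro _ ⟨⟩ _
        exact h2
      · exact ⟨(r, d), hr, Or.inr h, fun ψ e => absurd ⟨ψ, e⟩ hφ⟩
  choose w hw1 hw2 hw3 using step
  have : Nonempty Fml := ⟨Fml.bot⟩
  obtain ⟨f, hf⟩ := exists_surjective_nat (Fml × List ℕ)
  let tk (n : ℕ) : Fml × List ℕ := f n.unpair.1
  let st : ℕ → P × List (PName.{u, 0} P) := fun n => Nat.rec (p, [d])
    (fun n s => let x := w (tk n).1 ((tk n).2.map fun i => s.2.getD i d) s.1
      (x.1, s.2 ++ [x.2])) n
  let nm (n : ℕ) : PName.{u, 0} P := (st n).2.getD n d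
  have hlen : ∀ n, (st n).2.length = n + 1 := by
    intro n
    induction n with
    | zero => rfl
    | succ n ih =>
      change ((st n).2 ++ [_]).length = _
      rw [List.length_append, ih]; rfl
  have hnm : ∀ n k, k ≤ n → (st n).2.getD k d = nm k := by
    intro n k hk
    induction n, hk using Nat.le_induction with
    | base => rfl
    | succ n hkn ih =>
      rw [← ih]
      change ((st n).2 ++ [_]).getD k d = _
      rw [List.getD_append _ _ _ _ (by rw [hlen]; omega)]
  have key : ∀ (φ : Fml) (l : List ℕ), ∃ n, tk n = (φ, l) ∧
      (tk n).2.map (fun i => (st n).2.getD i d) = l.map nm := by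
    intro φ l
    obtain ⟨a, ha⟩ := hf (φ, l)
    -- Every task recurs at arbitrarily late stages. This stage is at least every entry of `l`, so
    -- the names mentioned are already available.
    have e : tk (Nat.pair a l.sum) = (φ, l) := by simp only [tk, Nat.unpair_pair, ha]
    refine ⟨_, e, ?_⟩
    rw [e]
    refine List.map_congr_left fun i hi => hnm _ _ ?_
    exact (List.le_sum_of_mem hi).trans (Nat.right_le_pair _ _)
  have anti : ∀ n, (st (n + 1)).1 ≤ (st n).1 := fun n => hw1 _ _ _
  refine ⟨⟨fun n => (st n).1, nm, anti, fun φ l => ?_, fun φ l n h => ?_⟩⟩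
  · obtain ⟨n, e, e'⟩ := key φ l
    have := hw2 (tk n).1 ((tk n).2.map fun i => (st n).2.getD i d) (st n).1
    rw [e', e] at this
    refine ⟨n + 1, ?_⟩
    change Forces (w (tk n).1 ((tk n).2.map fun i => (st n).2.getD i d) (st n).1).1 _ ∨
      Forces (w (tk n).1 ((tk n).2.map fun i => (st n).2.getD i d) (st n).1).1 _
    rw [e', e]
    exact this
  · obtain ⟨m, e, e'⟩ := key φ.all l
    have h1 := hw2 (tk m).1 ((tk m).2.map fun i => (st m).2.getD i d) (st m).1
    have h2 := hw3 (tk m).1 ((tk m).2.map fun i => (st m).2.getD i d) (st m).1 φ (by rw [e])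
    have hst : (st (m + 1)).1 = (w (tk m).1 ((tk m).2.map fun i => (st m).2.getD i d) (st m).1).1 :=
      rfl
    have hnm' : nm (m + 1) = (w (tk m).1 ((tk m).2.map fun i => (st m).2.getD i d) (st m).1).2 := by
      change ((st m).2 ++ [_]).getD (m + 1) d = _
      rw [List.getD_append_right _ _ _ _ (by rw [hlen]), hlen, Nat.sub_self]
      rfl
    rw [← hst, ← hnm', e', e] at h2
    rw [← hst, e', e] at h1
    have hle : Antitone fun n => (st n).1 := antitone_nat_of_succ_le anti
    refine ⟨m + 1, m + 1, h2 (h1.resolve_left fun h3 => ?_)⟩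
    exact h (st (max n (m + 1))).1 (hle (le_max_left _ _)) (h3.mono (hle (le_max_right _ _)))

namespace GenericSequence

open SetFml

variable {P : Type} [Preorder P] (G : GenericSequence.{u} P)

theorem cond_antitone : Antitone G.cond := antitone_nat_of_succ_le G.cond_succ_le

/-- Some condition in the generic sequence forces `φ`. -/
def Forced (φ : SetFml (PName.{u, 0} P)) : Prop := ∃ n, Forces (G.cond n) φ

variable {G}

theorem Forced.and {φ ψ : SetFml (PName.{u, 0} P)} (h : G.Forced φ) (h' : G.Forced ψ) :
    ∃ n, Forces (G.cond n) φ ∧ Forces (G.cond n) ψ := by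
  obtain ⟨n, hn⟩ := h
  obtain ⟨m, hm⟩ := h'
  exact ⟨max n m, hn.mono (G.cond_antitone (le_max_left _ _)),
    hm.mono (G.cond_antitone (le_max_right _ _))⟩

theorem forced_not_iff {φ : Fml} {l : List ℕ} :
    G.Forced (SetFml.not (φ.interp (G.name 0) (l.map G.name))) ↔
      ¬ G.Forced (φ.interp (G.name 0) (l.map G.name)) := by
  constructor
  · intro h h'
    obtain ⟨n, h1, h2⟩ := h.and h'
    exact h1 _ le_rfl h2
  · intro h
    obtain ⟨n, hn | hn⟩ := G.decide φ l
    · exact absurd ⟨n, hn⟩ h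
    · exact ⟨n, hn⟩

variable (G)

/-- the equality of the generic model -/
def setoid : Setoid ℕ where
  r i j := G.Forced (G.name i ≐ G.name j)
  iseqv := ⟨fun _ => ⟨0, Forces.eq_refl⟩, fun ⟨n, h⟩ => ⟨n, h.eq_symm⟩, fun h h' => by
    obtain ⟨n, h1, h2⟩ := h.and h'
    exact ⟨n, h1.eq_trans h2⟩⟩

/-- the generic model -/
def Model : Type := Quotient G.setoid

/-- the element of the generic model with a given name -/
def val (i : ℕ) : G.Model := Quotient.mk G.setoid i

/-- the membership relation of the generic model -/
def Mem : G.Model → G.Model → Prop :=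
  Quotient.lift₂ (s₁ := G.setoid) (s₂ := G.setoid) (fun i j => G.Forced (G.name i ∈' G.name j)) (by
    have key : ∀ i j i' j', G.Forced (G.name i ≐ G.name i') → G.Forced (G.name j ≐ G.name j') →
        G.Forced (G.name i ∈' G.name j) → G.Forced (G.name i' ∈' G.name j') := by
      intro i j i' j' h h' h''
      obtain ⟨n, h1, h2⟩ := h.and h'
      obtain ⟨m, h3⟩ := h''
      exact ⟨max n m, (h3.mono (G.cond_antitone (le_max_right _ _))).mem_congr
        (h1.mono (G.cond_antitone (le_max_left _ _))) (h2.mono (G.cond_antitone (le_max_left _ _)))⟩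
    intro i j i' j' h h'
    exact propext ⟨key _ _ _ _ h h', key _ _ _ _ (G.setoid.symm h) (G.setoid.symm h')⟩)

/-- Truth in the generic model is what is forced by the conditions of the generic sequence. -/
theorem holds_iff_forced (φ : Fml) (l : List ℕ) :
    Holds G.Mem (φ.interp (G.val 0) (l.map G.val)) ↔
      G.Forced (φ.interp (G.name 0) (l.map G.name)) := by
  induction φ generalizing l with
  | bot => exact ⟨fun h => h.elim, fun ⟨_, h⟩ => h⟩
  | eq i j =>
    simp only [Fml.interp, List.getD_map, Holds]
    exact Quotient.eq (r := G.setoid)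
  | mem i j =>
    simp only [Fml.interp, List.getD_map, Holds]
    exact Iff.rfl
  | imp φ ψ ih ih' =>
    simp only [Fml.interp, Holds, ih, ih']
    constructor
    · intro h
      by_cases h1 : G.Forced (φ.interp (G.name 0) (l.map G.name))
      · obtain ⟨n, hn⟩ := h h1
        exact ⟨n, fun q hq _ => hn.mono hq⟩
      · obtain ⟨n, hn⟩ := forced_not_iff.2 h1
        exact ⟨n, fun q hq h => absurd h (hn q hq)⟩
    · intro h h'
      obtain ⟨n, h1, h2⟩ := h.and h'
      exact ⟨n, h1 _ le_rfl h2⟩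
  | all φ ih =>
    simp only [Fml.interp, Holds]
    constructor
    · intro h
      by_contra hc
      obtain ⟨n, hn⟩ := (forced_not_iff (φ := φ.all)).2 hc
      obtain ⟨m, k, hk⟩ := G.witness φ l n hn
      have h1 := (ih (k :: l)).1 (h (G.val k))
      exact forced_not_iff.1 ⟨m, hk⟩ h1
    · rintro ⟨n, hn⟩ x
      obtain ⟨k, rfl⟩ := Quotient.exists_rep x
      exact (ih (k :: l)).2 ⟨n, hn (G.name k)⟩

theorem holds_of_forces {φ : Fml} (l : List ℕ)
    (h : ∀ p : P, Forces p (φ.interp (G.name 0) (l.map G.name))) :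
    Holds G.Mem (φ.interp (G.val 0) (l.map G.val)) :=
  (G.holds_iff_forced φ l).2 ⟨0, h _⟩

end GenericSequence

theorem exists_val_list {P : Type} [Preorder P] {G : GenericSequence.{u} P} (l : List G.Model) :
    ∃ l' : List ℕ, l = l'.map G.val := by
  induction l with
  | nil => exact ⟨[], rfl⟩
  | cons x l ih =>
    obtain ⟨l', rfl⟩ := ih
    obtain ⟨k, rfl⟩ := Quotient.exists_rep x
    exact ⟨k :: l', rfl⟩

/-! ### Truth of the connectives in a structure -/

namespace SetFml

variable {M : Type*} {E : M → M → Prop} {φ ψ : SetFml M} {Φ : M → SetFml M} {x y : M}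

theorem holds_not : Holds E (SetFml.not φ) ↔ ¬ Holds E φ := Iff.rfl

theorem holds_imp : Holds E (φ ⟶' ψ) ↔ (Holds E φ → Holds E ψ) := Iff.rfl

theorem holds_all : Holds E (all Φ) ↔ ∀ x, Holds E (Φ x) := Iff.rfl

theorem holds_eq : Holds E (x ≐ y) ↔ x = y := Iff.rfl

theorem holds_mem : Holds E (x ∈' y) ↔ E x y := Iff.rfl

theorem holds_and : Holds E (φ ⋏ ψ) ↔ Holds E φ ∧ Holds E ψ := by
  simp only [SetFml.and, holds_not, holds_imp]; tauto

theorem holds_or : Holds E (φ ⋎ ψ) ↔ Holds E φ ∨ Holds E ψ := by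
  simp only [SetFml.or, holds_not, holds_imp]; tauto

theorem holds_iff : Holds E (φ ⟷' ψ) ↔ (Holds E φ ↔ Holds E ψ) := by
  simp only [SetFml.iff, holds_and, holds_imp]; tauto

theorem holds_ex : Holds E (ex Φ) ↔ ∃ x, Holds E (Φ x) := by
  simp only [SetFml.ex, holds_not, holds_all, not_forall, not_not]

end SetFml

/-! ### The generic model satisfies ZFC -/

namespace GenericSequence

open SetFml

variable {P : Type} [Preorder P] [OrderTop P] (G : GenericSequence.{u} P)

theorem isModelZFC : IsModelZFC G.Mem where
  extensionality := by
    have h : Holds G.Mem (all fun a => all fun b => (all fun z => z ∈' a ⟷' z ∈' b) ⟶' a ≐ b) :=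
      G.holds_of_forces (φ := .all (.all (.imp (.all (.iff (.mem 0 2) (.mem 0 1))) (.eq 1 0)))) []
        fun p => Forces.extensionality
    simpa only [holds_all, holds_imp, holds_iff, holds_mem, holds_eq] using h
  foundation := by
    have h : Holds G.Mem (all fun a => (ex fun z => z ∈' a) ⟶'
        ex fun z => z ∈' a ⋏ all fun w => w ∈' z ⟶' SetFml.not (w ∈' a)) :=
      G.holds_of_forces (φ := .all (.imp (.ex (.mem 0 1)) (.ex (.and (.mem 0 1) (.all (.imp
        (.mem 0 1) (.not (.mem 0 2)))))))) [] fun p => Forces.foundation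
    simpa only [holds_all, holds_imp, holds_ex, holds_and, holds_not, holds_mem] using h
  pairing := by
    have h : Holds G.Mem (all fun x => all fun y => ex fun c => isPair c x y) :=
      G.holds_of_forces (φ := .all (.all (.ex (.isPair 0 2 1)))) []
        fun p x y => Forces.ex_intro _ (Forces.isPair_iff.2 Forces.eq_refl)
    simpa only [isPair, holds_all, holds_ex, holds_iff, holds_or, holds_mem, holds_eq] using h
  union := by
    have h : Holds G.Mem (all fun a => ex fun u => all fun z => z ∈' u ⟷'
        ex fun w => w ∈' a ⋏ z ∈' w) :=
      G.holds_of_forces (φ := .all (.ex (.all (.iff (.mem 0 1) (.ex (.and (.mem 0 3) (.mem 1 0)))))))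
        [] fun p => Forces.union
    simpa only [holds_all, holds_ex, holds_iff, holds_and, holds_mem] using h
  powerset := by
    have h : Holds G.Mem (all fun a => ex fun b => all fun z => z ∈' b ⟷'
        all fun w => w ∈' z ⟶' w ∈' a) :=
      G.holds_of_forces (φ := .all (.ex (.all (.iff (.mem 0 1) (.all (.imp (.mem 0 1) (.mem 0 3)))))))
        [] fun p => Forces.powerset
    simpa only [holds_all, holds_ex, holds_iff, holds_imp, holds_mem] using h
  infinity := by
    have h : Holds G.Mem (ex fun o => isInductive o) :=
      G.holds_of_forces (φ := .ex (.isInductive 0)) []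
        fun p => Forces.ex_intro (PName.omega P) Forces.isInductive_omega
    simpa only [isInductive, exIn, allIn, isEmpty, isSucc, holds_all, holds_ex, holds_iff, holds_imp,
      holds_and, holds_or, holds_not, holds_mem, holds_eq] using h
  separation := by
    intro S hS a
    obtain ⟨φ, ps, hφ⟩ := Fml.exists_interp_of_definable G.Mem (G.val 0) hS
    obtain ⟨l, rfl⟩ := exists_val_list ps
    obtain ⟨k, rfl⟩ := Quotient.exists_rep a
    have hφ' : ∀ z, z ∈ S ↔ Holds G.Mem (φ.interp (G.val 0) (z :: l.map G.val)) :=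
      fun z => hφ fun _ => z
    have h := G.holds_of_forces (φ := φ.separation) (k :: l) fun p => by
      rw [List.map_cons, Fml.interp_separation]
      refine Forces.separation (fun x y q hxy => ?_) _
      refine (Fml.forcedIff_interp φ _ _ fun i => ?_) q le_rfl |>.1
      cases i with
      | zero => exact hxy
      | succ i => exact Forces.eq_refl
    rw [List.map_cons, Fml.interp_separation] at h
    simp only [holds_all, holds_ex, holds_iff, holds_and, holds_mem, ← hφ'] at h
    exact h
  replacement := by
    intro R hR a hfun
    obtain ⟨φ, ps, hφ⟩ := Fml.exists_interp_of_definable G.Mem (G.val 0) hR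
    obtain ⟨l, rfl⟩ := exists_val_list ps
    obtain ⟨k, rfl⟩ := Quotient.exists_rep a
    have hφ' : ∀ x y, (x, y) ∈ R ↔ Holds G.Mem (φ.interp (G.val 0) (x :: y :: l.map G.val)) :=
      fun x y => hφ ![x, y]
    have h := G.holds_of_forces (φ := φ.replacement) (k :: l) fun p => by
      rw [List.map_cons, Fml.interp_replacement]
      refine Forces.replacement (fun x y x' y' q hx hy => ?_) _
      refine (Fml.forcedIff_interp φ _ _ fun i => ?_) q le_rfl |>.1
      rcases i with _ | _ | i
      · exact hx
      · exact hy
      · exact Forces.eq_refl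
    rw [List.map_cons, Fml.interp_replacement] at h
    simp only [holds_all, holds_ex, holds_iff, holds_imp, holds_and, holds_mem, holds_eq,
      ← hφ'] at h
    exact h hfun
  choice := by
    have h : Holds G.Mem (all fun a => (all fun x => x ∈' a ⟶' ex fun z => z ∈' x) ⟶'
        (all fun x => all fun y => all fun z => x ∈' a ⟶' y ∈' a ⟶' z ∈' x ⟶' z ∈' y ⟶' x ≐ y) ⟶'
        ex fun c => all fun x => x ∈' a ⟶' ex fun z => (z ∈' x ⋏ z ∈' c) ⋏
          all fun z' => (z' ∈' x ⋏ z' ∈' c) ⟶' z' ≐ z) :=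
      G.holds_of_forces (φ := .all (.imp (.all (.imp (.mem 0 1) (.ex (.mem 0 1)))) (.imp
        (.all (.all (.all (.imp (.mem 2 3) (.imp (.mem 1 3) (.imp (.mem 0 2) (.imp (.mem 0 1)
          (.eq 2 1)))))))) (.ex (.all (.imp (.mem 0 2) (.ex (.and (.and (.mem 0 1) (.mem 0 2))
          (.all (.imp (.and (.mem 0 2) (.mem 0 3)) (.eq 0 1))))))))))) [] fun p => Forces.choice
    simpa only [ExistsUnique, holds_all, holds_ex, holds_imp, holds_and, holds_mem, holds_eq] using h

end GenericSequence

/-! ## Ranks in subsets of a well-order -/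

section Rank

open Ordinal

variable {W : Type} [LinearOrder W] [WellFoundedLT W]

/-- Only the smaller element is restricted to `S`, so points outside `S` have a rank too. -/
instance (S : Set W) : IsWellFounded W (fun a b => a ∈ S ∧ a < b) :=
  ⟨Subrelation.wf (fun h => h.2) (wellFounded_lt (α := W))⟩

/-- the order type of the elements of `S` below `b` -/
noncomputable def subrank (S : Set W) (b : W) : Ordinal.{0} :=
  IsWellFounded.rank (fun a b => a ∈ S ∧ a < b) b

variable {S S' : Set W} {a b : W} {o : Ordinal.{0}}

theorem lt_subrank_iff : o < subrank S b ↔ ∃ a ∈ S, a < b ∧ o ≤ subrank S a := by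
  rw [subrank, IsWellFounded.rank_eq, Ordinal.lt_iSup_iff]
  simp only [Order.lt_succ_iff, Subtype.exists, exists_prop, and_assoc]
  rfl

theorem subrank_lt_subrank (ha : a ∈ S) (h : a < b) : subrank S a < subrank S b :=
  lt_subrank_iff.2 ⟨a, ha, h, le_rfl⟩

theorem subrank_injOn (ha : a ∈ S) (hb : b ∈ S) (h : subrank S a = subrank S b) : a = b := by
  rcases lt_trichotomy a b with h' | h' | h'
  · exact absurd h (subrank_lt_subrank ha h').ne
  · exact h'
  · exact absurd h (subrank_lt_subrank hb h').ne'

theorem exists_subrank_eq (h : o < subrank S b) : ∃ a ∈ S, a < b ∧ subrank S a = o := by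
  induction b using WellFoundedLT.induction with
  | ind b ih =>
    obtain ⟨a, ha, hab, h'⟩ := lt_subrank_iff.1 h
    rcases h'.eq_or_lt with e | e
    · exact ⟨a, ha, hab, e.symm⟩
    · obtain ⟨c, hc, hca, h2⟩ := ih a hab e
      exact ⟨c, hc, hca.trans hab, h2⟩

theorem subrank_mono (h : ∀ a ∈ S, a < b → a ∈ S') : subrank S b ≤ subrank S' b := by
  induction b using WellFoundedLT.induction with
  | ind b ih =>
    refine le_of_forall_lt fun o ho => ?_
    obtain ⟨a, ha, hab, h'⟩ := lt_subrank_iff.1 ho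
    exact lt_subrank_iff.2 ⟨a, h a ha hab, hab,
      h'.trans (ih a hab fun c hc hca => h c hc (hca.trans hab))⟩

theorem subrank_congr (h : ∀ a < b, a ∈ S ↔ a ∈ S') : subrank S b = subrank S' b :=
  le_antisymm (subrank_mono fun a ha hab => (h a hab).1 ha)
    (subrank_mono fun a ha hab => (h a hab).2 ha)

/-- A subset of an initial segment has the order type of a possibly shorter initial segment. -/
theorem exists_subrank_univ_eq (S : Set W) (b : W) :
    ∃ c ≤ b, subrank Set.univ c = subrank S b := by
  rcases (subrank_mono (S := S) (S' := Set.univ) (b := b) fun _ _ _ => trivial).eq_or_lt with h | h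
  · exact ⟨b, le_rfl, h.symm⟩
  · obtain ⟨c, -, hc, e⟩ := exists_subrank_eq h
    exact ⟨c, hc.le, e⟩

end Rank

/-! ## Functions modulo finite -/

/-- `f ≤* g` -/
def EvLE (f g : ℕ → ℕ) : Prop := ∀ᶠ n in atTop, f n ≤ g n

theorem EvLE.refl (f : ℕ → ℕ) : EvLE f f := Eventually.of_forall fun _ => le_rfl

theorem EvLE.trans {f g h : ℕ → ℕ} (h1 : EvLE f g) (h2 : EvLE g h) : EvLE f h := by
  filter_upwards [h1, h2] with n a b using a.trans b

theorem not_evLE {f g : ℕ → ℕ} : ¬ EvLE f g ↔ ∃ᶠ n in atTop, g n < f n := by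
  simp only [EvLE, Filter.Frequently, not_lt]

theorem exists_frequently_split {A : ℕ → Prop} (hA : ∃ᶠ n in atTop, A n) :
    ∃ B : Set ℕ, (∃ᶠ n in atTop, A n ∧ n ∈ B) ∧ ∃ᶠ n in atTop, A n ∧ n ∉ B := by
  have hinf : {n | A n}.Infinite := Nat.frequently_atTop_iff_infinite.1 hA
  have hmono := Nat.nth_strictMono hinf
  refine ⟨Set.range fun k => Nat.nth A (2 * k), ?_, ?_⟩
  · refine frequently_atTop.2 fun a => ⟨Nat.nth A (2 * a), ?_, Nat.nth_mem_of_infinite hinf _, a, rfl⟩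
    exact le_trans (by omega) (hmono.le_apply (x := 2 * a))
  · refine frequently_atTop.2 fun a => ⟨Nat.nth A (2 * a + 1), ?_,
      Nat.nth_mem_of_infinite hinf _, ?_⟩
    · exact le_trans (by omega) (hmono.le_apply (x := 2 * a + 1))
    · rintro ⟨k, hk⟩
      have := hmono.injective hk
      omega

theorem exists_evLE_upper_bound (c : ℕ → ℕ → ℕ) : ∃ y, ∀ n, EvLE (c n) y := by
  refine ⟨fun x => ∑ i ∈ Finset.range (x + 1), c i x, fun n => ?_⟩
  filter_upwards [eventually_ge_atTop n] with x hx
  exact Finset.single_le_sum (f := fun i => c i x) (fun _ _ => Nat.zero_le _)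
    (Finset.mem_range.2 (Nat.lt_succ_of_le hx))

/-- Countable pregaps can be filled. -/
theorem exists_interpolant {lo up : ℕ → ℕ → ℕ} (hlo : ∀ k, EvLE (lo k) (lo (k + 1)))
    (hup : ∀ k, EvLE (up (k + 1)) (up k)) (hle : ∀ k, EvLE (lo k) (up k))
    (hlt : ∀ k, ∃ᶠ n in atTop, lo k n < up k n) :
    ∃ l : ℕ → ℕ, (∀ k, EvLE (lo k) fun x => lo (l x) x) ∧ (∀ k, EvLE (fun x => up (l x) x) (up k)) ∧
      (EvLE (fun x => lo (l x) x) fun x => up (l x) x) ∧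
      ∃ᶠ x in atTop, lo (l x) x < up (l x) x := by
  have hlo' : ∀ k, ∀ j ≤ k, EvLE (lo j) (lo k) := fun k j hjk => by
    induction k, hjk using Nat.le_induction with
    | base => exact EvLE.refl _
    | succ k _ ih => exact ih.trans (hlo k)
  have hup' : ∀ k, ∀ j ≤ k, EvLE (up k) (up j) := fun k j hjk => by
    induction k, hjk using Nat.le_induction with
    | base => exact EvLE.refl _
    | succ k _ ih => exact (hup k).trans ih
  have h1 : ∀ k, ∃ a, ∀ x ≥ a, ∀ j ≤ k, lo j x ≤ lo k x ∧ up k x ≤ up j x ∧ lo k x ≤ up k x := by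
    intro k
    refine eventually_atTop.1 ((eventually_all_finite (Set.finite_Iic k)).2 fun j hj => ?_)
    filter_upwards [hlo' k j hj, hup' k j hj, hle k] with x h h' h'' using ⟨h, h', h''⟩
  choose a ha using h1
  have h2 : ∀ k N, ∃ x ≥ N, lo k x < up k x := fun k N => frequently_atTop.1 (hlt k) N
  choose b hb hb' using h2
  -- From `T k` on, the terms up to `k` are pointwise in order, and before `T (k + 1)` there is a
  -- place where the `k`-th pair is strictly apart. The interpolant follows the `k`-th pair between
  -- the two.
  let T : ℕ → ℕ := fun k => Nat.rec (a 0) (fun k t => max (a (k + 1)) (b k t + 1)) k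
  have hTb : ∀ k, b k (T k) < T (k + 1) := fun k => Nat.lt_of_succ_le (le_max_right _ _)
  have hTmono : StrictMono T := strictMono_nat_of_lt_succ fun k => (hb k (T k)).trans_lt (hTb k)
  have hTa : ∀ k, a k ≤ T k := fun k => by
    cases k with
    | zero => exact le_rfl
    | succ k => exact le_max_left _ _
  obtain ⟨l, -, hl, hl1, hl2⟩ := exists_inverse T
  have key : ∀ k, ∀ᶠ x in atTop, k ≤ l x ∧ a (l x) ≤ x := by
    intro k
    filter_upwards [hl.eventually (eventually_ge_atTop (k + 1))] with x hx
    exact ⟨by omega, (hTa _).trans (hl1 x (by omega))⟩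
  refine ⟨l, fun k => ?_, fun k => ?_, ?_, ?_⟩
  · filter_upwards [key k] with x hx using (ha (l x) x hx.2 k hx.1).1
  · filter_upwards [key k] with x hx using (ha (l x) x hx.2 k hx.1).2.1
  · filter_upwards [key 0] with x hx using (ha (l x) x hx.2 0 hx.1).2.2
  · refine frequently_atTop.2 fun N => ⟨b N (T N), ?_, ?_⟩
    · exact (hTmono.le_apply).trans (hb N (T N))
    · have e : l (b N (T N)) = N := by
        refine le_antisymm ?_ (hl2 N _ (hTmono.le_apply.trans (hb N _)) (hb N _))
        by_contra! hc
        have h3 := hl1 (b N (T N)) (by omega)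
        have h4 : T (N + 1) ≤ T (l (b N (T N))) := hTmono.monotone hc
        have := hTb N
        omega
      rw [e]
      exact hb' _ _

/-! ## A forcing for a tight gap -/

/-- Countable approximations to a tight gap in `2^ω` and to an enumeration of the reals. -/
structure GapCond (W : Type) [LinearOrder W] where
  lo : ℕ → ℕ
  up : ℕ → ℕ
  up_le_one : ∀ n, up n ≤ 1
  lo_le_up : EvLE lo up
  lo_lt_up : ∃ᶠ n in atTop, lo n < up n
  dom : Set W
  isLowerSet : IsLowerSet dom
  countable : dom.Countable
  val : W → ℕ → ℕ
  injOn : Set.InjOn val dom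

namespace GapCond

open SetFml PName

variable {W : Type} [LinearOrder W]

instance : Preorder (GapCond W) where
  le q p := EvLE p.lo q.lo ∧ EvLE q.up p.up ∧ p.dom ⊆ q.dom ∧ Set.EqOn q.val p.val p.dom
  le_refl _ := ⟨EvLE.refl _, EvLE.refl _, subset_rfl, fun _ _ => rfl⟩
  le_trans _ _ _ h h' := ⟨h'.1.trans h.1, h.2.1.trans h'.2.1, h'.2.2.1.trans h.2.2.1,
    fun w hw => (h.2.2.2 (h'.2.2.1 hw)).trans (h'.2.2.2 hw)⟩

instance : OrderTop (GapCond W) where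
  top := ⟨fun _ => 0, fun _ => 1, fun _ => le_rfl, Eventually.of_forall fun _ => Nat.zero_le _,
    Frequently.of_forall fun _ => Nat.zero_lt_one, ∅, isLowerSet_empty, Set.countable_empty,
    fun _ _ => 0, Set.injOn_empty _⟩
  le_top p := ⟨Eventually.of_forall fun _ => Nat.zero_le _, Eventually.of_forall p.up_le_one,
    Set.empty_subset _, fun _ h => h.elim⟩

/-- The forcing is countably closed. -/
theorem exists_lower_bound (p : ℕ → GapCond W) (hp : ∀ n, p (n + 1) ≤ p n) : ∃ q, ∀ n, q ≤ p n := by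
  classical
  have anti : Antitone p := antitone_nat_of_succ_le hp
  obtain ⟨l, h1, h2, h3, h4⟩ := exists_interpolant (lo := fun n => (p n).lo) (up := fun n => (p n).up)
    (fun n => (hp n).1) (fun n => (hp n).2.1) (fun n => (p n).lo_le_up) (fun n => (p n).lo_lt_up)
  -- The enumerations extend one another, so the chosen index is immaterial.
  let val : W → ℕ → ℕ := fun w => if h : ∃ n, w ∈ (p n).dom then (p h.choose).val w else fun _ => 0
  have hval : ∀ n, Set.EqOn val (p n).val (p n).dom := by
    intro n w hw
    have h : ∃ n, w ∈ (p n).dom := ⟨n, hw⟩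
    simp only [val, h, dif_pos]
    rcases le_total n h.choose with h' | h'
    · exact (anti h').2.2.2 hw
    · exact ((anti h').2.2.2 h.choose_spec).symm
  refine ⟨⟨fun x => (p (l x)).lo x, fun x => (p (l x)).up x, fun x => (p (l x)).up_le_one x, h3, h4,
    ⋃ n, (p n).dom, isLowerSet_iUnion fun n => (p n).isLowerSet,
    Set.countable_iUnion fun n => (p n).countable, val, ?_⟩,
    fun n => ⟨h1 n, h2 n, Set.subset_iUnion (fun n => (p n).dom) n, hval n⟩⟩
  intro w hw w' hw' e
  obtain ⟨n, hn⟩ := Set.mem_iUnion.1 hw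
  obtain ⟨n', hn'⟩ := Set.mem_iUnion.1 hw'
  have h5 := (anti (le_max_left n n')).2.2.1 hn
  have h6 := (anti (le_max_right n n')).2.2.1 hn'
  rw [hval _ h5, hval _ h6] at e
  exact (p (max n n')).injOn h5 h6 e

/-- Countably many dense open sets can be met simultaneously below any condition. -/
theorem fusion {ι : Type} [Countable ι] (q : GapCond W) (D : ι → GapCond W → Prop)
    (mono : ∀ i p r, r ≤ p → D i p → D i r) (dense : ∀ i, ∀ p ≤ q, ∃ r ≤ p, D i r) :
    ∃ r ≤ q, ∀ i, D i r := by
  classical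
  cases isEmpty_or_nonempty ι
  · exact ⟨q, le_rfl, fun i => isEmptyElim i⟩
  obtain ⟨f, hf⟩ := exists_surjective_nat ι
  have dense' : ∀ i, ∀ p : {p // p ≤ q}, ∃ r : {p // p ≤ q}, r ≤ p ∧ D i r := fun i p => by
    obtain ⟨r, hr, h⟩ := dense i p p.2
    exact ⟨⟨r, hr.trans p.2⟩, hr, h⟩
  choose s hs hs' using dense'
  let p : ℕ → {p // p ≤ q} := fun n => Nat.rec ⟨q, le_rfl⟩ (fun n r => s (f n) r) n
  obtain ⟨r, hr⟩ := exists_lower_bound (fun n => (p n).1) fun n => hs _ _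
  refine ⟨r, hr 0, fun i => ?_⟩
  obtain ⟨n, rfl⟩ := hf i
  exact mono _ _ _ (hr (n + 1)) (hs' (f n) (p n))

/-- No reals are added: countable closure decides all values of `f` with one condition. -/
theorem exists_eq_real {p : GapCond W} {f : PName.{u, 0} (GapCond W)}
    (hf : Forces p (isFun f (omega _) (omega _))) : ∃ q ≤ p, ∃ g, Forces q (f ≐ real g) := by
  obtain ⟨q, hq, h⟩ := fusion p (fun (n : ℕ) q => ∃ k, Forces q (app f (nat n) (nat k)))
    (fun n p r hr ⟨k, hk⟩ => ⟨k, hk.mono hr⟩)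
    (fun n r hr => Forces.isFun_omega_total (hf.mono hr) n)
  choose g hg using h
  exact ⟨q, hq, g, Forces.eq_real (hf.mono hq) hg⟩

theorem mem_groundReals_iff_isFun {p : GapCond W} (f : PName.{u, 0} (GapCond W)) :
    Forces p (f ∈' groundReals ⟷' isFun f (omega _) (omega _)) := by
  refine Forces.iff_iff.2 fun q _ => ⟨fun h => Forces.of_dense fun r hr => ?_,
    fun h => Forces.mem_groundReals_iff.2 fun r hr => exists_eq_real (h.mono hr)⟩
  obtain ⟨s, hs, g, hg⟩ := Forces.mem_groundReals_iff.1 h r hr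
  exact ⟨s, hs, (Forces.isFun_real g).congr
    (ForcedIff.isFun hg.eq_symm Forces.eq_refl Forces.eq_refl)⟩

/-- A new real goes to the least position outside the countable domain, which keeps the domain a
lower set. Thus only positions with countably many predecessors are ever used, whatever the order
type of `W`. -/
theorem exists_mem_range [WellFoundedLT W] [Uncountable W] (p : GapCond W) (r : ℕ → ℕ) :
    ∃ q ≤ p, ∃ w ∈ q.dom, q.val w = r := by
  classical
  by_cases h : ∃ w ∈ p.dom, p.val w = r
  · exact ⟨p, le_rfl, h⟩
  push Not at h
  have hne : p.domᶜ.Nonempty := by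
    by_contra hc
    rw [Set.not_nonempty_iff_eq_empty, Set.compl_empty_iff] at hc
    exact Set.not_countable_univ (α := W) (hc ▸ p.countable)
  obtain ⟨w, hw, hmin⟩ := (wellFounded_lt (α := W)).has_min _ hne
  have hne' : ∀ v ∈ p.dom, v ≠ w := fun v hv e => hw (e ▸ hv)
  refine ⟨⟨p.lo, p.up, p.up_le_one, p.lo_le_up, p.lo_lt_up, insert w p.dom, ?_,
    p.countable.insert w, Function.update p.val w r, ?_⟩,
    ⟨EvLE.refl _, EvLE.refl _, Set.subset_insert _ _, fun v hv => ?_⟩, w, Set.mem_insert _ _, ?_⟩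
  · rintro a b hba (rfl | ha)
    · rcases hba.eq_or_lt with e | e
      · exact Or.inl e
      · exact Or.inr (by_contra fun hc => hmin b hc e)
    · exact Or.inr (p.isLowerSet hba ha)
  · rintro a (rfl | ha) b (rfl | hb) e
    · rfl
    · simp only [Function.update_self, Function.update_of_ne (hne' b hb)] at e
      exact absurd e.symm (h b hb)
    · simp only [Function.update_self, Function.update_of_ne (hne' a ha)] at e
      exact absurd e (h a ha)
    · simp only [Function.update_of_ne (hne' a ha), Function.update_of_ne (hne' b hb)] at e
      exact p.injOn ha hb e
  · exact Function.update_of_ne (hne' v hv) _ _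
  · exact Function.update_self _ _ _

/-! ### Uncountable sets of reals have the cardinality of the continuum -/

section Ranked

variable (H : PName.{u, 0} (GapCond W))

/-- the positions whose reals are forced to be in `H` -/
def positions (q : GapCond W) : Set W := {w ∈ q.dom | Forces q (real (q.val w) ∈' H)}

/-- `q` decides `H` up to the position `w`, which is in `H`. -/
def Decides (q : GapCond W) (w : W) : Prop := w ∈ positions H q ∧
  ∀ v < w, v ∈ positions H q ∨ Forces q (SetFml.not (real (q.val v) ∈' H))

variable {H} {p q : GapCond W} {w w' c c' : W}

theorem positions_mono (h : q ≤ p) : positions H p ⊆ positions H q := fun w hw =>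
  ⟨h.2.2.1 hw.1, by rw [h.2.2.2 hw.1]; exact hw.2.mono h⟩

theorem Decides.mono (h : Decides H p w) (hq : q ≤ p) : Decides H q w :=
  ⟨positions_mono hq h.1, fun v hv => (h.2 v hv).imp (fun h => positions_mono hq h) fun h' => by
    rw [hq.2.2.2 (p.isLowerSet hv.le h.1.1)]; exact h'.mono hq⟩

variable [WellFoundedLT W]

/-- Once membership in `H` is settled below `w`, stronger conditions no longer change the rank of
`w`. -/
theorem Decides.subrank_eq (h : Decides H p w) (hq : q ≤ p) :
    subrank (positions H q) w = subrank (positions H p) w := by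
  refine subrank_congr fun v hv => ⟨fun h1 => ?_, fun h1 => positions_mono hq h1⟩
  refine (h.2 v hv).resolve_right fun h2 => ?_
  have h3 := h1.2
  rw [hq.2.2.2 (p.isLowerSet hv.le h.1.1)] at h3
  exact h2 q hq h3

theorem exists_decides [Uncountable W] {r : ℕ → ℕ} (h : Forces p (real r ∈' H)) :
    ∃ q ≤ p, ∃ w, Decides H q w ∧ q.val w = r := by
  obtain ⟨q, hq, w, hw, rfl⟩ := exists_mem_range p r
  have : Countable (Set.Iio w) :=
    (q.countable.mono fun v hv => q.isLowerSet (le_of_lt hv) hw).to_subtype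
  obtain ⟨s, hs, h'⟩ := fusion q (fun (v : Set.Iio w) s => Forces s (real (q.val v) ∈' H) ∨
    Forces s (SetFml.not (real (q.val v) ∈' H))) (fun v p r hr h => h.imp (·.mono hr) (·.mono hr))
    (fun v p _ => Forces.decide p _)
  have hv : ∀ v < w, s.val v = q.val v := fun v hv => hs.2.2.2 (q.isLowerSet hv.le hw)
  refine ⟨s, hs.trans hq, w, ⟨⟨hs.2.2.1 hw, ?_⟩, fun v hvw => ?_⟩, hs.2.2.2 hw⟩
  · rw [hs.2.2.2 hw]; exact h.mono (hs.trans hq)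
  · have := h' ⟨v, hvw⟩
    simp only [← hv v hvw] at this
    exact this.imp_left fun h => ⟨hs.2.2.1 (q.isLowerSet hvw.le hw), h⟩

/-- The real at position `w` is the element of `H` with the same rank as the position `c`. -/
def Ranked (H : PName.{u, 0} (GapCond W)) (q : GapCond W) (w c : W) : Prop :=
  Decides H q w ∧ c ∈ q.dom ∧ subrank (positions H q) w = subrank Set.univ c

theorem Ranked.mono (h : Ranked H p w c) (hq : q ≤ p) : Ranked H q w c :=
  ⟨h.1.mono hq, hq.2.2.1 h.2.1, (h.1.subrank_eq hq).trans h.2.2⟩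

theorem Ranked.eq_right (h : Ranked H p w c) (h' : Ranked H p w c') : c = c' :=
  subrank_injOn (Set.mem_univ c) (Set.mem_univ c') (h.2.2.symm.trans h'.2.2)

theorem Ranked.eq_left (h : Ranked H p w c) (h' : Ranked H p w' c) : w = w' :=
  subrank_injOn h.1.1 h'.1.1 (h.2.2.trans h'.2.2.symm)

theorem Decides.exists_ranked (h : Decides H p w) : ∃ c, Ranked H p w c := by
  obtain ⟨c, hc, e⟩ := exists_subrank_univ_eq (positions H p) w
  exact ⟨c, h, p.isLowerSet hc h.1.1, e.symm⟩

variable [Uncountable W]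

/-- Induction on `c`. Fusion realises all smaller ranks at once, using countably many elements of
`H`; a further element then has rank at least that of `c`, and either it or an earlier element of
`H` has exactly that rank. -/
theorem exists_ranked (hH : ∀ q ≤ p, ∀ C : Set (ℕ → ℕ), C.Countable →
      ∃ r ≤ q, ∃ x, Forces r (real x ∈' H) ∧ x ∉ C)
    (c : W) (hq : q ≤ p) (hc : c ∈ q.dom) : ∃ r ≤ q, ∃ w, Ranked H r w c := by
  induction c using WellFoundedLT.induction generalizing q with
  | ind c ih =>
    have hcount : Countable (Set.Iio c) :=
      (q.countable.mono fun v hv => q.isLowerSet (le_of_lt hv) hc).to_subtype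
    obtain ⟨q1, hq1, h1⟩ := fusion q (fun (d : Set.Iio c) s => ∃ w, Ranked H s w d)
      (fun d p r hr ⟨w, hw⟩ => ⟨w, hw.mono hr⟩)
      (fun d s hs => ih d d.2 (hs.trans hq) (hs.2.2.1 (q.isLowerSet (le_of_lt d.2) hc)))
    choose w hw using h1
    obtain ⟨q2, hq2, x, hx, hxC⟩ := hH q1 (hq1.trans hq) (Set.range fun d => q1.val (w d))
      (Set.countable_range _)
    obtain ⟨q3, hq3, v, hv, rfl⟩ := exists_decides hx
    have hq31 : q3 ≤ q1 := hq3.trans hq2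
    have hw3 : ∀ d, Ranked H q3 (w d) d := fun d => (hw d).mono hq31
    have hvw : ∀ d, w d ≠ v := fun d e => hxC ⟨d, by
      rw [← e]; exact (hq31.2.2.2 (hw d).1.1.1).symm⟩
    -- If `v` came before some `w d`, its rank would be that of some `d'` below `d`, so `v` would be
    -- `w d'`, which was excluded.
    have hlt : ∀ d, w d < v := by
      intro d
      refine lt_of_le_of_ne (not_lt.1 fun hlt => ?_) (hvw d)
      have h2 := subrank_lt_subrank hv.1 hlt
      rw [(hw3 d).2.2] at h2
      obtain ⟨d', -, hd', e⟩ := exists_subrank_eq h2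
      exact hvw ⟨d', hd'.trans d.2⟩ (subrank_injOn (hw3 _).1.1 hv.1 ((hw3 ⟨d', hd'.trans d.2⟩).2.2.trans e))
    have hle : subrank Set.univ c ≤ subrank (positions H q3) v := by
      refine le_of_forall_lt fun o ho => ?_
      obtain ⟨d, -, hd, e⟩ := lt_subrank_iff.1 ho
      refine e.trans_lt ?_
      have := subrank_lt_subrank (hw3 ⟨d, hd⟩).1.1 (hlt ⟨d, hd⟩)
      rwa [(hw3 ⟨d, hd⟩).2.2] at this
    have hq3q : q3 ≤ q := hq31.trans hq1
    rcases hle.eq_or_lt with e | e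
    · exact ⟨q3, hq3q, v, hv, hq3q.2.2.1 hc, e.symm⟩
    · obtain ⟨v', hv', hlt', e'⟩ := exists_subrank_eq e
      exact ⟨q3, hq3q, v', ⟨hv', fun a ha => hv.2 a (ha.trans hlt')⟩, hq3q.2.2.1 hc, e'⟩

/-- The element of `H` of each rank is matched with the real at the position of that rank in the
whole enumeration. -/
theorem cardEq_groundReals (hsub : Forces p (sub H groundReals))
    (hH : ∀ q ≤ p, ∀ C : Set (ℕ → ℕ), C.Countable →
      ∃ r ≤ q, ∃ x, Forces r (real x ∈' H) ∧ x ∉ C) :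
    Forces p (cardEq H groundReals) ∧ Forces p (cardEq groundReals H) := by
  let Q (x y : ℕ → ℕ) (q : GapCond W) : Prop :=
    ∃ w c, Ranked H q w c ∧ q.val w = x ∧ q.val c = y
  have hQ : ∀ x y p q, q ≤ p → Q x y p → Q x y q := by
    rintro x y p q hq ⟨w, c, h, rfl, rfl⟩
    exact ⟨w, c, h.mono hq, hq.2.2.2 h.1.1.1, hq.2.2.2 h.2.1⟩
  have ha : ∀ q ≤ p, ∀ x, Forces q (x ∈' H) → ∃ r ≤ q, ∃ i, Forces r (x ≐ real i) :=
    fun q hq x hx => Forces.mem_groundReals_iff.1 (hsub x q hq hx) q le_rfl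
  have hb : ∀ q ≤ p, ∀ x, Forces q (x ∈' (groundReals : PName.{u, 0} (GapCond W))) →
      ∃ r ≤ q, ∃ i, Forces r (x ≐ real i) :=
    fun q _ x hx => Forces.mem_groundReals_iff.1 hx q le_rfl
  have hab : ∀ q, ∀ x y, Q x y q → Forces q (real x ∈' H) ∧
      Forces q (real y ∈' (groundReals : PName.{u, 0} (GapCond W))) := by
    rintro q _ _ ⟨w, c, h, rfl, rfl⟩
    exact ⟨h.1.1.2, Forces.real_mem_groundReals _⟩
  have tot : ∀ q ≤ p, ∀ x, Forces q (real x ∈' H) → ∃ r ≤ q, ∃ y, Q x y r := by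
    intro q _ x hx
    obtain ⟨r, hr, w, hw, e⟩ := exists_decides hx
    obtain ⟨c, hc⟩ := hw.exists_ranked
    exact ⟨r, hr, r.val c, w, c, hc, e, rfl⟩
  have onto : ∀ q ≤ p, ∀ y, ∃ r ≤ q, ∃ x, Q x y r := by
    intro q hq y
    obtain ⟨r, hr, c, hc, rfl⟩ := exists_mem_range q y
    obtain ⟨s, hs, w, hw⟩ := exists_ranked hH c (hr.trans hq) hc
    exact ⟨s, hs.trans hr, s.val w, w, c, hw, rfl, hs.2.2.2 hc⟩
  have func : ∀ q ≤ p, ∀ x y y', Q x y q → Q x y' q → y = y' := by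
    rintro q _ _ _ _ ⟨w, c, h, rfl, rfl⟩ ⟨w', c', h', e, rfl⟩
    obtain rfl := q.injOn h'.1.1.1 h.1.1.1 e
    rw [h.eq_right h']
  have inj : ∀ q ≤ p, ∀ x x' y, Q x y q → Q x' y q → x = x' := by
    rintro q _ _ _ _ ⟨w, c, h, rfl, rfl⟩ ⟨w', c', h', rfl, e⟩
    obtain rfl := q.injOn h'.2.1 h.2.1 e
    rw [h.eq_left h']
  exact ⟨Forces.cardEq_of_relation hQ Forces.real_inj Forces.real_inj ha hb hab tot
      (fun q hq k _ => onto q hq k) func inj,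
    Forces.cardEq_of_relation (Q := fun y x => Q x y) (fun y x => hQ x y) Forces.real_inj
      Forces.real_inj hb ha (fun q y x h => (hab q x y h).symm) (fun q hq k _ => onto q hq k) tot
      (fun q hq i k k' h h' => inj q hq k k' i h h') (fun q hq i i' k h h' => func q hq k i i' h h')⟩

end Ranked

end GapCond

namespace GapCond

open SetFml PName

variable {W : Type} [LinearOrder W]

/-! ### The bounding numbers -/

/-- An unbounded `H` cannot be covered by a countable set of reals because of `bdd`, hence has the
size of the continuum. By `unbdd`, `X` itself is unbounded. -/
theorem forces_isBoundingNumber [WellFoundedLT W] [Uncountable W] {X : PName.{u, 0} (GapCond W)}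
    {le : PName.{u, 0} (GapCond W) → PName.{u, 0} (GapCond W) → SetFml (PName.{u, 0} (GapCond W))}
    {L : (ℕ → ℕ) → (ℕ → ℕ) → Prop}
    (hL : ∀ p x y, Forces p (le (real x) (real y)) ↔ L x y)
    (hle : ∀ p x x' y y', Forces p (x ≐ x') → Forces p (y ≐ y') → ForcedIff p (le x y) (le x' y'))
    (hX : ∀ p, Forces p (sub X groundReals))
    (bdd : ∀ p, ∀ C : Set (ℕ → ℕ), C.Countable → (∀ c ∈ C, Forces p (real c ∈' X)) →
      ∃ q ≤ p, ∃ y, Forces q (real y ∈' X) ∧ ∀ c ∈ C, L c y)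
    (unbdd : ∀ p y, Forces p (real y ∈' X) → ∃ q ≤ p, ∃ x, Forces q (real x ∈' X) ∧ ¬ L x y)
    (p : GapCond W) : Forces p (isBoundingNumber le X groundReals) := by
  have key : ∀ p H, Forces p (isUnboundedIn le X H) →
      Forces p (cardEq H groundReals) ∧ Forces p (cardEq groundReals H) := by
    intro p H hH
    obtain ⟨hHX, hH⟩ := Forces.and_iff.1 hH
    refine cardEq_groundReals (fun x q hq hx => hX q x q le_rfl (hHX x q hq hx)) fun q hq C hC => ?_
    by_contra! hcon
    have := hC.to_subtype
    -- `bdd` applies only to reals already forced into `X`, so membership is first decided for all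
    -- members of `C`.
    obtain ⟨r, hr, hdec⟩ := fusion q (fun (c : C) r => Forces r (real c.1 ∈' X) ∨
      Forces r (SetFml.not (real c.1 ∈' X))) (fun c p r hr h => h.imp (·.mono hr) (·.mono hr))
      (fun c p _ => Forces.decide p _)
    obtain ⟨s, hs, y, hy, hyC⟩ := bdd r {c ∈ C | Forces r (real c ∈' X)}
      (hC.mono fun _ h => h.1) fun _ h => h.2
    refine hH s (hs.trans (hr.trans hq)) (Forces.exIn_intro (real y) hy fun h t ht hh => ?_)
    refine Forces.of_dense fun t' ht' => ?_
    have ht'p : t' ≤ p := ht'.trans (ht.trans (hs.trans (hr.trans hq)))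
    have hhX := hHX h t' ht'p (hh.mono ht')
    obtain ⟨w, hw, g, hg⟩ := Forces.mem_groundReals_iff.1 (hX t' h t' le_rfl hhX) t' le_rfl
    have hwr : w ≤ r := hw.trans (ht'.trans (ht.trans hs))
    have hgC : g ∈ C := hcon w (hwr.trans hr) g
      ((hh.mono (hw.trans ht')).mem_congr hg Forces.eq_refl)
    have hgX : Forces w (real g ∈' X) := (hhX.mono hw).mem_congr hg Forces.eq_refl
    have hgr : Forces r (real g ∈' X) :=
      (hdec ⟨g, hgC⟩).resolve_right fun hn => hn w hwr hgX
    exact ⟨w, hw, ((hL w g y).2 (hyC g ⟨hgC, hgr⟩)).congr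
      (hle w _ _ _ _ hg.eq_symm Forces.eq_refl)⟩
  have hself : Forces p (isUnboundedIn le X X) := by
    refine Forces.and_iff.2 ⟨fun x q _ h => h, fun q _ h => ?_⟩
    obtain ⟨r, _, y, hy, hbd⟩ := Forces.exIn_iff.1 h q le_rfl
    obtain ⟨s, hs, g, hg⟩ := Forces.mem_groundReals_iff.1 (hX r y r le_rfl hy) r le_rfl
    obtain ⟨t, ht, x, hx, hxg⟩ := unbdd s g ((hy.mono hs).mem_congr hg Forces.eq_refl)
    exact hxg ((hL t x g).1 ((hbd (real x) t (ht.trans hs) hx).congr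
      (hle t _ _ _ _ Forces.eq_refl (hg.mono ht))))
  exact Forces.and_iff.2 ⟨Forces.ex_intro X (Forces.and_iff.2 ⟨hself, (key p X hself).1⟩),
    fun H q _ hH => Forces.cardLE_of_cardEq (key q H hH).2⟩

/-! ### The gap -/

/-- Split the infinite set where `g` is below `p.up`. On one half the lower function is lifted to
`p.up`, past `g`; the other half keeps the gap open. -/
theorem exists_split_lo {p : GapCond W} {g : ℕ → ℕ} (h : EvLE p.lo g) (hg : ¬ EvLE p.up g) :
    ∃ q ≤ p, ¬ EvLE q.lo g := by
  classical
  obtain ⟨B, hB, hB'⟩ := exists_frequently_split (not_evLE.1 hg)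
  refine ⟨⟨fun n => if g n < p.up n ∧ n ∈ B then p.up n else p.lo n, p.up, p.up_le_one, ?_, ?_,
    p.dom, p.isLowerSet, p.countable, p.val, p.injOn⟩,
    ⟨?_, EvLE.refl _, subset_rfl, fun _ _ => rfl⟩, not_evLE.2 ?_⟩
  · filter_upwards [p.lo_le_up] with n hn
    split_ifs
    exacts [le_rfl, hn]
  · refine (hB'.and_eventually h).mono fun n hn => ?_
    simpa only [hn.1.2, and_false, if_false] using hn.2.trans_lt hn.1.1
  · filter_upwards [p.lo_le_up] with n hn
    split_ifs
    exacts [hn, le_rfl]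
  · refine hB.mono fun n hn => ?_
    simpa only [if_pos hn] using hn.1

theorem exists_split_up {p : GapCond W} {g : ℕ → ℕ} (h : EvLE g p.up) (hg : ¬ EvLE g p.lo) :
    ∃ q ≤ p, ¬ EvLE g q.up := by
  classical
  obtain ⟨B, hB, hB'⟩ := exists_frequently_split (not_evLE.1 hg)
  -- The order `lo ≤ up` holds only modulo finite; the minimum keeps the new upper function at most
  -- `1` everywhere.
  refine ⟨⟨p.lo, fun n => if p.lo n < g n ∧ n ∈ B then min (p.lo n) (p.up n) else p.up n,
    fun n => ?_, ?_, ?_, p.dom, p.isLowerSet, p.countable, p.val, p.injOn⟩,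
    ⟨EvLE.refl _, Eventually.of_forall fun n => ?_, subset_rfl, fun _ _ => rfl⟩, not_evLE.2 ?_⟩
  · split_ifs
    exacts [(min_le_right _ _).trans (p.up_le_one n), p.up_le_one n]
  · filter_upwards [p.lo_le_up] with n hn
    split_ifs
    exacts [le_min le_rfl hn, hn]
  · refine (hB'.and_eventually h).mono fun n hn => ?_
    simpa only [hn.1.2, and_false, if_false] using hn.1.1.trans_le hn.2
  · change (if _ then _ else _) ≤ p.up n
    split_ifs
    exacts [min_le_right _ _, le_rfl]
  · refine hB.mono fun n hn => ?_
    simpa only [hn, and_self, if_true] using (min_le_left _ _).trans_lt hn.1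

theorem not_evLE_up_lo (p : GapCond W) : ¬ EvLE p.up p.lo := not_evLE.2 p.lo_lt_up

variable (W) in
/-- the name of the lower half of the gap -/
def lower : PName.{u, 0} (GapCond W) := subName real fun f p => EvLE f p.lo

variable (W) in
/-- the name of the upper half of the gap -/
def upper : PName.{u, 0} (GapCond W) := subName real fun f p => EvLE p.up f

variable {p : GapCond W} {f x y x' y' : PName.{u, 0} (GapCond W)} {g h : ℕ → ℕ}

theorem lower_mono : ∀ (f : ℕ → ℕ) (p q : GapCond W), q ≤ p → EvLE f p.lo → EvLE f q.lo :=
  fun _ _ _ hq h => h.trans hq.1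

theorem upper_mono : ∀ (f : ℕ → ℕ) (p q : GapCond W), q ≤ p → EvLE p.up f → EvLE q.up f :=
  fun _ _ _ hq h => hq.2.1.trans h

theorem real_mem_lower_iff :
    Forces p (real g ∈' lower.{u} W) ↔ ∀ q ≤ p, ∃ r ≤ q, EvLE g r.lo :=
  Forces.mem_subName lower_mono Forces.real_inj

theorem real_mem_upper_iff :
    Forces p (real g ∈' upper.{u} W) ↔ ∀ q ≤ p, ∃ r ≤ q, EvLE r.up g :=
  Forces.mem_subName upper_mono Forces.real_inj

theorem real_mem_lower (h : EvLE g p.lo) : Forces p (real g ∈' lower.{u} W) :=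
  real_mem_lower_iff.2 fun q hq => ⟨q, le_rfl, lower_mono _ _ _ hq h⟩

theorem real_mem_upper (h : EvLE p.up g) : Forces p (real g ∈' upper.{u} W) :=
  real_mem_upper_iff.2 fun q hq => ⟨q, le_rfl, upper_mono _ _ _ hq h⟩

theorem lower_sub_groundReals (p : GapCond W) : Forces p (sub (lower.{u} W) groundReals) :=
  fun _ _ _ hx => Forces.mem_groundReals_iff.2 fun q hq =>
    let ⟨r, hr, g, _, h⟩ := (Forces.mem_subName_iff lower_mono).1 hx q hq
    ⟨r, hr, g, h⟩

theorem upper_sub_groundReals (p : GapCond W) : Forces p (sub (upper.{u} W) groundReals) :=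
  fun _ _ _ hx => Forces.mem_groundReals_iff.2 fun q hq =>
    let ⟨r, hr, g, _, h⟩ := (Forces.mem_subName_iff upper_mono).1 hx q hq
    ⟨r, hr, g, h⟩

theorem isDominating_lower_of_mem_upper (hy : Forces p (y ∈' upper.{u} W)) :
    Forces p (isDominating (omega _) (lower.{u} W) y) := by
  refine Forces.of_dense fun q hq => ?_
  obtain ⟨r, hr, g, hg, e⟩ := (Forces.mem_subName_iff upper_mono).1 hy q hq
  suffices h : Forces r (isDominating (omega _) (lower.{u} W) (real g)) from
    ⟨r, hr, h.congr (ForcedIff.isDominating Forces.eq_refl Forces.eq_refl e.eq_symm)⟩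
  refine Forces.and_iff.2 ⟨Forces.isFun_real g, fun f s hs hf =>
    Forces.of_dense fun s' hs' => ?_⟩
  obtain ⟨t, ht, h, hh, e'⟩ := (Forces.mem_subName_iff lower_mono).1 hf s' hs'
  have htr : t ≤ r := ht.trans (hs'.trans hs)
  exact ⟨t, ht, Forces.congr
    (Forces.leStar_real_iff.2 (hh.trans (t.lo_le_up.trans (htr.2.1.trans hg))))
    (ForcedIff.leStar Forces.eq_refl e'.eq_symm Forces.eq_refl)⟩

/-- Tightness of the gap. If the decided real `g` were not above the upper function, splitting would
give a condition whose lower function, itself a member of the lower half, is not below `g`. -/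
theorem mem_upper_of_isDominating_lower
    (hy : Forces p (isDominating (omega _) (lower.{u} W) y)) : Forces p (y ∈' upper.{u} W) := by
  obtain ⟨hfun, hy⟩ := Forces.and_iff.1 hy
  refine Forces.of_dense fun q hq => ?_
  obtain ⟨r, hr, g, hg⟩ := exists_eq_real (hfun.mono hq)
  have hlo : ∀ s ≤ r, EvLE s.lo g := fun s hs =>
    Forces.leStar_real_iff.1 (Forces.congr
      (hy (real s.lo) s (hs.trans (hr.trans hq)) (real_mem_lower (EvLE.refl _)))
      (ForcedIff.leStar Forces.eq_refl Forces.eq_refl (hg.mono hs)))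
  have hup : EvLE r.up g := by
    by_contra hc
    obtain ⟨s, hs, h⟩ := exists_split_lo (hlo r le_rfl) hc
    exact h (hlo s hs)
  exact ⟨r, hr, (real_mem_upper hup).mem_congr hg.eq_symm Forces.eq_refl⟩

theorem forces_existsLaflammeFamily [WellFoundedLT W] [Uncountable W] (p : GapCond W) :
    Forces p (existsLaflammeFamily : SetFml (PName.{u, 0} (GapCond W))) := by
  refine Forces.ex_intro (omega _) (Forces.ex_intro groundReals (Forces.ex_intro (lower W)
    (Forces.ex_intro (upper W) (Forces.ex_intro groundReals ?_))))
  simp only [Forces.and_iff]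
  refine ⟨Forces.isOmega_omega, fun f => mem_groundReals_iff_isFun f, lower_sub_groundReals p,
    ?_, fun y => Forces.iff_iff.2 fun q _ =>
      ⟨isDominating_lower_of_mem_upper, mem_upper_of_isDominating_lower⟩, ?_, ?_, ?_⟩
  · exact Forces.exIn_intro (real fun _ => 1) (Forces.real_mem_groundReals _)
      (Forces.and_iff.1 (isDominating_lower_of_mem_upper
        (real_mem_upper (Eventually.of_forall p.up_le_one)))).2
  · refine forces_isBoundingNumber (L := EvLE) (fun _ _ _ => Forces.leStar_real_iff)
      (fun _ _ _ _ _ hx hy => ForcedIff.leStar Forces.eq_refl hx hy) lower_sub_groundReals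
      (fun q C hC hCF => ?_) (fun q y hy => ?_) p
    · have := hC.to_subtype
      obtain ⟨r, hr, h⟩ := fusion q (fun (c : C) r => EvLE c r.lo)
        (fun c p r hr h => lower_mono _ _ _ hr h)
        (fun c p hp => real_mem_lower_iff.1 (hCF c c.2) p hp)
      exact ⟨r, hr, r.lo, real_mem_lower (EvLE.refl _), fun c hc => h ⟨c, hc⟩⟩
    · obtain ⟨r, hr, h⟩ := real_mem_lower_iff.1 hy q le_rfl
      obtain ⟨s, hs, h'⟩ := exists_split_lo (EvLE.refl r.lo) r.not_evLE_up_lo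
      exact ⟨s, hs.trans hr, s.lo, real_mem_lower (EvLE.refl _), fun hc => h' (hc.trans h)⟩
  · refine forces_isBoundingNumber (L := fun x y => EvLE y x) (fun _ _ _ => Forces.leStar_real_iff)
      (fun _ _ _ _ _ hx hy => ForcedIff.leStar Forces.eq_refl hy hx) upper_sub_groundReals
      (fun q C hC hCF => ?_) (fun q y hy => ?_) p
    · have := hC.to_subtype
      obtain ⟨r, hr, h⟩ := fusion q (fun (c : C) r => EvLE r.up c)
        (fun c p r hr h => upper_mono _ _ _ hr h)
        (fun c p hp => real_mem_upper_iff.1 (hCF c c.2) p hp)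
      exact ⟨r, hr, r.up, real_mem_upper (EvLE.refl _), fun c hc => h ⟨c, hc⟩⟩
    · obtain ⟨r, hr, h⟩ := real_mem_upper_iff.1 hy q le_rfl
      obtain ⟨s, hs, h'⟩ := exists_split_up (EvLE.refl r.up) r.not_evLE_up_lo
      exact ⟨s, hs.trans hr, s.up, real_mem_upper (EvLE.refl _), fun hc => h' (h.trans hc)⟩
  · refine forces_isBoundingNumber (L := EvLE) (fun _ _ _ => Forces.leStar_real_iff)
      (fun _ _ _ _ _ hx hy => ForcedIff.leStar Forces.eq_refl hx hy) (fun _ _ _ _ h => h)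
      (fun q C hC _ => ?_) (fun q y _ => ?_) p
    · rcases C.eq_empty_or_nonempty with rfl | hne
      · exact ⟨q, le_rfl, fun _ => 0, Forces.real_mem_groundReals _, fun c hc => hc.elim⟩
      · obtain ⟨e, rfl⟩ := hC.exists_eq_range hne
        obtain ⟨y, hy⟩ := exists_evLE_upper_bound e
        exact ⟨q, le_rfl, y, Forces.real_mem_groundReals _, Set.forall_mem_range.2 hy⟩
    · exact ⟨q, le_rfl, fun n => y n + 1, Forces.real_mem_groundReals _,
        not_evLE.2 (Frequently.of_forall fun n => Nat.lt_succ_self _)⟩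

end GapCond

/-! ### The model containing the family, and the theorem -/

theorem exists_isModelZFC_and_existsLaflammeFamily : ∃ (M : Type) (E : M → M → Prop),
    IsModelZFC E ∧ SetFml.Holds E SetFml.existsLaflammeFamily := by
  obtain ⟨W, _⟩ : ∃ W : Type, Uncountable W :=
    ⟨Set ℕ, not_countable_iff.1 fun _ => let ⟨f, hf⟩ := exists_injective_nat (Set ℕ)
      Function.cantor_injective f hf⟩
  obtain ⟨_, _⟩ := exists_wellFoundedLT W
  obtain ⟨G⟩ := exists_genericSequence.{0} (⊤ : GapCond W)
  exact ⟨G.Model, G.Mem, G.isModelZFC, G.holds_of_forces (φ := Fml.existsLaflammeFamily) []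
    fun p => GapCond.forces_existsLaflammeFamily p⟩

theorem mainTheorem7 :
    (∀ p : HechlerND,
      Forces p (SetFml.countableLowerBounds (PName.groundReals : PName.{u, 0} HechlerND))) ∧
    (∃ (M : Type) (E : M → M → Prop),
      IsModelZFC E ∧ SetFml.Holds E SetFml.existsLaflammeFamily) :=
  ⟨HechlerND.forces_countableLowerBounds, exists_isModelZFC_and_existsLaflammeFamily⟩
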